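/- Let $k_0,k_1\in\mathbb{R}$ satisfy $-\tfrac12<k_0+k_1<\tfrac12$ and $-\tfrac12<k_0-k_1<\tfrac12$. **Dunkl operators and forms.** Let $\mathcal P_V$ be the space of vector polynomials $f(x,t)=f_1(x)t_1+f_2(x)t_2$, $x\in\mathbb{R}^2$, also written $f=(f_1,f_2)$. The group $W=W(B_2)$ of symmetries of the square acts on row vectors; the reflections along $v=(1,0),(0,1)$ carry the parameter $\kappa(v)=k_1$, those along $v=(1,-1),(1,1)$ carry $\kappa(v)=k_0$. For $i=1,2$ put $$\mathcal D_i f(x,t)=\frac{\partial f}{\partial x_i}(x,t)+\sum_{v}\kappa(v)\,\frac{f(x,t\sigma_v)-f(x\sigma_v,t\sigma_v)}{\langle x,v\rangle}\,v_i ,\qquad \Delta_\kappa=\mathcal D_1^2+\mathcal D_2^2 ,$$ the sum being over these four $v$, with $\sigma_v$ the reflection along $v$. With $t_1,t_2$ orthonormal, let $$\langle f,g\rangle_\tau=\sum_{i=1}^2\big\langle t_i,f_i(\mathcal D_1,\mathcal D_2)g\big\rangle\big|_{x=0},\qquad \langle f,g\rangle_G=\big\langle e^{\Delta_\kappa/2}f,e^{\Delta_\kappa/2}g\big\rangle_\tau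 ,$$ and let $\langle\cdot,\cdot\rangle_S$ be the bilinear form such that, for $f,g\in\mathcal P_V$ homogeneous of degrees $n,m$, $\langle f,g\rangle_S=\frac{1}{2^\ell\ell!}\langle f,g\rangle_G$ with $\ell=\frac{m+n}2$ if $m\equiv n \bmod 2$, and $\langle f,g\rangle_S=0$ otherwise. **The matrix weight.** For $0<x_2<x_1$ and $u=x_2/x_1$ let $K(x)=L(u)^T\operatorname{diag}(d_1,d_2)L(u)$, where, with $F={}_2F_1$, $$\begin{aligned} L_{11}&=u^{k_1}(1-u^2)^{-k_0}F\big(-k_0,\tfrac12-k_0+k_1;k_1+\tfrac12;u^2\big),\\ L_{12}&=-\tfrac{k_0}{k_1+1/2}\,u^{k_1}(1-u^2)^{-k_0}\,u\,F\big(1-k_0,\tfrac12-k_0+k_1;k_1+\tfrac32;u^2\big),\\ L_{21}&=-\tfrac{k_0}{1/2-k_1}\,u^{-k_1}(1-u^2)^{-k_0}\,u\,F\big(1-k_0,\tfrac12-k_0-k_1;\tfrac32-k_1;u^2\big),\\ L_{22}&=u^{-k_1}(1-u^2)^{-k_0}F\big(-k_0,\tfrac12-k_0-k_1;\tfrac12-k_1;u^2\big),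 \end{aligned}$$ $$d_1=\frac{c\,\Gamma(\frac12-k_1)^2}{\cos\pi k_0\,\Gamma(\frac12+k_0-k_1)\Gamma(\frac12-k_0-k_1)},\qquad d_2=\frac{c\,\Gamma(\frac12+k_1)^2}{\cos\pi k_0\,\Gamma(\frac12+k_0+k_1)\Gamma(\frac12-k_0+k_1)} .$$ Extend $K$ to almost all of $\mathbb{R}^2$ by $K(xw)=w^{-1}K(x)w$ for $w\in W$. The constant $c=c(k_0,k_1)$ is the one for which $\int_{\mathbb{R}^2}K(x)_{11}\,e^{-|x|^2/2}\,dx=1$. **Statement.** Let $\phi=x_1^2-x_2^2$, $p_{1,2}=-x_2t_1+x_1t_2$, $p_{1,4}=-x_2t_1-x_1t_2$ and $x_\theta=(\cos\theta,\sin\theta)$. Then for every integer $n\ge 0$ the integral below converges and $$\big\langle\phi^{2n+1}p_{1,4},p_{1,2}\big\rangle_S=8\int_0^{\pi/4}\phi(x_\theta)^{2n+1}\,p_{1,4}(x_\theta)\,K(x_\theta)\,p_{1,2}(x_\theta)^T\,d\theta ,$$ and, as $n\to\infty$ (where $a(n)\sim b(n)$ means $a(n)/b(n)\to1$), $$\big\langle\phi^{2n+1}p_{1,4},p_{1,2}\big\rangle_S\sim\frac{-2\pi\,c(k_0,k_1)}{\cos\pi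 k_0\,\cos\pi k_1}\cdot\frac{2^{2k_1}\,n^{k_1-1/2}\,\Gamma(\frac12+k_1)}{\Gamma(\frac12+k_0+k_1)\,\Gamma(\frac12-k_0+k_1)} .$$ -/

import Mathlib

open scoped Matrix

noncomputable section

namespace DunklB2

/-- Scalar polynomials in `x₁, x₂` (indices `0, 1`). -/
abbrev Poly : Type := MvPolynomial (Fin 2) ℝ

/-- `P_V`, `V = span {t₁, t₂}`: the vector polynomial `f₁(x) t₁ + f₂(x) t₂` is stored as its
coefficient vector `(f₁, f₂)`. -/
abbrev VPoly : Type := Fin 2 → Poly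

/-! ### The reflections of `W(B₂)` and the Dunkl operators -/

/-- The four positive roots `(1,0), (0,1), (1,-1), (1,1)`. -/
def root : Fin 4 → Fin 2 → ℝ := ![![1, 0], ![0, 1], ![1, -1], ![1, 1]]

/-- The parameter attached to a positive root: `k₁` for `(1,0), (0,1)` and `k₀` for `(1,∓1)`. -/
def mult (k₀ k₁ : ℝ) : Fin 4 → ℝ := ![k₁, k₁, k₀, k₀]

/-- The matrix of the reflection along each positive root; it acts on row vectors by `x ↦ x σ`. -/
def refl : Fin 4 → Matrix (Fin 2) (Fin 2) ℝ :=
  ![!![-1, 0; 0, 1], !![1, 0; 0, -1], !![0, 1; 1, 0], !![0, -1; -1, 0]]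

/-- The linear polynomial `⟨x, v⟩`. -/
def linForm (v : Fin 2 → ℝ) : Poly := ∑ j, MvPolynomial.C (v j) * MvPolynomial.X j

/-- `p(x) ↦ p(x w)`. -/
def actX (w : Matrix (Fin 2) (Fin 2) ℝ) (p : Poly) : Poly :=
  MvPolynomial.aeval (fun i => linForm (fun j => w j i)) p

/-- `f(x, t) ↦ f(x, t w)`, on coefficient vectors. -/
def actT (w : Matrix (Fin 2) (Fin 2) ℝ) (f : VPoly) : VPoly := fun j => ∑ i, w j i • f i

open Classical in
/-- The quotient `a / b` of polynomials when `b` divides `a` (and `0` otherwise). -/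
def exactDiv (a b : Poly) : Poly := if h : b ∣ a then h.choose else 0

theorem exactDiv_eq {a b q : Poly} (hb : b ≠ 0) (h : a = b * q) : exactDiv a b = q := by
  have hd : b ∣ a := ⟨q, h⟩
  unfold exactDiv
  rw [dif_pos hd]
  exact mul_left_cancel₀ hb (hd.choose_spec.symm.trans h)

/-- The division in the Dunkl operators is always exact. -/
theorem linForm_root_dvd (r : Fin 4) (p : Poly) : linForm (root r) ∣ p - actX (refl r) p := by
  induction p using MvPolynomial.induction_on with
  | C a => simp [actX]
  | add p q hp hq =>
    have : p + q - actX (refl r) (p + q) = (p - actX (refl r) p) + (q - actX (refl r) q) := by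
      simp only [actX, map_add]; ring
    rw [this]; exact dvd_add hp hq
  | mul_X p i hp =>
    have h2 : p * MvPolynomial.X i - actX (refl r) (p * MvPolynomial.X i)
        = (p - actX (refl r) p) * MvPolynomial.X i
          + actX (refl r) p * (MvPolynomial.X i - linForm (fun j => refl r j i)) := by
      simp only [actX, map_mul, MvPolynomial.aeval_X]; ring
    rw [h2]
    refine dvd_add (hp.mul_right _) (Dvd.dvd.mul_left ?_ _)
    fin_cases r <;> fin_cases i <;>
      simp [linForm, root, refl, Fin.sum_univ_two, ← two_mul, sub_eq_add_neg, add_comm]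
    exact ⟨-1, by ring⟩

/-- The Dunkl operator
`D_i f(x,t) = ∂f/∂x_i + ∑_v κ(v) v_i (f(x, t σ_v) - f(x σ_v, t σ_v)) / ⟨x, v⟩`. -/
def dunkl (k₀ k₁ : ℝ) (i : Fin 2) (f : VPoly) : VPoly := fun j =>
  MvPolynomial.pderiv i (f j) +
    ∑ r : Fin 4, (mult k₀ k₁ r * root r i) •
      exactDiv (actT (refl r) f j - actX (refl r) (actT (refl r) f j)) (linForm (root r))

/-- `Δ_κ = D₁² + D₂²`. -/
def lapK (k₀ k₁ : ℝ) (f : VPoly) : VPoly :=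
  dunkl k₀ k₁ 0 (dunkl k₀ k₁ 0 f) + dunkl k₀ k₁ 1 (dunkl k₀ k₁ 1 f)

/-- `p(D) g = p(D₁, D₂) g` for a scalar polynomial `p`. -/
def applyD (k₀ k₁ : ℝ) (p : Poly) (g : VPoly) : VPoly :=
  ∑ m ∈ p.support, p.coeff m • (dunkl k₀ k₁ 0)^[m 0] ((dunkl k₀ k₁ 1)^[m 1] g)

/-! ### The bilinear forms -/

/-- `⟨f, g⟩_τ = ⟨t₁, f₁(D) g⟩|_{x=0} + ⟨t₂, f₂(D) g⟩|_{x=0}`, with `t₁, t₂` orthonormal. -/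
def formTau (k₀ k₁ : ℝ) (f g : VPoly) : ℝ :=
  ∑ i, MvPolynomial.eval 0 (applyD k₀ k₁ (f i) g i)

/-- The degree of a vector polynomial. -/
def vdeg (f : VPoly) : ℕ := max (f 0).totalDegree (f 1).totalDegree

/-- `e^{Δ_κ/2} f`. As `Δ_κ` lowers degrees by two, the terms with `j > vdeg f` vanish. -/
def expLap (k₀ k₁ : ℝ) (f : VPoly) : VPoly :=
  ∑ j ∈ Finset.range (vdeg f + 1), ((2 : ℝ) ^ j * (j.factorial : ℝ))⁻¹ • (lapK k₀ k₁)^[j] f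

/-- The abstract Gaussian form `⟨f, g⟩_G = ⟨e^{Δ_κ/2} f, e^{Δ_κ/2} g⟩_τ`. -/
def formG (k₀ k₁ : ℝ) (f g : VPoly) : ℝ :=
  formTau k₀ k₁ (expLap k₀ k₁ f) (expLap k₀ k₁ g)

/-- The homogeneous component of degree `n`. -/
def vcomp (n : ℕ) (f : VPoly) : VPoly := fun i => MvPolynomial.homogeneousComponent n (f i)

/-- The form `⟨f, g⟩_S`: for `f`, `g` homogeneous of degrees `n`, `m` it is `⟨f, g⟩_G / (2^ℓ ℓ!)`
with `ℓ = (m + n) / 2` if `m ≡ n mod 2`, and `0` otherwise; it is extended bilinearly. -/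
def formS (k₀ k₁ : ℝ) (f g : VPoly) : ℝ :=
  ∑ n ∈ Finset.range (vdeg f + 1), ∑ m ∈ Finset.range (vdeg g + 1),
    if n % 2 = m % 2 then
      ((2 : ℝ) ^ ((m + n) / 2) * (((m + n) / 2).factorial : ℝ))⁻¹ *
        formG k₀ k₁ (vcomp n f) (vcomp m g)
    else 0

/-! ### The polynomials `φ`, `p_{1,2}`, `p_{1,4}` -/

/-- `φ = x₁² - x₂²`. -/
def phi : Poly := MvPolynomial.X 0 ^ 2 - MvPolynomial.X 1 ^ 2

/-- `p_{1,2} = -x₂ t₁ + x₁ t₂`. -/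
def p12 : VPoly := ![-MvPolynomial.X 1, MvPolynomial.X 0]

/-- `p_{1,4} = -x₂ t₁ - x₁ t₂`. -/
def p14 : VPoly := ![-MvPolynomial.X 1, -MvPolynomial.X 0]

/-- The value of a vector polynomial at a point. -/
def vEval (x : Fin 2 → ℝ) (f : VPoly) : Fin 2 → ℝ := fun i => MvPolynomial.eval x (f i)

/-- The point `x_θ = (cos θ, sin θ)`. -/
def circlePt (θ : ℝ) : Fin 2 → ℝ := ![Real.cos θ, Real.sin θ]

/-! ### The matrix weight -/

/-- The matrix `L(u)`, `0 < u < 1`. -/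
def matL (k₀ k₁ u : ℝ) : Matrix (Fin 2) (Fin 2) ℝ :=
  !![|u| ^ k₁ * (1 - u ^ 2) ^ (-k₀) *
        ordinaryHypergeometric (-k₀) (1 / 2 - k₀ + k₁) (k₁ + 1 / 2) (u ^ 2),
     -(k₀ / (k₁ + 1 / 2)) * |u| ^ k₁ * (1 - u ^ 2) ^ (-k₀) * u *
        ordinaryHypergeometric (1 - k₀) (1 / 2 - k₀ + k₁) (k₁ + 3 / 2) (u ^ 2);
     -(k₀ / (1 / 2 - k₁)) * |u| ^ (-k₁) * (1 - u ^ 2) ^ (-k₀) * u *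
        ordinaryHypergeometric (1 - k₀) (1 / 2 - k₀ - k₁) (3 / 2 - k₁) (u ^ 2),
     |u| ^ (-k₁) * (1 - u ^ 2) ^ (-k₀) *
        ordinaryHypergeometric (-k₀) (1 / 2 - k₀ - k₁) (1 / 2 - k₁) (u ^ 2)]

/-- `d₁` for the scalar `c`. -/
def d1 (k₀ k₁ c : ℝ) : ℝ :=
  c * (Real.Gamma (1 / 2 - k₁) ^ 2 /
    (Real.cos (Real.pi * k₀) * Real.Gamma (1 / 2 + k₀ - k₁) * Real.Gamma (1 / 2 - k₀ - k₁)))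

/-- `d₂` for the scalar `c`. -/
def d2 (k₀ k₁ c : ℝ) : ℝ :=
  c * (Real.Gamma (1 / 2 + k₁) ^ 2 /
    (Real.cos (Real.pi * k₀) * Real.Gamma (1 / 2 + k₀ + k₁) * Real.Gamma (1 / 2 - k₀ + k₁)))

/-- `L(u)ᵀ diag(d₁, d₂) L(u)`, `u = x₂ / x₁`: the weight on the chamber `0 < x₂ < x₁`, for the
scalar `c`. -/
def chamberWeight (k₀ k₁ c : ℝ) (x : Fin 2 → ℝ) : Matrix (Fin 2) (Fin 2) ℝ :=
  (matL k₀ k₁ (x 1 / x 0))ᵀ * Matrix.diagonal ![d1 k₀ k₁ c, d2 k₀ k₁ c] * matL k₀ k₁ (x 1 / x 0)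

/-- For `x` off the mirrors: the element `w` of `W(B₂)` with `x = y w`, `0 < y₂ < y₁`. -/
def chamberElt (x : Fin 2 → ℝ) : Matrix (Fin 2) (Fin 2) ℝ :=
  if |x 1| < |x 0| then !![Real.sign (x 0), 0; 0, Real.sign (x 1)]
  else !![0, Real.sign (x 1); Real.sign (x 0), 0]

/-- The weight on the plane for the scalar `c`, extended from the chamber by
`K(y w) = w⁻¹ K(y) w` for `w` in `W(B₂)` (here `w⁻¹ = wᵀ`, and `y = x w⁻¹`). Its values on the
mirrors, a null set, are irrelevant. -/
def weight (k₀ k₁ c : ℝ) (x : Fin 2 → ℝ) : Matrix (Fin 2) (Fin 2) ℝ :=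
  (chamberElt x)ᵀ * chamberWeight k₀ k₁ c (x ᵥ* (chamberElt x)ᵀ) * chamberElt x

/-- The normalizing constant `c(k₀, k₁)`: the scalar `c` for which the weight satisfies
`∫_{ℝ²} (1,0) K(x) (1,0)ᵀ e^{-|x|²/2} dx = 1` (the weight is linear in `c`). -/
def normConst (k₀ k₁ : ℝ) : ℝ :=
  (∫ x : Fin 2 → ℝ, weight k₀ k₁ 1 x 0 0 * Real.exp (-(x 0 ^ 2 + x 1 ^ 2) / 2))⁻¹

/-- The normalized matrix weight `K(x)`. -/
def matK (k₀ k₁ : ℝ) (x : Fin 2 → ℝ) : Matrix (Fin 2) (Fin 2) ℝ :=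
  weight k₀ k₁ (normConst k₀ k₁) x

end DunklB2

end

noncomputable section

namespace DunklB2

/-! ### Algebra: the form against `p12` reduces to a recurrence. -/

section Algebra

open MvPolynomial

/-! ### Divided differences and Dunkl operators as linear maps -/

/-! The form and the integral are matched because both obey one and the same recurrence in `n`, with
the same initial data.

Algebraic side. Both `D_i p₁₂` are constants, so `Δ_κ p₁₂ = 0`, and for `f` homogeneous of degree
`2L + 1` the number `⟨f, p₁₂⟩_S` is a fixed multiple of a functional on the linear polynomial `Δ_κ^L
f` (`formS_p12`). The operator `Δ_κ` sends `φ^(2b+2) p₁₂` to a combination of `|x|² φ^(2b) p₁₂` and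
`φ^(2b+1) p₁₄`, and similarly for `φ^(2b+3) p₁₄` (`lapL_phi_pow_p12`, `lapL_phi_pow_p14`). By the
commutator `[Δ_κ, |x|²] = 4(E + 1)`, with `E` the Euler operator, the normalization of `S` is
exactly the one that makes a factor `|x|²` invisible (`pairing_sqNorm_smul`). This closes a
recurrence that couples the two families (`formS_eq_of_recurrence`).

Analytic side. The rows of `L` solve a first-order linear system in `u` (`isRowSolution_row`), so
the trace `T`, the diagonal difference `G` and twice the off-diagonal entry `B` of `K` solve a
linear system along the arc. Integrating derivatives of `cos^n(2θ)` times `T`, `G`, `B` and suitable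
factors gives moment relations (`moment_G`, `moment_B`, `moment_T`) whose combinations are that
recurrence. The boundary terms must vanish. At `θ = 0` this follows from `|k₁| < 1/2` and `B → 0`.
At `θ = π/4` it follows from `|k₀| < 1/2` and `G → 0`, and the latter is what the ratio `d₁ : d₂` is
made for (`d_balance`, `tendsto_wtDiff`). Finding the limit of `G` needs the rows at `u = 1`:
Gauss's value by way of Euler's integral, a contiguous relation, and the symmetry `k₀ → -k₀`
(`row_neg`). The choice of `c` supplies the initial value.

Asymptotics. The factor `cos^(2n)(2θ)` concentrates the integral at `θ = 0`, where the density is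
comparable to `(sin 2θ)^(-2k₁)`. A Laplace-type comparison (`tendsto_integral_div_of_peak`) reduces
the moments to explicit Beta integrals governed by Euler's limit for `Γ`, and the reflection formula
puts the constant in its final form. -/

theorem linForm_root_ne_zero (r : Fin 4) : linForm (root r) ≠ 0 := by
  intro h
  have h1 := congrArg (MvPolynomial.eval (root r)) h
  fin_cases r <;> norm_num [linForm, root, Fin.sum_univ_two] at h1

/-- The divided difference `(p(x) - p(x σ)) / ⟨x, v⟩` along the positive root `v` of index `r`. -/
def divDiff (r : Fin 4) : Poly →ₗ[ℝ] Poly where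
  toFun p := exactDiv (p - actX (refl r) p) (linForm (root r))
  map_add' p q := by
    obtain ⟨a, ha⟩ := linForm_root_dvd r p
    obtain ⟨b, hb⟩ := linForm_root_dvd r q
    rw [exactDiv_eq (linForm_root_ne_zero r) ha, exactDiv_eq (linForm_root_ne_zero r) hb]
    refine exactDiv_eq (linForm_root_ne_zero r) ?_
    rw [mul_add, ← ha, ← hb]
    simp only [actX, map_add]
    ring
  map_smul' c p := by
    obtain ⟨a, ha⟩ := linForm_root_dvd r p
    rw [exactDiv_eq (linForm_root_ne_zero r) ha]
    refine exactDiv_eq (linForm_root_ne_zero r) ?_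
    rw [RingHom.id_apply, mul_smul_comm, ← ha]
    simp only [actX, map_smul, smul_sub]

theorem divDiff_eq {r : Fin 4} {p q : Poly} (h : p - actX (refl r) p = linForm (root r) * q) :
    divDiff r p = q :=
  exactDiv_eq (linForm_root_ne_zero r) h

theorem linForm_mul_divDiff (r : Fin 4) (p : Poly) :
    linForm (root r) * divDiff r p = p - actX (refl r) p := by
  obtain ⟨a, ha⟩ := linForm_root_dvd r p
  rw [divDiff_eq ha, ha]

theorem divDiff_C_mul (r : Fin 4) (a : ℝ) (p : Poly) : divDiff r (C a * p) = C a * divDiff r p := by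
  rw [C_mul', C_mul', map_smul]

theorem divDiff_mul_of_invariant {r : Fin 4} {h : Poly} (hh : actX (refl r) h = h) (p : Poly) :
    divDiff r (h * p) = h * divDiff r p := by
  refine divDiff_eq ?_
  rw [mul_left_comm, linForm_mul_divDiff]
  have : actX (refl r) (h * p) = actX (refl r) h * actX (refl r) p := by simp only [actX, map_mul]
  rw [this, hh]
  ring

theorem actX_add (w : Matrix (Fin 2) (Fin 2) ℝ) (p q : Poly) :
    actX w (p + q) = actX w p + actX w q := by simp only [actX, map_add]

theorem actX_sub (w : Matrix (Fin 2) (Fin 2) ℝ) (p q : Poly) :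
    actX w (p - q) = actX w p - actX w q := by simp only [actX, map_sub]

theorem actX_mul (w : Matrix (Fin 2) (Fin 2) ℝ) (p q : Poly) :
    actX w (p * q) = actX w p * actX w q := by simp only [actX, map_mul]

theorem actX_pow (w : Matrix (Fin 2) (Fin 2) ℝ) (p : Poly) (n : ℕ) :
    actX w (p ^ n) = actX w p ^ n := by simp only [actX, map_pow]

theorem actX_C (w : Matrix (Fin 2) (Fin 2) ℝ) (a : ℝ) : actX w (C a) = C a := by
  simp [actX]

theorem actX_refl_X (r : Fin 4) :
    actX (refl r) (X 0) = ![-X 0, X 0, X 1, -X 1] r ∧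
    actX (refl r) (X 1) = ![X 1, -X 1, X 0, -X 0] r := by
  fin_cases r <;> simp [actX, linForm, refl, Fin.sum_univ_two]

theorem linForm_root (r : Fin 4) :
    linForm (root r) = ![X 0, X 1, X 0 - X 1, X 0 + X 1] r := by
  fin_cases r <;> simp [linForm, root, Fin.sum_univ_two, sub_eq_add_neg]

theorem dunkl_zero_zero (k₀ k₁ : ℝ) (f : VPoly) :
    dunkl k₀ k₁ 0 f 0 = pderiv 0 (f 0) - C k₁ * divDiff 0 (f 0) + C k₀ * divDiff 2 (f 1)
      - C k₀ * divDiff 3 (f 1) := by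
  have h : ∀ r p, exactDiv (p - actX (refl r) p) (linForm (root r)) = divDiff r p := fun _ _ => rfl
  simp only [dunkl, h, Fin.sum_univ_four]
  simp [mult, root, actT, refl, Fin.sum_univ_two, smul_eq_C_mul]
  ring

theorem dunkl_zero_one (k₀ k₁ : ℝ) (f : VPoly) :
    dunkl k₀ k₁ 0 f 1 = pderiv 0 (f 1) + C k₁ * divDiff 0 (f 1) + C k₀ * divDiff 2 (f 0)
      - C k₀ * divDiff 3 (f 0) := by
  have h : ∀ r p, exactDiv (p - actX (refl r) p) (linForm (root r)) = divDiff r p := fun _ _ => rfl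
  simp only [dunkl, h, Fin.sum_univ_four]
  simp [mult, root, actT, refl, Fin.sum_univ_two, smul_eq_C_mul]
  ring

theorem dunkl_one_zero (k₀ k₁ : ℝ) (f : VPoly) :
    dunkl k₀ k₁ 1 f 0 = pderiv 1 (f 0) + C k₁ * divDiff 1 (f 0) - C k₀ * divDiff 2 (f 1)
      - C k₀ * divDiff 3 (f 1) := by
  have h : ∀ r p, exactDiv (p - actX (refl r) p) (linForm (root r)) = divDiff r p := fun _ _ => rfl
  simp only [dunkl, h, Fin.sum_univ_four]
  simp [mult, root, actT, refl, Fin.sum_univ_two, smul_eq_C_mul]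
  ring

theorem dunkl_one_one (k₀ k₁ : ℝ) (f : VPoly) :
    dunkl k₀ k₁ 1 f 1 = pderiv 1 (f 1) - C k₁ * divDiff 1 (f 1) - C k₀ * divDiff 2 (f 0)
      - C k₀ * divDiff 3 (f 0) := by
  have h : ∀ r p, exactDiv (p - actX (refl r) p) (linForm (root r)) = divDiff r p := fun _ _ => rfl
  simp only [dunkl, h, Fin.sum_univ_four]
  simp [mult, root, actT, refl, Fin.sum_univ_two, smul_eq_C_mul]
  ring

/-- The Dunkl operator as a linear map. -/
def dunklL (k₀ k₁ : ℝ) (i : Fin 2) : VPoly →ₗ[ℝ] VPoly where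
  toFun := dunkl k₀ k₁ i
  map_add' f g := by
    ext1 j
    fin_cases i <;> fin_cases j <;>
      simp [dunkl_zero_zero, dunkl_zero_one, dunkl_one_zero, dunkl_one_one] <;> ring
  map_smul' c f := by
    ext1 j
    fin_cases i <;> fin_cases j <;>
      simp [dunkl_zero_zero, dunkl_zero_one, dunkl_one_zero, dunkl_one_one, smul_eq_C_mul,
        divDiff_C_mul] <;> ring

theorem dunklL_apply (k₀ k₁ : ℝ) (i : Fin 2) (f : VPoly) : dunklL k₀ k₁ i f = dunkl k₀ k₁ i f := rfl

/-- The Dunkl Laplacian as a linear map. -/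
def lapL (k₀ k₁ : ℝ) : VPoly →ₗ[ℝ] VPoly :=
  dunklL k₀ k₁ 0 ∘ₗ dunklL k₀ k₁ 0 + dunklL k₀ k₁ 1 ∘ₗ dunklL k₀ k₁ 1

theorem lapL_apply (k₀ k₁ : ℝ) (f : VPoly) : lapL k₀ k₁ f =
    dunklL k₀ k₁ 0 (dunklL k₀ k₁ 0 f) + dunklL k₀ k₁ 1 (dunklL k₀ k₁ 1 f) := rfl

theorem lapK_iterate (k₀ k₁ : ℝ) (j : ℕ) (f : VPoly) :
    (lapK k₀ k₁)^[j] f = (lapL k₀ k₁ ^ j) f := by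
  rw [Module.End.pow_apply]
  rfl

/-- A factor fixed by all four reflections passes through every divided difference, so only the
derivative sees it and the ordinary Leibniz rule survives. It is applied to `|x|²` and to even
powers of `φ`. -/
theorem dunklL_mul_of_invariant (k₀ k₁ : ℝ) (i : Fin 2) {h : Poly}
    (hh : ∀ r, actX (refl r) h = h) (f : VPoly) :
    dunklL k₀ k₁ i (h • f) = pderiv i h • f + h • dunklL k₀ k₁ i f := by
  ext1 j
  fin_cases i <;> fin_cases j <;>
    simp [dunklL_apply, dunkl_zero_zero, dunkl_zero_one, dunkl_one_zero, dunkl_one_one,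
      divDiff_mul_of_invariant (hh _)] <;> ring

/-! ### The Euler operator -/

/-- The Euler derivation `x₁ ∂₁ + x₂ ∂₂`. -/
def euler : Derivation ℝ Poly Poly := (X 0 : Poly) • pderiv 0 + (X 1 : Poly) • pderiv 1

theorem euler_apply (p : Poly) : euler p = X 0 * pderiv 0 p + X 1 * pderiv 1 p := rfl

theorem euler_X (i : Fin 2) : euler (X i) = X i := by
  fin_cases i <;> simp [euler_apply, pderiv_X]

theorem euler_actX (r : Fin 4) (p : Poly) :
    euler (actX (refl r) p) = actX (refl r) (euler p) := by
  induction p using MvPolynomial.induction_on with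
  | C a => simp [actX]
  | add p q hp hq => simp only [actX_add, map_add, hp, hq]
  | mul_X p i hp =>
    have hX : euler (actX (refl r) (X i)) = actX (refl r) (X i) := by
      fin_cases i
      · rw [Fin.zero_eta, (actX_refl_X r).1]
        fin_cases r <;> simp [euler_X]
      · rw [Fin.mk_one, (actX_refl_X r).2]
        fin_cases r <;> simp [euler_X]
    rw [actX_mul, Derivation.leibniz, Derivation.leibniz, hp, hX, euler_X]
    simp only [smul_eq_mul, actX_add, actX_mul]

theorem euler_linForm_root (r : Fin 4) : euler (linForm (root r)) = linForm (root r) := by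
  rw [linForm_root]
  fin_cases r <;> simp [euler_X]

/-- Divided differences lower the degree by one: apply the Euler derivation to `⟨x, v⟩ · divDiff r p
= p - p σ`, using that it commutes with `σ` and fixes `⟨x, v⟩`, then cancel `⟨x, v⟩`. -/
theorem euler_divDiff (r : Fin 4) (p : Poly) :
    euler (divDiff r p) = divDiff r (euler p) - divDiff r p := by
  have h := congrArg euler (linForm_mul_divDiff r p)
  rw [Derivation.leibniz, euler_linForm_root, map_sub, euler_actX, ← linForm_mul_divDiff r (euler p),
    smul_eq_mul, smul_eq_mul] at h
  refine mul_left_cancel₀ (linForm_root_ne_zero r) ?_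
  linear_combination h

theorem euler_pderiv (i : Fin 2) (p : Poly) :
    euler (pderiv i p) = pderiv i (euler p) - pderiv i p := by
  have hc : pderiv 0 (pderiv 1 p) = pderiv 1 (pderiv 0 p) := by
    -- The commutator of two derivations is a derivation, and this one kills both variables.
    have h : ⁅(pderiv 0 : Derivation ℝ Poly Poly), (pderiv 1 : Derivation ℝ Poly Poly)⁆ = 0 :=
      derivation_ext fun i => by
        fin_cases i <;> simp [Derivation.commutator_apply, pderiv_X]
    refine sub_eq_zero.1 ?_
    rw [← Derivation.commutator_apply, h]
    rfl
  fin_cases i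
  · simp only [euler_apply, map_add, Derivation.leibniz, smul_eq_mul, Fin.zero_eta, pderiv_X, hc]
    simp
    ring
  · simp only [euler_apply, map_add, Derivation.leibniz, smul_eq_mul, Fin.mk_one, pderiv_X, hc]
    simp
    ring

/-- The Euler operator on vector polynomials. -/
def eulerV (f : VPoly) : VPoly := fun i => euler (f i)

/-- Homogeneity is carried as an eigenvalue equation for the Euler operator. In that form it passes
through Dunkl operators by pure algebra, and degrees may be negative without harm. -/
theorem eulerV_dunklL (k₀ k₁ : ℝ) (i : Fin 2) (f : VPoly) :
    eulerV (dunklL k₀ k₁ i f) = dunklL k₀ k₁ i (eulerV f) - dunklL k₀ k₁ i f := by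
  ext1 j
  fin_cases i <;> fin_cases j <;>
    simp [eulerV, dunklL_apply, dunkl_zero_zero, dunkl_zero_one, dunkl_one_zero, dunkl_one_one,
      euler_divDiff, euler_pderiv] <;> ring

theorem eulerV_dunklL_of_eq {k₀ k₁ : ℝ} {i : Fin 2} {f : VPoly} {d : ℝ} (hf : eulerV f = d • f) :
    eulerV (dunklL k₀ k₁ i f) = (d - 1) • dunklL k₀ k₁ i f := by
  rw [eulerV_dunklL, hf, map_smul, sub_smul, one_smul]

theorem eulerV_lapL_of_eq {k₀ k₁ : ℝ} {f : VPoly} {d : ℝ} (hf : eulerV f = d • f) :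
    eulerV (lapL k₀ k₁ f) = (d - 2) • lapL k₀ k₁ f := by
  have h : ∀ g h : VPoly, eulerV (g + h) = eulerV g + eulerV h := fun g h => by
    ext1 i; simp [eulerV]
  rw [lapL_apply, h, eulerV_dunklL_of_eq (eulerV_dunklL_of_eq hf),
    eulerV_dunklL_of_eq (eulerV_dunklL_of_eq hf), smul_add]
  congr 2 <;> ring

theorem eulerV_lapL_pow_of_eq {k₀ k₁ : ℝ} {f : VPoly} {d : ℝ} (hf : eulerV f = d • f) (j : ℕ) :
    eulerV ((lapL k₀ k₁ ^ j) f) = (d - 2 * j) • (lapL k₀ k₁ ^ j) f := by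
  induction j with
  | zero => simpa using hf
  | succ j ih =>
    rw [pow_succ', Module.End.mul_apply, eulerV_lapL_of_eq ih]
    push_cast
    congr 1
    ring

/-! ### The commutator of the Dunkl Laplacian with `|x|²` -/

/-- `x₁² + x₂²`. -/
def sqNorm : Poly := X 0 ^ 2 + X 1 ^ 2

theorem actX_sqNorm (r : Fin 4) : actX (refl r) sqNorm = sqNorm := by
  rw [sqNorm, actX_add, actX_pow, actX_pow, (actX_refl_X r).1, (actX_refl_X r).2]
  fin_cases r <;> simp <;> ring

/-- After multiplication by `⟨x, v⟩` the left side becomes `2⟨x, v⟩ p - (⟨x σ, v⟩ + ⟨x, v⟩)(p σ)`,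
and `⟨x σ, v⟩ = -⟨x, v⟩`. -/
theorem root_sum_divDiff (r : Fin 4) (p : Poly) :
    C (root r 0) * (divDiff r (X 0 * p) + X 0 * divDiff r p) +
      C (root r 1) * (divDiff r (X 1 * p) + X 1 * divDiff r p) = 2 * p := by
  refine mul_left_cancel₀ (linForm_root_ne_zero r) ?_
  have h0 := linForm_mul_divDiff r (X 0 * p)
  have h1 := linForm_mul_divDiff r (X 1 * p)
  have h2 := linForm_mul_divDiff r p
  rw [actX_mul, (actX_refl_X r).1] at h0
  rw [actX_mul, (actX_refl_X r).2] at h1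
  rw [linForm_root] at h0 h1 h2 ⊢
  fin_cases r
  · simp [root, -mul_eq_mul_left_iff] at h0 h1 h2 ⊢
    refine mul_left_cancel₀ (X_ne_zero (R := ℝ) (0 : Fin 2)) ?_
    linear_combination h0 + X 0 * h2
  · simp [root, -mul_eq_mul_left_iff] at h0 h1 h2 ⊢
    refine mul_left_cancel₀ (X_ne_zero (R := ℝ) (1 : Fin 2)) ?_
    linear_combination h1 + X 1 * h2
  · simp [root, -mul_eq_mul_left_iff] at h0 h1 h2 ⊢
    linear_combination h0 - h1 + (X 0 - X 1) * h2
  · simp [root, -mul_eq_mul_left_iff] at h0 h1 h2 ⊢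
    linear_combination h0 + h1 + (X 0 + X 1) * h2

/-- Each reflection contributes `2 κ(v)` times `σ_v` acting on `t` alone. The two reflections with
parameter `k₁` add up to zero as matrices, and so do the two with `k₀`. Hence the constant is the
dimension, free of the parameters. -/
theorem sum_dunklL_X (k₀ k₁ : ℝ) (f : VPoly) :
    (dunklL k₀ k₁ 0 ((X 0 : Poly) • f) + (X 0 : Poly) • dunklL k₀ k₁ 0 f) +
      (dunklL k₀ k₁ 1 ((X 1 : Poly) • f) + (X 1 : Poly) • dunklL k₀ k₁ 1 f) =
    (2 : ℝ) • eulerV f + (2 : ℝ) • f := by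
  have hC : (C (2 : ℝ) : Poly) = 2 := map_ofNat C 2
  have e0 := fun p => root_sum_divDiff 0 p
  have e1 := fun p => root_sum_divDiff 1 p
  have e2 := fun p => root_sum_divDiff 2 p
  have e3 := fun p => root_sum_divDiff 3 p
  simp [root] at e0 e1 e2 e3
  ext1 j
  fin_cases j
  · simp [eulerV, dunklL_apply, dunkl_zero_zero, dunkl_one_zero, euler_apply, pderiv_X,
      smul_eq_C_mul, hC]
    linear_combination (-C k₁) * e0 (f 0) + C k₁ * e1 (f 0) + C k₀ * e2 (f 1) - C k₀ * e3 (f 1)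
  · simp [eulerV, dunklL_apply, dunkl_zero_one, dunkl_one_one, euler_apply, pderiv_X,
      smul_eq_C_mul, hC]
    linear_combination (C k₁) * e0 (f 1) - C k₁ * e1 (f 1) + C k₀ * e2 (f 0) - C k₀ * e3 (f 0)

/-- The `sl₂` relation. Since `|x|²` is invariant, applying the Leibniz rule twice leaves `2 ∑ (D_i
x_i + x_i D_i)`, which `sum_dunklL_X` evaluates. -/
theorem lapL_sqNorm_smul (k₀ k₁ : ℝ) (f : VPoly) :
    lapL k₀ k₁ (sqNorm • f) = sqNorm • lapL k₀ k₁ f + (4 : ℝ) • (eulerV f + f) := by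
  have h2 : ∀ (i : Fin 2) (g : VPoly), ((2 : Poly) * X i) • g = (2 : ℝ) • (X i : Poly) • g := by
    intro i g
    rw [mul_smul, two_smul, two_smul]
  have p0 : pderiv 0 sqNorm = 2 * X 0 := by simp [sqNorm, pderiv_X]
  have p1 : pderiv 1 sqNorm = 2 * X 1 := by simp [sqNorm, pderiv_X]
  have h := sum_dunklL_X k₀ k₁ f
  rw [lapL_apply, lapL_apply]
  simp only [dunklL_mul_of_invariant k₀ k₁ _ actX_sqNorm, p0, p1, map_add, h2, map_smul]
  have h4 : (4 : ℝ) • (eulerV f + f) = (2 : ℝ) • ((2 : ℝ) • eulerV f + (2 : ℝ) • f) := by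
    module
  rw [h4, ← h]
  module

/-! ### The Dunkl Laplacian on `φ ^ m p_{1,2}` and `φ ^ m p_{1,4}` -/

theorem actX_phi (r : Fin 4) : actX (refl r) phi = ![phi, phi, -phi, -phi] r := by
  rw [phi, actX_sub, actX_pow, actX_pow, (actX_refl_X r).1, (actX_refl_X r).2]
  fin_cases r <;> simp

theorem actX_phi_pow_two_mul (b : ℕ) (r : Fin 4) :
    actX (refl r) (phi ^ (2 * b)) = phi ^ (2 * b) := by
  rw [actX_pow, actX_phi, pow_mul, pow_mul]
  congr 1
  fin_cases r <;> simp

/-- Along a diagonal root `φ` changes sign and contains `⟨x, v⟩` as a factor. The difference becomes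
a sum and the division is explicit, leaving the other linear factor of `φ`. -/
theorem divDiff_two_phi_mul (p : Poly) :
    divDiff 2 (phi * p) = (X 0 + X 1) * (p + actX (refl 2) p) := by
  refine divDiff_eq ?_
  rw [actX_mul, actX_phi, linForm_root, phi]
  simp
  ring

theorem divDiff_three_phi_mul (p : Poly) :
    divDiff 3 (phi * p) = (X 0 - X 1) * (p + actX (refl 3) p) := by
  refine divDiff_eq ?_
  rw [actX_mul, actX_phi, linForm_root, phi]
  simp
  ring

theorem divDiff_phi_mul_of_lt {r : Fin 4} (hr : r < 2) (p : Poly) :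
    divDiff r (phi * p) = phi * divDiff r p := by
  refine divDiff_mul_of_invariant ?_ p
  rw [actX_phi]
  fin_cases r
  · rfl
  · rfl
  · exact absurd hr (by decide)
  · exact absurd hr (by decide)

/-- The quadratic form `a x₁² + b x₁ x₂ + c x₂²`. -/
def quad (a b c : ℝ) : Poly := C a * X 0 ^ 2 + C b * (X 0 * X 1) + C c * X 1 ^ 2

theorem actX_quad (r : Fin 4) (a b c : ℝ) :
    actX (refl r) (quad a b c) = ![quad a (-b) c, quad a (-b) c, quad c b a, quad c b a] r := by
  simp only [quad, actX_add, actX_mul, actX_pow, actX_C, (actX_refl_X r).1, (actX_refl_X r).2]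
  fin_cases r <;> simp <;> ring

theorem divDiff_quad (r : Fin 4) (a b c : ℝ) :
    divDiff r (quad a b c) =
      ![C (2 * b) * X 1, C (2 * b) * X 0, C (a - c) * (X 0 + X 1), C (a - c) * (X 0 - X 1)] r := by
  refine divDiff_eq ?_
  have hC : (C (2 : ℝ) : Poly) = 2 := map_ofNat C 2
  rw [actX_quad, linForm_root]
  fin_cases r <;> simp [quad, hC] <;> ring

theorem pderiv_zero_quad (a b c : ℝ) :
    pderiv 0 (quad a b c) = 2 * C a * X 0 + C b * X 1 := by
  simp [quad, pderiv_X]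
  ring

theorem pderiv_one_quad (a b c : ℝ) :
    pderiv 1 (quad a b c) = C b * X 0 + 2 * C c * X 1 := by
  simp [quad, pderiv_X]
  ring

theorem pderiv_zero_phi : pderiv 0 phi = 2 * X 0 := by
  simp [phi, pderiv_X]

theorem pderiv_one_phi : pderiv 1 phi = -(2 * X 1) := by
  simp [phi, pderiv_X]

theorem divDiff_X (r : Fin 4) :
    divDiff r (X 0) = ![2, 0, 1, 1] r ∧ divDiff r (X 1) = ![0, 2, -1, 1] r := by
  constructor <;> refine divDiff_eq ?_
  · rw [(actX_refl_X r).1, linForm_root]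
    fin_cases r <;> simp <;> ring
  · rw [(actX_refl_X r).2, linForm_root]
    fin_cases r <;> simp <;> ring

theorem dunklL_zero_p12 (k₀ k₁ : ℝ) :
    dunklL k₀ k₁ 0 p12 = ![0, C (1 + 2 * k₀ + 2 * k₁)] := by
  have hC : (C (2 : ℝ) : Poly) = 2 := map_ofNat C 2
  ext1 j
  fin_cases j <;>
    simp [dunklL_apply, dunkl_zero_zero, dunkl_zero_one, p12, divDiff_X, pderiv_X, hC] <;> ring

theorem dunklL_one_p12 (k₀ k₁ : ℝ) :
    dunklL k₀ k₁ 1 p12 = ![-C (1 + 2 * k₀ + 2 * k₁), 0] := by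
  have hC : (C (2 : ℝ) : Poly) = 2 := map_ofNat C 2
  ext1 j
  fin_cases j <;>
    simp [dunklL_apply, dunkl_one_zero, dunkl_one_one, p12, divDiff_X, pderiv_X, hC] <;> ring

theorem pderiv_phi_pow (i : Fin 2) (m : ℕ) :
    pderiv i (phi ^ (m + 1)) = (m + 1 : Poly) * phi ^ m * pderiv i phi := by
  simp
  ring

/-- The extra factor `φ` on the left avoids the exponent `m - 1`, so that `m = 0` is included. -/
theorem pderiv_phi_pow_mul_phi (i : Fin 2) (m : ℕ) :
    pderiv i (phi ^ m) * phi = (m : Poly) * phi ^ m * pderiv i phi := by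
  cases m with
  | zero => simp
  | succ m => rw [pderiv_phi_pow]; push_cast; ring

theorem dunklL_zero_phi_mul_quad (k₀ k₁ a b c a' b' c' : ℝ) :
    dunklL k₀ k₁ 0 (phi • ![quad a b c, quad a' b' c']) =
      ![2 * X 0 * quad a b c + phi * (2 * C a * X 0 + C b * X 1) - 2 * C k₁ * C b * phi * X 1
          + C k₀ * (2 * X 1) * quad (a' + c') (2 * b') (a' + c'),
        2 * X 0 * quad a' b' c' + phi * (2 * C a' * X 0 + C b' * X 1) + 2 * C k₁ * C b' * phi * X 1
          + C k₀ * (2 * X 1) * quad (a + c) (2 * b) (a + c)] := by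
  have hC : (C (2 : ℝ) : Poly) = 2 := map_ofNat C 2
  ext1 j
  fin_cases j <;>
    simp [dunklL_apply, dunkl_zero_zero, dunkl_zero_one, divDiff_two_phi_mul,
      divDiff_three_phi_mul, divDiff_phi_mul_of_lt (show (0 : Fin 4) < 2 by decide),
      pderiv_zero_phi, pderiv_zero_quad, actX_quad, divDiff_quad, hC] <;>
    simp [quad, hC] <;> ring

theorem dunklL_one_phi_mul_quad (k₀ k₁ a b c a' b' c' : ℝ) :
    dunklL k₀ k₁ 1 (phi • ![quad a b c, quad a' b' c']) =
      ![-(2 * X 1) * quad a b c + phi * (C b * X 0 + 2 * C c * X 1) + 2 * C k₁ * C b * phi * X 0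
          - C k₀ * (2 * X 0) * quad (a' + c') (2 * b') (a' + c'),
        -(2 * X 1) * quad a' b' c' + phi * (C b' * X 0 + 2 * C c' * X 1)
          - 2 * C k₁ * C b' * phi * X 0
          - C k₀ * (2 * X 0) * quad (a + c) (2 * b) (a + c)] := by
  have hC : (C (2 : ℝ) : Poly) = 2 := map_ofNat C 2
  ext1 j
  fin_cases j <;>
    simp [dunklL_apply, dunkl_one_zero, dunkl_one_one, divDiff_two_phi_mul,
      divDiff_three_phi_mul, divDiff_phi_mul_of_lt (show (1 : Fin 4) < 2 by decide),
      pderiv_one_phi, pderiv_one_quad, actX_quad, divDiff_quad, hC] <;>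
    simp [quad, hC] <;> ring

theorem dunklL_zero_quad (k₀ k₁ a b c a' b' c' : ℝ) :
    dunklL k₀ k₁ 0 ![quad a b c, quad a' b' c'] =
      ![2 * C a * X 0 + C b * X 1 - 2 * C k₁ * C b * X 1 + 2 * C k₀ * C (a' - c') * X 1,
        2 * C a' * X 0 + C b' * X 1 + 2 * C k₁ * C b' * X 1 + 2 * C k₀ * C (a - c) * X 1] := by
  have hC : (C (2 : ℝ) : Poly) = 2 := map_ofNat C 2
  ext1 j
  fin_cases j <;>
    simp [dunklL_apply, dunkl_zero_zero, dunkl_zero_one, pderiv_zero_quad, divDiff_quad, hC] <;>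
    ring

theorem dunklL_one_quad (k₀ k₁ a b c a' b' c' : ℝ) :
    dunklL k₀ k₁ 1 ![quad a b c, quad a' b' c'] =
      ![C b * X 0 + 2 * C c * X 1 + 2 * C k₁ * C b * X 0 - 2 * C k₀ * C (a' - c') * X 0,
        C b' * X 0 + 2 * C c' * X 1 - 2 * C k₁ * C b' * X 0 - 2 * C k₀ * C (a - c) * X 0] := by
  have hC : (C (2 : ℝ) : Poly) = 2 := map_ofNat C 2
  ext1 j
  fin_cases j <;>
    simp [dunklL_apply, dunkl_one_zero, dunkl_one_one, pderiv_one_quad, divDiff_quad, hC] <;>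
    ring

/-- Only `φ²` is invariant under the whole group. This is why exponents are treated by parity, with
at most one factor `φ` left inside the Dunkl operator. -/
theorem dunklL_phi_pow_smul (k₀ k₁ : ℝ) (i : Fin 2) (b : ℕ) (f : VPoly) :
    dunklL k₀ k₁ i (phi ^ (2 * b) • f) =
      pderiv i (phi ^ (2 * b)) • f + phi ^ (2 * b) • dunklL k₀ k₁ i f :=
  dunklL_mul_of_invariant k₀ k₁ i (actX_phi_pow_two_mul b) f

theorem dunklL_zero_phi_pow_p12 (k₀ k₁ : ℝ) (b : ℕ) :
    dunklL k₀ k₁ 0 (phi ^ (2 * b + 2) • p12) =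
      phi ^ (2 * b) • phi • ![quad 0 (-(2 * (2 * b + 2))) 0,
        quad (2 * (2 * b + 2) + (1 + 2 * k₀ + 2 * k₁)) 0 (-(1 + 2 * k₀ + 2 * k₁))] := by
  have hC : (C (2 : ℝ) : Poly) = 2 := map_ofNat C 2
  rw [show 2 * b + 2 = 2 * (b + 1) by ring, dunklL_phi_pow_smul, dunklL_zero_p12,
    show 2 * (b + 1) = 2 * b + 1 + 1 by ring, pderiv_phi_pow, pderiv_zero_phi]
  ext1 j
  fin_cases j <;> simp [quad, p12, hC]
  · ring
  · rw [phi]; ring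

theorem dunklL_one_phi_pow_p12 (k₀ k₁ : ℝ) (b : ℕ) :
    dunklL k₀ k₁ 1 (phi ^ (2 * b + 2) • p12) =
      phi ^ (2 * b) • phi • ![quad (-(1 + 2 * k₀ + 2 * k₁)) 0
        (2 * (2 * b + 2) + (1 + 2 * k₀ + 2 * k₁)), quad 0 (-(2 * (2 * b + 2))) 0] := by
  have hC : (C (2 : ℝ) : Poly) = 2 := map_ofNat C 2
  rw [show 2 * b + 2 = 2 * (b + 1) by ring, dunklL_phi_pow_smul, dunklL_one_p12,
    show 2 * (b + 1) = 2 * b + 1 + 1 by ring, pderiv_phi_pow, pderiv_one_phi]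
  ext1 j
  fin_cases j <;> simp [quad, p12, hC]
  · rw [phi]; ring
  · ring

/-- The elements `φ^(2b) p₁₂` and `φ^(2b+1) p₁₄` all change by the determinant under the
simultaneous action of the group on `x` and `t`, a type that `Δ_κ` preserves. This explains why only
these two families occur. -/
theorem lapL_phi_pow_p12 (k₀ k₁ : ℝ) (b : ℕ) :
    lapL k₀ k₁ (phi ^ (2 * b + 2) • p12) =
      (4 * (2 * b + 2) * (2 * b + 1 - 2 * k₀)) • sqNorm • phi ^ (2 * b) • p12 -
        (4 * (2 * b + 2) * (1 + 2 * k₀ + 2 * k₁)) • phi ^ (2 * b + 1) • p14 := by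
  have hC : (C (2 : ℝ) : Poly) = 2 := map_ofNat C 2
  have hC4 : (C (4 : ℝ) : Poly) = 4 := map_ofNat C 4
  have h0 := pderiv_phi_pow_mul_phi 0 (2 * b)
  have h1 := pderiv_phi_pow_mul_phi 1 (2 * b)
  rw [pderiv_zero_phi] at h0
  rw [pderiv_one_phi] at h1
  push_cast at h0 h1
  rw [lapL_apply, dunklL_zero_phi_pow_p12, dunklL_one_phi_pow_p12, dunklL_phi_pow_smul,
    dunklL_phi_pow_smul, dunklL_zero_phi_mul_quad, dunklL_one_phi_mul_quad]
  generalize hA : pderiv 0 (phi ^ (2 * b)) = A at *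
  generalize hB : pderiv 1 (phi ^ (2 * b)) = B at *
  ext1 j
  fin_cases j
  · simp [p12, p14, smul_eq_C_mul, hC, hC4, sqNorm]
    rw [← mul_assoc A, ← mul_assoc B, h0, h1, pow_succ]
    simp [quad, hC, phi]
    ring
  · simp [p12, p14, smul_eq_C_mul, hC, hC4, sqNorm]
    rw [← mul_assoc A, ← mul_assoc B, h0, h1, pow_succ]
    simp [quad, hC, phi]
    ring

theorem dunklL_zero_p14 (k₀ k₁ : ℝ) :
    dunklL k₀ k₁ 0 (phi • p14) =
      ![quad 0 (-2 - 4 * k₀) 0,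
        quad (-2 - (1 + 2 * k₁) - 2 * k₀) 0 ((1 + 2 * k₁) - 2 * k₀)] := by
  have hC : (C (2 : ℝ) : Poly) = 2 := map_ofNat C 2
  have hC4 : (C (4 : ℝ) : Poly) = 4 := map_ofNat C 4
  ext1 j
  fin_cases j <;>
    simp [dunklL_apply, dunkl_zero_zero, dunkl_zero_one, divDiff_two_phi_mul, p14, divDiff_X,
      divDiff_three_phi_mul, divDiff_phi_mul_of_lt (show (0 : Fin 4) < 2 by decide),
      pderiv_zero_phi, pderiv_X, actX_refl_X] <;>
    simp [quad, phi, hC, hC4] <;> ring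

theorem dunklL_one_p14 (k₀ k₁ : ℝ) :
    dunklL k₀ k₁ 1 (phi • p14) =
      ![quad (-(1 + 2 * k₁) + 2 * k₀) 0 (2 + (1 + 2 * k₁) + 2 * k₀),
        quad 0 (2 + 4 * k₀) 0] := by
  have hC : (C (2 : ℝ) : Poly) = 2 := map_ofNat C 2
  have hC4 : (C (4 : ℝ) : Poly) = 4 := map_ofNat C 4
  ext1 j
  fin_cases j <;>
    simp [dunklL_apply, dunkl_one_zero, dunkl_one_one, divDiff_two_phi_mul, p14, divDiff_X,
      divDiff_three_phi_mul, divDiff_phi_mul_of_lt (show (1 : Fin 4) < 2 by decide),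
      pderiv_one_phi, pderiv_X, actX_refl_X] <;>
    simp [quad, phi, hC, hC4] <;> ring

theorem dunklL_zero_phi_pow_p14 (k₀ k₁ : ℝ) (b : ℕ) :
    dunklL k₀ k₁ 0 (phi ^ (2 * b + 1) • p14) =
      phi ^ (2 * b) • ![quad 0 (-(2 * (2 * b + 1)) - 4 * k₀) 0,
        quad (-(2 * (2 * b + 1)) - (1 + 2 * k₁) - 2 * k₀) 0 ((1 + 2 * k₁) - 2 * k₀)] := by
  have hC : (C (2 : ℝ) : Poly) = 2 := map_ofNat C 2
  have h0 := pderiv_phi_pow_mul_phi 0 (2 * b)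
  rw [pderiv_zero_phi] at h0
  push_cast at h0
  rw [pow_succ, mul_smul, dunklL_phi_pow_smul, dunklL_zero_p14]
  generalize pderiv 0 (phi ^ (2 * b)) = A at *
  ext1 j
  fin_cases j <;> simp [p14] <;> rw [← mul_assoc, h0] <;> simp [quad, hC] <;> ring

theorem dunklL_one_phi_pow_p14 (k₀ k₁ : ℝ) (b : ℕ) :
    dunklL k₀ k₁ 1 (phi ^ (2 * b + 1) • p14) =
      phi ^ (2 * b) • ![quad (-(1 + 2 * k₁) + 2 * k₀) 0
        (2 * (2 * b + 1) + (1 + 2 * k₁) + 2 * k₀), quad 0 (2 * (2 * b + 1) + 4 * k₀) 0] := by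
  have hC : (C (2 : ℝ) : Poly) = 2 := map_ofNat C 2
  have h0 := pderiv_phi_pow_mul_phi 1 (2 * b)
  rw [pderiv_one_phi] at h0
  push_cast at h0
  rw [pow_succ, mul_smul, dunklL_phi_pow_smul, dunklL_one_p14]
  generalize pderiv 1 (phi ^ (2 * b)) = A at *
  ext1 j
  fin_cases j <;> simp [p14] <;> rw [← mul_assoc, h0] <;> simp [quad, hC] <;> ring

/-- The lowest odd case of `lapL_phi_pow_p14`: its `|x|²` term has coefficient zero, so it is
treated apart from the general exponent. -/
theorem lapL_phi_p14 (k₀ k₁ : ℝ) :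
    lapL k₀ k₁ (phi • p14) = -((4 * (1 - 2 * k₀ + 2 * k₁)) • p12) := by
  have hC : (C (2 : ℝ) : Poly) = 2 := map_ofNat C 2
  have hC4 : (C (4 : ℝ) : Poly) = 4 := map_ofNat C 4
  rw [lapL_apply, dunklL_zero_p14, dunklL_one_p14, dunklL_zero_quad, dunklL_one_quad]
  ext1 j
  fin_cases j <;> simp [p12, smul_eq_C_mul, hC, hC4] <;> ring

theorem lapL_phi_pow_p14 (k₀ k₁ : ℝ) (b : ℕ) :
    lapL k₀ k₁ (phi ^ (2 * b + 3) • p14) =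
      (4 * (2 * b + 2) * (2 * b + 3 + 2 * k₀)) • sqNorm • phi ^ (2 * b + 1) • p14 -
        (4 * (2 * b + 3) * (1 - 2 * k₀ + 2 * k₁)) • phi ^ (2 * b + 2) • p12 := by
  have hC : (C (2 : ℝ) : Poly) = 2 := map_ofNat C 2
  have hC3 : (C (3 : ℝ) : Poly) = 3 := map_ofNat C 3
  have hC4 : (C (4 : ℝ) : Poly) = 4 := map_ofNat C 4
  rw [lapL_apply, show 2 * b + 3 = 2 * (b + 1) + 1 by ring, dunklL_zero_phi_pow_p14,
    dunklL_one_phi_pow_p14, dunklL_phi_pow_smul, dunklL_phi_pow_smul, dunklL_zero_quad,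
    dunklL_one_quad, show 2 * (b + 1) = 2 * b + 1 + 1 by ring, pderiv_phi_pow, pderiv_phi_pow,
    pderiv_zero_phi, pderiv_one_phi]
  ext1 j
  fin_cases j
  · simp [p12, p14, smul_eq_C_mul, hC, hC3, hC4, sqNorm, quad, pow_succ]
    generalize phi ^ (2 * b) = Z
    simp only [phi]
    ring
  · simp [p12, p14, smul_eq_C_mul, hC, hC3, hC4, sqNorm, quad, pow_succ]
    generalize phi ^ (2 * b) = Z
    simp only [phi]
    ring

/-! ### The pairing with `p_{1,2}` -/

/-- The linear functional extracting the `p_{1,2}`-part of the linear terms, up to scaling. -/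
def detCoeff : VPoly →ₗ[ℝ] ℝ where
  toFun f := coeff (Finsupp.single 0 1) (f 1) - coeff (Finsupp.single 1 1) (f 0)
  map_add' f g := by simp; ring
  map_smul' c f := by simp; ring

theorem detCoeff_apply (f : VPoly) :
    detCoeff f = coeff (Finsupp.single 0 1) (f 1) - coeff (Finsupp.single 1 1) (f 0) := rfl

theorem detCoeff_sqNorm_smul (f : VPoly) : detCoeff (sqNorm • f) = 0 := by
  have h : ∀ (i j : Fin 2) (p : Poly), coeff (Finsupp.single i 1) (X j ^ 2 * p) = 0 := by
    intro i j p
    rw [pow_two, mul_assoc, coeff_X_mul']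
    split_ifs with hij
    · have : j = i := by
        by_contra hne
        simp at hij
        exact hne hij
      subst this
      simp [coeff_X_mul']
    · rfl
  simp [detCoeff_apply, sqNorm, add_mul, h]

theorem coeff_single_euler (i : Fin 2) (p : Poly) :
    coeff (Finsupp.single i 1) (euler p) = coeff (Finsupp.single i 1) p := by
  induction p using MvPolynomial.induction_on' with
  | add p q hp hq => rw [map_add, coeff_add, coeff_add, hp, hq]
  | monomial m a =>
    have h : euler (monomial m a) = (m 0 + m 1 : ℝ) • monomial m a := by
      rw [euler_apply, X_mul_pderiv_monomial, X_mul_pderiv_monomial, ← add_smul,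
        ← Nat.cast_smul_eq_nsmul ℝ]
      push_cast
      rfl
    rw [h, coeff_smul, coeff_monomial]
    split_ifs with hm
    · subst hm
      fin_cases i <;> simp
    · simp

/-- `detCoeff` reads only linear coefficients, and on these the Euler operator is the identity. -/
theorem detCoeff_eq_zero_of_eulerV {f : VPoly} {d : ℝ} (hf : eulerV f = d • f) (hd : d ≠ 1) :
    detCoeff f = 0 := by
  have h : detCoeff (eulerV f) = detCoeff f := by
    simp only [detCoeff_apply, eulerV, coeff_single_euler]
  rw [hf, map_smul, smul_eq_mul] at h
  have : (d - 1) * detCoeff f = 0 := by linear_combination h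
  exact (mul_eq_zero.1 this).resolve_left (sub_ne_zero.2 hd)

theorem divDiff_C (r : Fin 4) (a : ℝ) : divDiff r (C a) = 0 :=
  divDiff_eq (by rw [actX_C]; simp)

theorem dunklL_C (k₀ k₁ : ℝ) (i : Fin 2) (a b : ℝ) : dunklL k₀ k₁ i ![C a, C b] = 0 := by
  ext1 j
  fin_cases i <;> fin_cases j <;>
    simp [dunklL_apply, dunkl_zero_zero, dunkl_zero_one, dunkl_one_zero, dunkl_one_one, divDiff_C]

theorem dunkl_iterate_zero (k₀ k₁ : ℝ) (i : Fin 2) (n : ℕ) :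
    (dunkl k₀ k₁ i)^[n] 0 = 0 :=
  Function.iterate_fixed (show dunkl k₀ k₁ i 0 = 0 from map_zero (dunklL k₀ k₁ i)) n

theorem dunkl_iterate_succ_C (k₀ k₁ : ℝ) (i : Fin 2) (n : ℕ) (a b : ℝ) :
    (dunkl k₀ k₁ i)^[n + 1] ![C a, C b] = 0 := by
  rw [Function.iterate_succ_apply, ← dunklL_apply, dunklL_C, dunkl_iterate_zero]

/-- Both `D₁ p₁₂` and `D₂ p₁₂` are constants, so a second Dunkl operator kills them, while `p₁₂`
itself vanishes at the origin. Only the two monomials of degree one survive. -/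
theorem dunkl_iterate_p12 (k₀ k₁ : ℝ) (m : Fin 2 →₀ ℕ) (i : Fin 2) :
    eval 0 (((dunkl k₀ k₁ 0)^[m 0] ((dunkl k₀ k₁ 1)^[m 1] p12)) i) =
      (if m = Finsupp.single 0 1 then ![0, 1 + 2 * k₀ + 2 * k₁] i else 0) +
      (if m = Finsupp.single 1 1 then ![-(1 + 2 * k₀ + 2 * k₁), 0] i else 0) := by
  have hne : ∀ (a b : Fin 2 →₀ ℕ), a = b ↔ a 0 = b 0 ∧ a 1 = b 1 := by
    intro a b
    rw [Finsupp.ext_iff, Fin.forall_fin_two]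
  have e0 : dunkl k₀ k₁ 0 p12 = ![C 0, C (1 + 2 * k₀ + 2 * k₁)] := by
    rw [← dunklL_apply, dunklL_zero_p12, C_0]
  have e1 : dunkl k₀ k₁ 1 p12 = ![C (-(1 + 2 * k₀ + 2 * k₁)), C 0] := by
    rw [← dunklL_apply, dunklL_one_p12, C_0, C_neg]
  simp only [hne]
  generalize m 0 = a
  generalize m 1 = b
  rcases b with _ | _ | b
  · rcases a with _ | _ | a
    · fin_cases i <;> simp [p12]
    · fin_cases i <;> simp [e0]
    · rw [Function.iterate_zero_apply, Function.iterate_succ_apply, e0, dunkl_iterate_succ_C]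
      simp
  · rcases a with _ | a
    · fin_cases i <;> simp [e1]
    · rw [Function.iterate_one, e1, dunkl_iterate_succ_C]
      simp
  · rw [Function.iterate_succ_apply (dunkl k₀ k₁ 1), e1, dunkl_iterate_succ_C, dunkl_iterate_zero]
    simp

theorem formTau_p12 (k₀ k₁ : ℝ) (f : VPoly) :
    formTau k₀ k₁ f p12 = (1 + 2 * k₀ + 2 * k₁) * detCoeff f := by
  have h : ∀ i : Fin 2, eval 0 (applyD k₀ k₁ (f i) p12 i) =
      coeff (Finsupp.single 0 1) (f i) * ![0, 1 + 2 * k₀ + 2 * k₁] i +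
      coeff (Finsupp.single 1 1) (f i) * ![-(1 + 2 * k₀ + 2 * k₁), 0] i := by
    intro i
    have hs : ∀ (p : Poly) (m₀ : Fin 2 →₀ ℕ) (x : ℝ),
        ∑ m ∈ p.support, coeff m p * (if m = m₀ then x else 0) = coeff m₀ p * x := by
      intro p m₀ x
      simp only [mul_ite, mul_zero, Finset.sum_ite_eq']
      split_ifs with hm
      · rfl
      · rw [notMem_support_iff.1 hm, zero_mul]
    rw [applyD, Finset.sum_apply, map_sum]
    simp only [Pi.smul_apply, smul_eval, dunkl_iterate_p12, mul_add, Finset.sum_add_distrib, hs]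
  rw [formTau, Fin.sum_univ_two, h, h, detCoeff_apply]
  simp
  ring

theorem lapL_p12 (k₀ k₁ : ℝ) : lapL k₀ k₁ p12 = 0 := by
  have h0 : dunklL k₀ k₁ 0 p12 = ![C 0, C (1 + 2 * k₀ + 2 * k₁)] := by
    rw [dunklL_zero_p12, C_0]
  have h1 : dunklL k₀ k₁ 1 p12 = ![C (-(1 + 2 * k₀ + 2 * k₁)), C 0] := by
    rw [dunklL_one_p12, C_0, C_neg]
  rw [lapL_apply, h0, h1, dunklL_C, dunklL_C, add_zero]

theorem expLap_p12 (k₀ k₁ : ℝ) : expLap k₀ k₁ p12 = p12 := by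
  rw [expLap, Finset.sum_range_succ', Finset.sum_eq_zero, zero_add]
  · simp
  · intro j _
    rw [lapK_iterate, pow_succ (lapL k₀ k₁), Module.End.mul_apply, lapL_p12, map_zero, smul_zero]

theorem expLap_zero (k₀ k₁ : ℝ) : expLap k₀ k₁ 0 = 0 := by
  rw [expLap]
  refine Finset.sum_eq_zero fun j _ => ?_
  rw [lapK_iterate, map_zero, smul_zero]

theorem formG_zero_right (k₀ k₁ : ℝ) (f : VPoly) : formG k₀ k₁ f 0 = 0 := by
  rw [formG, expLap_zero, formTau]
  refine Finset.sum_eq_zero fun i _ => ?_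
  rw [applyD, Finset.sum_eq_zero]
  · simp
  · intro m _
    rw [dunkl_iterate_zero, dunkl_iterate_zero, smul_zero]

/-- As `p₁₂` is harmonic, the exponential acts only on `f`. The term `Δ_κ^j f` has degree `2L + 1 -
2j`, so `detCoeff` retains `j = L` alone. The bound `L ≤ vdeg f` ensures that this term belongs to
the truncated exponential. -/
theorem formG_p12 {k₀ k₁ : ℝ} {f : VPoly} {L : ℕ} (hf : eulerV f = (2 * L + 1 : ℝ) • f)
    (hL : L ≤ vdeg f) :
    formG k₀ k₁ f p12 = (1 + 2 * k₀ + 2 * k₁) *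
      (((2 : ℝ) ^ L * (L.factorial : ℝ))⁻¹ * detCoeff ((lapL k₀ k₁ ^ L) f)) := by
  rw [formG, expLap_p12, formTau_p12, expLap, map_sum]
  congr 1
  rw [Finset.sum_eq_single L]
  · rw [lapK_iterate, map_smul, smul_eq_mul]
  · intro j _ hj
    rw [lapK_iterate, map_smul, detCoeff_eq_zero_of_eulerV (eulerV_lapL_pow_of_eq hf j), smul_zero]
    intro h
    have : (j : ℝ) = L := by linarith
    exact hj (by exact_mod_cast this)
  · intro h
    exact absurd (Finset.mem_range.2 (by omega)) h

theorem isHomogeneous_phi : phi.IsHomogeneous 2 :=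
  (isHomogeneous_X_pow _ _).sub (isHomogeneous_X_pow _ _)

theorem phi_ne_zero : phi ≠ 0 := by
  intro h
  have := congrArg (eval ![1, 0]) h
  simp [phi] at this

theorem euler_phi_pow (m : ℕ) : euler (phi ^ m) = (2 * m : ℝ) • phi ^ m := by
  have h := (isHomogeneous_phi.pow m).sum_X_mul_pderiv
  rw [Fin.sum_univ_two, ← Nat.cast_smul_eq_nsmul ℝ] at h
  rw [euler_apply, h]
  push_cast
  rfl

theorem eulerV_phi_pow_smul {p : VPoly} (hp : eulerV p = p) (m : ℕ) :
    eulerV (phi ^ m • p) = (2 * m + 1 : ℝ) • phi ^ m • p := by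
  ext1 i
  have hi : euler (p i) = p i := congrFun hp i
  simp only [eulerV, Pi.smul_apply, smul_eq_mul, Derivation.leibniz, euler_phi_pow, hi]
  simp only [add_smul, one_smul, smul_eq_C_mul]
  ring

theorem eulerV_p12 : eulerV p12 = p12 := by
  ext1 i
  fin_cases i <;> simp [eulerV, p12, euler_X]

theorem eulerV_p14 : eulerV p14 = p14 := by
  ext1 i
  fin_cases i <;> simp [eulerV, p14, euler_X]

theorem isHomogeneous_p12 (i : Fin 2) : (p12 i).IsHomogeneous 1 := by
  fin_cases i
  · exact (isHomogeneous_X ℝ 1).neg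
  · exact isHomogeneous_X ℝ 0

theorem isHomogeneous_p14 (i : Fin 2) : (p14 i).IsHomogeneous 1 := by
  fin_cases i
  · exact (isHomogeneous_X ℝ 1).neg
  · exact (isHomogeneous_X ℝ 0).neg

theorem vcomp_of_isHomogeneous {f : VPoly} {d : ℕ} (hf : ∀ i, (f i).IsHomogeneous d) (n : ℕ) :
    vcomp n f = if n = d then f else 0 := by
  ext1 i
  rw [vcomp, homogeneousComponent_of_mem ((mem_homogeneousSubmodule d _).2 (hf i))]
  split_ifs <;> simp_all

theorem vdeg_of_isHomogeneous {f : VPoly} {d : ℕ} (hf : ∀ i, (f i).IsHomogeneous d)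
    (hne : ∀ i, f i ≠ 0) : vdeg f = d := by
  rw [vdeg, (hf 0).totalDegree (hne 0), (hf 1).totalDegree (hne 1), max_self]

/-- The normalized functional `f ↦ ⟨f, p_{1,2}⟩_S` on homogeneous `f` of degree `2 L + 1`. -/
def pairing (k₀ k₁ : ℝ) (L : ℕ) : VPoly →ₗ[ℝ] ℝ :=
  ((1 + 2 * k₀ + 2 * k₁) / ((2 : ℝ) ^ (2 * L + 1) * L.factorial * (L + 1).factorial)) •
    (detCoeff ∘ₗ (lapL k₀ k₁ ^ L))

theorem pairing_apply (k₀ k₁ : ℝ) (L : ℕ) (f : VPoly) : pairing k₀ k₁ L f =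
    (1 + 2 * k₀ + 2 * k₁) / ((2 : ℝ) ^ (2 * L + 1) * L.factorial * (L + 1).factorial) *
      detCoeff ((lapL k₀ k₁ ^ L) f) := rfl

/-- The degrees `2L + 1` and `1` give `ℓ = L + 1`. The denominator in `pairing` is thus `2^L L!`
from the exponential times `2^(L+1) (L+1)!` from the normalization of `S`. -/
theorem formS_p12 {k₀ k₁ : ℝ} {f : VPoly} {L : ℕ} (hf : ∀ i, (f i).IsHomogeneous (2 * L + 1))
    (hne : ∀ i, f i ≠ 0) (hE : eulerV f = (2 * L + 1 : ℝ) • f) :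
    formS k₀ k₁ f p12 = pairing k₀ k₁ L f := by
  have h12 : vdeg p12 = 1 := vdeg_of_isHomogeneous isHomogeneous_p12 fun i => by
    fin_cases i <;> simp [p12]
  have hd := vdeg_of_isHomogeneous hf hne
  rw [formS, Finset.sum_eq_single (2 * L + 1), Finset.sum_eq_single 1]
  · rw [vcomp_of_isHomogeneous hf, vcomp_of_isHomogeneous isHomogeneous_p12, if_pos rfl,
      if_pos rfl, if_pos (by omega), formG_p12 hE (by omega), pairing_apply,
      show (1 + (2 * L + 1)) / 2 = L + 1 by omega]
    field_simp
    ring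
  · intro m _ hm
    rw [vcomp_of_isHomogeneous isHomogeneous_p12 m, if_neg hm, formG_zero_right]
    simp
  · intro h
    exact absurd (Finset.mem_range.2 (by omega)) h
  · intro n _ hn
    have h0 : ∀ g, formG k₀ k₁ 0 g = 0 := fun g => by
      rw [formG, expLap_zero, formTau]
      exact Finset.sum_eq_zero fun i _ => by simp [applyD]
    refine Finset.sum_eq_zero fun m _ => ?_
    rw [vcomp_of_isHomogeneous hf n, if_neg hn, h0]
    simp
  · intro h
    exact absurd (Finset.mem_range.2 (by omega)) h

theorem pairing_succ (k₀ k₁ : ℝ) (L : ℕ) (f : VPoly) :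
    4 * (L + 1) * (L + 2) * pairing k₀ k₁ (L + 1) f = pairing k₀ k₁ L (lapL k₀ k₁ f) := by
  rw [pairing_apply, pairing_apply, pow_succ (lapL k₀ k₁), Module.End.mul_apply,
    Nat.factorial_succ (L + 1), Nat.factorial_succ L]
  push_cast
  field_simp
  ring

/-- Iterating the commutator adds `4(d - 2i + 1)` for `i = 0, …, j`, since `Δ_κ^i f` has degree `d -
2i`. -/
theorem lapL_pow_sqNorm_smul {k₀ k₁ : ℝ} {f : VPoly} {d : ℝ} (hf : eulerV f = d • f) (j : ℕ) :
    (lapL k₀ k₁ ^ (j + 1)) (sqNorm • f) = sqNorm • (lapL k₀ k₁ ^ (j + 1)) f +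
      (4 * (j + 1) * (d + 1 - j)) • (lapL k₀ k₁ ^ j) f := by
  induction j with
  | zero =>
    simp only [zero_add, pow_one, pow_zero, lapL_sqNorm_smul, hf, Module.End.one_apply]
    push_cast
    module
  | succ j ih =>
    rw [pow_succ', Module.End.mul_apply, ih, map_add, LinearMap.map_smul, lapL_sqNorm_smul,
      eulerV_lapL_pow_of_eq hf, ← Module.End.mul_apply, ← Module.End.mul_apply, ← pow_succ',
      ← pow_succ']
    generalize sqNorm • (lapL k₀ k₁ ^ (j + 1 + 1)) f = g
    push_cast
    module

/-- The form `S` does not see `|x|²`, as befits an integral over the circle. The term still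
divisible by `|x|²` has no linear part, and with `d = 2L + 1`, `j = L` the commutator constant is
`4(L + 1)(L + 2)`, exactly the ratio of consecutive normalizations. -/
theorem pairing_sqNorm_smul {k₀ k₁ : ℝ} {f : VPoly} {L : ℕ}
    (hf : eulerV f = (2 * L + 1 : ℝ) • f) :
    pairing k₀ k₁ (L + 1) (sqNorm • f) = pairing k₀ k₁ L f := by
  rw [pairing_apply, pairing_apply, lapL_pow_sqNorm_smul hf, map_add, detCoeff_sqNorm_smul,
    map_smul, smul_eq_mul, Nat.factorial_succ (L + 1), Nat.factorial_succ L]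
  push_cast
  field_simp
  ring

theorem pairing_zero_p12 (k₀ k₁ : ℝ) : pairing k₀ k₁ 0 p12 = 1 + 2 * k₀ + 2 * k₁ := by
  rw [pairing_apply, pow_zero, Module.End.one_apply, detCoeff_apply]
  simp [p12]
  ring

theorem pairing_one_phi_p14 (k₀ k₁ : ℝ) :
    2 * pairing k₀ k₁ 1 (phi • p14) = -(1 - 2 * k₀ + 2 * k₁) * pairing k₀ k₁ 0 p12 := by
  have h := pairing_succ k₀ k₁ 0 (phi • p14)
  rw [lapL_phi_p14, map_neg, LinearMap.map_smul, smul_eq_mul] at h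
  push_cast at h
  norm_num at h
  linear_combination h / 4

theorem pairing_phi_pow_p12 (k₀ k₁ : ℝ) (b : ℕ) :
    (2 * b + 3) * pairing k₀ k₁ (2 * b + 2) (phi ^ (2 * b + 2) • p12) =
      (2 * b + 1 - 2 * k₀) * pairing k₀ k₁ (2 * b) (phi ^ (2 * b) • p12) -
        (1 + 2 * k₀ + 2 * k₁) * pairing k₀ k₁ (2 * b + 1) (phi ^ (2 * b + 1) • p14) := by
  have h := pairing_succ k₀ k₁ (2 * b + 1) (phi ^ (2 * b + 2) • p12)
  rw [lapL_phi_pow_p12, map_sub, LinearMap.map_smul, LinearMap.map_smul,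
    pairing_sqNorm_smul (by simpa using eulerV_phi_pow_smul eulerV_p12 (2 * b)),
    smul_eq_mul, smul_eq_mul] at h
  push_cast at h
  have hb : (4 * (2 * b + 2) : ℝ) ≠ 0 := by positivity
  refine mul_left_cancel₀ hb ?_
  linear_combination h

theorem pairing_phi_pow_p14 (k₀ k₁ : ℝ) (b : ℕ) :
    (2 * b + 4) * (2 * b + 3) * pairing k₀ k₁ (2 * b + 3) (phi ^ (2 * b + 3) • p14) =
      (2 * b + 2) * (2 * b + 3 + 2 * k₀) * pairing k₀ k₁ (2 * b + 1) (phi ^ (2 * b + 1) • p14) -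
        (2 * b + 3) * (1 - 2 * k₀ + 2 * k₁) *
          pairing k₀ k₁ (2 * b + 2) (phi ^ (2 * b + 2) • p12) := by
  have h := pairing_succ k₀ k₁ (2 * b + 2) (phi ^ (2 * b + 3) • p14)
  rw [lapL_phi_pow_p14, map_sub, LinearMap.map_smul, LinearMap.map_smul,
    pairing_sqNorm_smul (by simpa using eulerV_phi_pow_smul eulerV_p14 (2 * b + 1)),
    smul_eq_mul, smul_eq_mul] at h
  push_cast at h
  linear_combination h / 4

/-- The values `⟨φ ^ (2 n + 1) p_{1,4}, p_{1,2}⟩_S` are determined by a two-term recurrence. -/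
theorem formS_eq_of_recurrence {k₀ k₁ : ℝ} {E O : ℕ → ℝ} (h0 : E 0 = 1 + 2 * k₀ + 2 * k₁)
    (h1 : 2 * O 0 = -(1 - 2 * k₀ + 2 * k₁) * E 0)
    (hE : ∀ b : ℕ, (2 * b + 3) * E (b + 1) =
      (2 * b + 1 - 2 * k₀) * E b - (1 + 2 * k₀ + 2 * k₁) * O b)
    (hO : ∀ b : ℕ, (2 * b + 4) * (2 * b + 3) * O (b + 1) =
      (2 * b + 2) * (2 * b + 3 + 2 * k₀) * O b -
        (2 * b + 3) * (1 - 2 * k₀ + 2 * k₁) * E (b + 1)) (n : ℕ) :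
    formS k₀ k₁ (phi ^ (2 * n + 1) • p14) p12 = O n := by
  -- The two sequences advance together: `E (n + 1)` uses `E n` and `O n`, and `O (n + 1)` then uses
  -- the new `E (n + 1)`.
  have key : ∀ n : ℕ, pairing k₀ k₁ (2 * n) (phi ^ (2 * n) • p12) = E n ∧
      pairing k₀ k₁ (2 * n + 1) (phi ^ (2 * n + 1) • p14) = O n := by
    intro n
    induction n with
    | zero =>
      have e0 : pairing k₀ k₁ 0 p12 = E 0 := by rw [pairing_zero_p12, h0]
      refine ⟨by simpa using e0, ?_⟩
      have e1 := pairing_one_phi_p14 k₀ k₁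
      rw [e0, ← h1] at e1
      simpa using e1
    | succ n ih =>
      have eE := pairing_phi_pow_p12 k₀ k₁ n
      rw [ih.1, ih.2, ← hE] at eE
      have eE' := mul_left_cancel₀ (by positivity) eE
      have eO := pairing_phi_pow_p14 k₀ k₁ n
      rw [ih.2, eE', ← hO] at eO
      exact ⟨eE', mul_left_cancel₀ (by positivity) eO⟩
  rw [← (key n).2]
  have hE := eulerV_phi_pow_smul eulerV_p14 (2 * n + 1)
  refine formS_p12 (fun i => ?_) (fun i => ?_) hE
  · exact (isHomogeneous_phi.pow (2 * n + 1)).mul (isHomogeneous_p14 i)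
  · refine mul_ne_zero (pow_ne_zero _ phi_ne_zero) ?_
    fin_cases i <;> simp [p14]

end Algebra

/-! ### Analysis: the weight, its moments and their asymptotics. -/

open Set Filter Topology MeasureTheory

/-! ### Power series with coefficient ratio tending to one -/

theorem summable_mul_pow_of_ratio {w q : ℕ → ℝ} (hw : ∀ n, w (n + 1) = q n * w n)
    (hq : Tendsto q atTop (𝓝 1)) {z : ℝ} (hz : |z| < 1) : Summable fun n => w n * z ^ n := by
  obtain ⟨r, hzr, hr⟩ := exists_between hz
  refine summable_of_ratio_norm_eventually_le hr ?_
  have h1 : Tendsto (fun n => |q n| * |z|) atTop (𝓝 (1 * |z|)) := by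
    simpa using hq.abs.mul_const |z|
  rw [one_mul] at h1
  filter_upwards [h1.eventually_lt_const hzr] with n hn
  rw [hw, pow_succ, Real.norm_eq_abs, Real.norm_eq_abs]
  have : |q n * w n * (z ^ n * z)| = |q n| * |z| * |w n * z ^ n| := by
    simp only [abs_mul]
    ring
  rw [this]
  exact mul_le_mul_of_nonneg_right hn.le (abs_nonneg _)

/-- Termwise differentiation: on a ball of radius `r` with `|z| < r < 1` the differentiated terms
are dominated by their values at `r`. -/
theorem hasDerivAt_tsum_mul_pow {w : ℕ → ℝ}
    (hs : ∀ z : ℝ, |z| < 1 → Summable fun n => (n + 1) * w (n + 1) * z ^ n) {z : ℝ}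
    (hz : |z| < 1) :
    HasDerivAt (fun z : ℝ => ∑' n, w n * z ^ n) (∑' n, (n + 1) * w (n + 1) * z ^ n) z := by
  obtain ⟨r, hzr, hr⟩ := exists_between hz
  have hr0 : 0 < r := (abs_nonneg z).trans_lt hzr
  have hu : Summable fun n : ℕ => |w n * (n * r ^ (n - 1))| := by
    rw [← summable_nat_add_iff 1]
    refine ((hs r (by rwa [abs_of_pos hr0])).abs).congr fun n => ?_
    push_cast
    congr 1
    ring
  have hg : ∀ (n : ℕ) (y : ℝ), y ∈ Metric.ball (0 : ℝ) r →
      HasDerivAt (fun z : ℝ => w n * z ^ n) (w n * (n * y ^ (n - 1))) y :=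
    fun n y _ => (hasDerivAt_pow n y).const_mul (w n)
  have key := hasDerivAt_tsum_of_isPreconnected (y₀ := (0 : ℝ)) (y := z) hu Metric.isOpen_ball
    (convex_ball (0 : ℝ) r).isPreconnected hg ?_ (Metric.mem_ball_self hr0) ?_
    (by simpa using hzr)
  · have hsum : Summable fun n : ℕ => w n * (n * z ^ (n - 1)) := by
      rw [← summable_nat_add_iff 1]
      refine (hs z hz).congr fun n => ?_
      push_cast
      ring
    rw [hsum.tsum_eq_zero_add] at key
    simp only [Nat.cast_zero, zero_mul, mul_zero, zero_add] at key
    refine key.congr_deriv (tsum_congr fun n => ?_)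
    push_cast
    ring
  · intro n y hy
    rw [Real.norm_eq_abs, abs_mul, abs_mul, abs_mul, abs_mul]
    have hy' : |y| ≤ r := by simpa using (Metric.mem_ball.1 hy).le
    have h2 : |y ^ (n - 1)| ≤ |r ^ (n - 1)| := by
      rw [abs_pow, abs_pow, abs_of_pos hr0]
      exact pow_le_pow_left₀ (abs_nonneg _) hy' _
    exact mul_le_mul_of_nonneg_left (mul_le_mul_of_nonneg_left h2 (abs_nonneg _)) (abs_nonneg _)
  · refine summable_of_ne_finset_zero (s := {0}) fun n hn => ?_
    simp only [Finset.mem_singleton] at hn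
    simp [hn]

/-! ### The hypergeometric function on the unit interval -/

theorem ordinaryHypergeometric_eq_tsum_mul_pow (a b c z : ℝ) :
    ordinaryHypergeometric a b c z = ∑' n, ordinaryHypergeometricCoefficient a b c n * z ^ n := by
  rw [ordinaryHypergeometric_eq_tsum]
  rfl

theorem ordinaryHypergeometricCoefficient_succ (a b : ℝ) {c : ℝ} (hc : 0 < c) (n : ℕ) :
    ordinaryHypergeometricCoefficient a b c (n + 1) =
      (a + n) * (b + n) / ((c + n) * (n + 1)) * ordinaryHypergeometricCoefficient a b c n := by
  have h1 : (ascPochhammer ℝ n).eval c ≠ 0 := (ascPochhammer_pos n c hc).ne'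
  have h2 : c + n ≠ 0 := by positivity
  simp only [ordinaryHypergeometricCoefficient, ascPochhammer_succ_eval, Nat.factorial_succ]
  push_cast
  field_simp

theorem tendsto_add_div_add (x y : ℝ) :
    Tendsto (fun n : ℕ => (x + n) / (y + n)) atTop (𝓝 1) := by
  have h : Tendsto (fun n : ℕ => 1 + (x - y) / (y + n)) atTop (𝓝 (1 + 0)) := by
    refine tendsto_const_nhds.add (Tendsto.const_div_atTop ?_ _)
    exact tendsto_atTop_add_const_left _ _ tendsto_natCast_atTop_atTop
  rw [add_zero] at h
  refine h.congr' ?_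
  filter_upwards [(tendsto_atTop_add_const_left atTop y
    (tendsto_natCast_atTop_atTop (R := ℝ))).eventually_ne_atTop 0] with n hn
  field_simp
  ring

theorem tendsto_hypergeometric_ratio (a b c : ℝ) :
    Tendsto (fun n : ℕ => (a + n) * (b + n) / ((c + n) * (n + 1))) atTop (𝓝 1) := by
  have h := (tendsto_add_div_add a c).mul (tendsto_add_div_add b 1)
  rw [one_mul] at h
  refine h.congr fun n => ?_
  rw [div_mul_div_comm, add_comm 1 (n : ℝ)]

theorem summable_hypergeometric (a b : ℝ) {c z : ℝ} (hc : 0 < c) (hz : |z| < 1) :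
    Summable fun n => ordinaryHypergeometricCoefficient a b c n * z ^ n :=
  summable_mul_pow_of_ratio (ordinaryHypergeometricCoefficient_succ a b hc)
    (tendsto_hypergeometric_ratio a b c) hz

theorem summable_deriv_hypergeometric (a b : ℝ) {c z : ℝ} (hc : 0 < c) (hz : |z| < 1) :
    Summable fun n : ℕ =>
      (n + 1) * ordinaryHypergeometricCoefficient a b c (n + 1) * z ^ n := by
  refine summable_mul_pow_of_ratio
    (w := fun n : ℕ => (n + 1) * ordinaryHypergeometricCoefficient a b c (n + 1))
    (q := fun n : ℕ => ((a + 1) + n) * ((b + 1) + n) / (((c + 1) + n) * (n + 1)))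
    (fun n => ?_) (tendsto_hypergeometric_ratio (a + 1) (b + 1) (c + 1)) hz
  rw [ordinaryHypergeometricCoefficient_succ a b hc (n + 1)]
  have : c + 1 + n ≠ 0 := by positivity
  have : c + (n + 1) ≠ 0 := by positivity
  push_cast
  field_simp
  ring

theorem hasSum_hypergeometric (a b : ℝ) {c z : ℝ} (hc : 0 < c) (hz : |z| < 1) :
    HasSum (fun n => ordinaryHypergeometricCoefficient a b c n * z ^ n)
      (ordinaryHypergeometric a b c z) := by
  rw [ordinaryHypergeometric_eq_tsum_mul_pow]
  exact (summable_hypergeometric a b hc hz).hasSum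

/-- The derivative of the hypergeometric function, with its power series. -/
theorem exists_hasDerivAt_hypergeometric (a b : ℝ) {c z : ℝ} (hc : 0 < c) (hz : |z| < 1) :
    ∃ f', HasDerivAt (fun z : ℝ => ordinaryHypergeometric a b c z) f' z ∧
      HasSum (fun n : ℕ =>
        (n + 1) * ordinaryHypergeometricCoefficient a b c (n + 1) * z ^ n) f' ∧
      HasSum (fun n : ℕ => n * ordinaryHypergeometricCoefficient a b c n * z ^ n) (z * f') := by
  have hs := (summable_deriv_hypergeometric a b hc hz).hasSum
  refine ⟨_, ?_, hs, ?_⟩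
  · have h := hasDerivAt_tsum_mul_pow
      (fun z hz => summable_deriv_hypergeometric a b hc hz) hz
    simpa only [ordinaryHypergeometric_eq_tsum_mul_pow] using h
  · rw [← hasSum_nat_add_iff' 1]
    simp only [Finset.range_one, Finset.sum_singleton, Nat.cast_zero, zero_mul, sub_zero]
    refine (hs.mul_left z).congr_fun fun n => ?_
    push_cast
    ring

theorem self_mul_ascPochhammer_add_one (x : ℝ) (n : ℕ) :
    x * (ascPochhammer ℝ n).eval (x + 1) = (ascPochhammer ℝ n).eval x * (x + n) := by
  rw [← ascPochhammer_succ_eval, ascPochhammer_succ_left]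
  simp [Polynomial.eval_comp]

/-- First-order system: the derivative of `F(-k, c - k; c)`. -/
theorem hasDerivAt_hypergeometric_fst (k : ℝ) {c z : ℝ} (hc : 0 < c) (hz : |z| < 1) :
    HasDerivAt (fun z : ℝ => ordinaryHypergeometric (-k) (c - k) c z)
      ((k ^ 2 / c * ordinaryHypergeometric (1 - k) (c - k) (c + 1) z -
        k * ordinaryHypergeometric (-k) (c - k) c z) / (1 - z)) z := by
  obtain ⟨f', hf', hs, hs'⟩ := exists_hasDerivAt_hypergeometric (-k) (c - k) hc hz
  have hf := hasSum_hypergeometric (-k) (c - k) hc hz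
  have hg := hasSum_hypergeometric (1 - k) (c - k) (by linarith : 0 < c + 1) hz
  have h1z : 1 - z ≠ 0 := by have := (abs_lt.1 hz).2; linarith
  -- Comparison of coefficients in `(1 - z) f' + k f = (k²/c) g`, where `f`, `g` are the two
  -- hypergeometric functions. The shift relations for Pochhammer symbols bring the coefficients to
  -- common factors.
  have key := ((hs.sub hs').add (hf.mul_left k)).unique
    ((hg.mul_left (k ^ 2 / c)).congr_fun fun n => ?_)
  · refine hf'.congr_deriv ?_
    field_simp at key ⊢
    linear_combination key
  · have p1 := self_mul_ascPochhammer_add_one (-k) n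
    have p2 := self_mul_ascPochhammer_add_one c n
    have q1 : (ascPochhammer ℝ n).eval c ≠ 0 := (ascPochhammer_pos n c hc).ne'
    have q2 : (ascPochhammer ℝ n).eval (c + 1) ≠ 0 :=
      (ascPochhammer_pos n _ (by linarith)).ne'
    have q3 : c + n ≠ 0 := by positivity
    rw [ordinaryHypergeometricCoefficient_succ _ _ hc]
    simp only [ordinaryHypergeometricCoefficient]
    rw [show 1 - k = -k + 1 by ring]
    have p2' : (ascPochhammer ℝ n).eval c = c * (ascPochhammer ℝ n).eval (c + 1) / (c + n) := by
      field_simp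
      linear_combination -p2
    rw [p2']
    generalize (ascPochhammer ℝ n).eval (-k) = A at *
    generalize (ascPochhammer ℝ n).eval (c - k) = B
    generalize (ascPochhammer ℝ n).eval (-k + 1) = P at *
    field_simp
    linear_combination k * B * z ^ n * p1

/-- First-order system: the derivative of `F(1 - k, c - k; c + 1)`. -/
theorem hasDerivAt_hypergeometric_snd (k : ℝ) {c z : ℝ} (hc : 0 < c) (hz0 : z ≠ 0)
    (hz : |z| < 1) :
    HasDerivAt (fun z : ℝ => ordinaryHypergeometric (1 - k) (c - k) (c + 1) z)
      ((c * ordinaryHypergeometric (-k) (c - k) c z - (c * (1 - z) + k * z) *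
        ordinaryHypergeometric (1 - k) (c - k) (c + 1) z) / (z * (1 - z))) z := by
  have hc1 : 0 < c + 1 := by linarith
  obtain ⟨g', hg', -, hs'⟩ := exists_hasDerivAt_hypergeometric (1 - k) (c - k) hc1 hz
  have hf := hasSum_hypergeometric (-k) (c - k) hc hz
  have hg := hasSum_hypergeometric (1 - k) (c - k) hc1 hz
  have h1z : 1 - z ≠ 0 := by have := (abs_lt.1 hz).2; linarith
  have hB := ((hg.mul_left (c - k)).add hs').mul_left z
  have hA := ((hg.mul_left c).add hs').sub (hf.mul_left c)
  -- The identity compared is `c g + z g' - c f = z ((c - k) g + z g')`. The left series has no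
  -- constant term, and dropping it aligns the powers of `z` on both sides.
  rw [← hasSum_nat_add_iff' 1] at hA
  have key := hA.unique (hB.congr_fun fun n => ?_)
  · simp only [Finset.range_one, Finset.sum_singleton, ordinaryHypergeometricCoefficient] at key
    simp at key
    refine hg'.congr_deriv ?_
    field_simp
    linear_combination key
  · have p1 := self_mul_ascPochhammer_add_one (-k) n
    have p2 := self_mul_ascPochhammer_add_one c n
    have q1 : (ascPochhammer ℝ n).eval c ≠ 0 := (ascPochhammer_pos n c hc).ne'
    have q2 : (ascPochhammer ℝ n).eval (c + 1) ≠ 0 :=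
      (ascPochhammer_pos n _ (by linarith)).ne'
    have q3 : c + n ≠ 0 := by positivity
    have q4 : c + 1 + n ≠ 0 := by positivity
    rw [ordinaryHypergeometricCoefficient_succ _ _ hc,
      ordinaryHypergeometricCoefficient_succ _ _ hc1]
    simp only [ordinaryHypergeometricCoefficient]
    rw [show 1 - k = -k + 1 by ring]
    have p2' : (ascPochhammer ℝ n).eval c = c * (ascPochhammer ℝ n).eval (c + 1) / (c + n) := by
      field_simp
      linear_combination -p2
    rw [p2']
    generalize (ascPochhammer ℝ n).eval (-k) = A at *
    generalize (ascPochhammer ℝ n).eval (c - k) = B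
    generalize (ascPochhammer ℝ n).eval (-k + 1) = P at *
    push_cast
    field_simp
    linear_combination B * z ^ (n + 1) * (c + n + 1) * (c + n - k) * p1

/-- A contiguous relation. -/
theorem hypergeometric_contiguous (k : ℝ) {c z : ℝ} (hc : 0 < c) (hz : |z| < 1) :
    ordinaryHypergeometric (-k) (c - k) c z +
        k / c * ordinaryHypergeometric (1 - k) (c - k) (c + 1) z =
      (c + k) / c * ordinaryHypergeometric (-k) (c - k) (c + 1) z := by
  have hc1 : 0 < c + 1 := by linarith
  have hf := hasSum_hypergeometric (-k) (c - k) hc hz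
  have hg := hasSum_hypergeometric (1 - k) (c - k) hc1 hz
  have hh := hasSum_hypergeometric (-k) (c - k) hc1 hz
  refine (hf.add (hg.mul_left (k / c))).unique ((hh.mul_left ((c + k) / c)).congr_fun fun n => ?_)
  have p1 := self_mul_ascPochhammer_add_one (-k) n
  have p2 := self_mul_ascPochhammer_add_one c n
  have q1 : (ascPochhammer ℝ n).eval c ≠ 0 := (ascPochhammer_pos n c hc).ne'
  have q2 : (ascPochhammer ℝ n).eval (c + 1) ≠ 0 :=
    (ascPochhammer_pos n _ (by linarith)).ne'
  have q3 : c + n ≠ 0 := by positivity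
  simp only [ordinaryHypergeometricCoefficient]
  rw [show 1 - k = -k + 1 by ring]
  have p2' : (ascPochhammer ℝ n).eval c = c * (ascPochhammer ℝ n).eval (c + 1) / (c + n) := by
    field_simp
    linear_combination -p2
  rw [p2']
  generalize (ascPochhammer ℝ n).eval (-k) = A at *
  generalize (ascPochhammer ℝ n).eval (c - k) = B
  generalize (ascPochhammer ℝ n).eval (-k + 1) = P at *
  field_simp
  linear_combination (-B) * z ^ n * p1

/-! ### Beta integrals and the value of the hypergeometric function at one -/

theorem ascPochhammer_eval_mul_Gamma {x : ℝ} (hx : 0 < x) (n : ℕ) :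
    (ascPochhammer ℝ n).eval x * Real.Gamma x = Real.Gamma (x + n) := by
  induction n with
  | zero => simp
  | succ n ih =>
    have h : x + n ≠ 0 := by positivity
    rw [ascPochhammer_succ_eval, mul_right_comm, ih, Nat.cast_succ, ← add_assoc,
      Real.Gamma_add_one h, mul_comm]

theorem integrableOn_beta {u v : ℝ} (hu : 0 < u) (hv : 0 < v) :
    IntegrableOn (fun t : ℝ => t ^ (u - 1) * (1 - t) ^ (v - 1)) (Ioo 0 1) := by
  have h := Complex.betaIntegral_convergent (u := u) (v := v) (by simpa) (by simpa)
  rw [intervalIntegrable_iff_integrableOn_Ioo_of_le zero_le_one] at h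
  refine IntegrableOn.congr_fun h.re (fun t ht => ?_) measurableSet_Ioo
  have h1 : 0 ≤ 1 - t := by linarith [ht.2]
  have e : ((t : ℂ) ^ ((u : ℂ) - 1) * (1 - (t : ℂ)) ^ ((v : ℂ) - 1)) =
      ((t ^ (u - 1) * (1 - t) ^ (v - 1) : ℝ) : ℂ) := by
    push_cast
    rw [Complex.ofReal_cpow ht.1.le, Complex.ofReal_cpow h1]
    push_cast
    rfl
  simp only [e, RCLike.re_to_complex, Complex.ofReal_re]

theorem integral_beta {u v : ℝ} (hu : 0 < u) (hv : 0 < v) :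
    ∫ t in Ioo (0 : ℝ) 1, t ^ (u - 1) * (1 - t) ^ (v - 1) =
      Real.Gamma u * Real.Gamma v / Real.Gamma (u + v) := by
  have h := Complex.betaIntegral_eq_Gamma_mul_div u v (by simpa) (by simpa)
  rw [Complex.betaIntegral, intervalIntegral.integral_of_le zero_le_one,
    integral_Ioc_eq_integral_Ioo, ← Complex.ofReal_add, Complex.Gamma_ofReal,
    Complex.Gamma_ofReal, Complex.Gamma_ofReal] at h
  have e : ∫ t in Ioo (0 : ℝ) 1, ((t : ℂ) ^ ((u : ℂ) - 1) * (1 - (t : ℂ)) ^ ((v : ℂ) - 1)) =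
      ∫ t in Ioo (0 : ℝ) 1, ((t ^ (u - 1) * (1 - t) ^ (v - 1) : ℝ) : ℂ) := by
    refine setIntegral_congr_fun measurableSet_Ioo fun t ht => ?_
    have h1 : 0 ≤ 1 - t := by linarith [ht.2]
    push_cast
    rw [Complex.ofReal_cpow ht.1.le, Complex.ofReal_cpow h1]
    push_cast
    rfl
  rw [e, integral_complex_ofReal] at h
  exact_mod_cast h

/-- The binomial series. -/
theorem hasSum_binomial (k : ℝ) {x : ℝ} (hx : |x| < 1) :
    HasSum (fun n : ℕ => (ascPochhammer ℝ n).eval (-k) / n.factorial * x ^ n) ((1 - x) ^ k) := by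
  have hco : ∀ n : ℕ, ordinaryHypergeometricCoefficient (-k) 1 (1 : ℝ) n =
      (ascPochhammer ℝ n).eval (-k) / n.factorial := by
    intro n
    have h : (ascPochhammer ℝ n).eval 1 ≠ 0 := (ascPochhammer_pos n 1 one_pos).ne'
    simp only [ordinaryHypergeometricCoefficient]
    field_simp
  set y : ℝ → ℝ := ordinaryHypergeometric (-k) 1 (1 : ℝ) with hy
  -- The series `y` satisfies `(1 - t) y' = -k y`, so `y (1 - t)^(-k)` is constant, equal to its
  -- value `1` at the origin.
  have hder : ∀ t ∈ Ioo (-1 : ℝ) 1,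
      HasDerivAt (fun t => y t * (1 - t) ^ (-k)) 0 t := by
    intro t ht
    have ht' : |t| < 1 := abs_lt.2 ht
    have h1 : 0 < 1 - t := by linarith [ht.2]
    obtain ⟨f', hf', hs, hs'⟩ := exists_hasDerivAt_hypergeometric (-k) 1 one_pos ht'
    have hf := hasSum_hypergeometric (-k) 1 one_pos ht'
    have key : f' - t * f' = -k * y t := by
      refine (hs.sub hs').unique ((hf.mul_left (-k)).congr_fun fun n => ?_)
      rw [ordinaryHypergeometricCoefficient_succ _ _ one_pos]
      have : (1 : ℝ) + n ≠ 0 := by positivity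
      field_simp
      ring
    have hp : HasDerivAt (fun t : ℝ => (1 - t) ^ (-k)) (-1 * (-k) * (1 - t) ^ (-k - 1)) t :=
      ((hasDerivAt_id t).const_sub 1).rpow_const (Or.inl h1.ne')
    refine (hf'.mul hp).congr_deriv ?_
    have e : (1 - t) ^ (-k) = (1 - t) ^ (-k - 1) * (1 - t) := by
      rw [← Real.rpow_add_one h1.ne']
      congr 1
      ring
    rw [e]
    linear_combination (1 - t) ^ (-k - 1) * key
  have hconst : y x * (1 - x) ^ (-k) = 1 := by
    have hx' : x ∈ Ioo (-1 : ℝ) 1 := abs_lt.1 hx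
    have h := isOpen_Ioo.is_const_of_deriv_eq_zero isPreconnected_Ioo
      (fun t ht => (hder t ht).differentiableAt.differentiableWithinAt)
      (fun t ht => (hder t ht).deriv) hx' (show (0 : ℝ) ∈ Ioo (-1 : ℝ) 1 by norm_num)
    simpa [hy] using h
  have h1x : 0 < 1 - x := by linarith [(abs_lt.1 hx).2]
  have hyx : y x = (1 - x) ^ k := by
    rw [Real.rpow_neg h1x.le] at hconst
    have := (Real.rpow_pos_of_pos h1x k).ne'
    field_simp at hconst
    exact hconst
  have := hasSum_hypergeometric (-k) 1 one_pos hx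
  simp only [hco] at this
  rwa [← hyx]

/-- Euler's integral for `F(-k, b; b + 1 + k; z)`. -/
theorem hypergeometric_euler_integral {k b z : ℝ} (hk : -1 < k) (hb : 0 < b) (hz : z ∈ Ico 0 1) :
    ∫ t in Ioo (0 : ℝ) 1, t ^ (b - 1) * (1 - t) ^ k * (1 - z * t) ^ k =
      Real.Gamma b * Real.Gamma (1 + k) / Real.Gamma (b + (1 + k)) *
        ordinaryHypergeometric (-k) b (b + (1 + k)) z := by
  have hz' : |z| < 1 := by rw [abs_of_nonneg hz.1]; exact hz.2
  have hc : 0 < b + (1 + k) := by linarith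
  set w : ℕ → ℝ := fun n => (ascPochhammer ℝ n).eval (-k) / n.factorial with hw
  have hint : ∀ n : ℕ, IntegrableOn
      (fun t : ℝ => w n * z ^ n * (t ^ (b + n - 1) * (1 - t) ^ (1 + k - 1))) (Ioo 0 1) :=
    fun n => (integrableOn_beta (by positivity) (by linarith)).const_mul _
  have hval : ∀ n : ℕ, ∫ t in Ioo (0 : ℝ) 1, t ^ (b + n - 1) * (1 - t) ^ (1 + k - 1) =
      Real.Gamma (b + n) * Real.Gamma (1 + k) / Real.Gamma (b + n + (1 + k)) :=
    fun n => integral_beta (by positivity) (by linarith)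
  have hnn : ∀ n : ℕ, ∀ t ∈ Ioo (0 : ℝ) 1, 0 ≤ t ^ (b + n - 1) * (1 - t) ^ (1 + k - 1) :=
    fun n t ht => mul_nonneg (Real.rpow_nonneg ht.1.le _)
      (Real.rpow_nonneg (by linarith [ht.2]) _)
  -- The binomial series for `(1 - z t)^k` may be integrated term by term: every Beta integral is at
  -- most the one with `n = 0`, and the binomial series converges absolutely at `z`.
  have hsumm : Summable fun n : ℕ => ∫ t in Ioo (0 : ℝ) 1,
      ‖w n * z ^ n * (t ^ (b + n - 1) * (1 - t) ^ (1 + k - 1))‖ := by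
    have hs : Summable fun n => |w n * z ^ n| * ∫ t in Ioo (0 : ℝ) 1,
        t ^ (b - 1) * (1 - t) ^ (1 + k - 1) :=
      (hasSum_binomial k hz').summable.abs.mul_right _
    refine hs.of_nonneg_of_le (fun n => integral_nonneg fun t => norm_nonneg _) fun n => ?_
    rw [← integral_const_mul]
    refine setIntegral_mono_on (hint n).norm
      ((integrableOn_beta hb (by linarith)).const_mul _) measurableSet_Ioo fun t ht => ?_
    rw [norm_mul, Real.norm_eq_abs, Real.norm_of_nonneg (hnn n t ht)]
    refine mul_le_mul_of_nonneg_left (mul_le_mul_of_nonneg_right ?_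
      (Real.rpow_nonneg (by linarith [ht.2]) _)) (abs_nonneg _)
    exact Real.rpow_le_rpow_of_exponent_ge ht.1 ht.2.le (by
      have : (0 : ℝ) ≤ n := Nat.cast_nonneg n
      linarith)
  have hsum := hasSum_integral_of_summable_integral_norm hint hsumm
  have hL : ∫ t in Ioo (0 : ℝ) 1, ∑' n : ℕ,
      w n * z ^ n * (t ^ (b + n - 1) * (1 - t) ^ (1 + k - 1)) =
      ∫ t in Ioo (0 : ℝ) 1, t ^ (b - 1) * (1 - t) ^ k * (1 - z * t) ^ k := by
    refine setIntegral_congr_fun measurableSet_Ioo fun t ht => ?_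
    have hzt : |z * t| < 1 := by
      rw [abs_mul, abs_of_pos ht.1]
      nlinarith [ht.1, ht.2, abs_nonneg z]
    have h := (hasSum_binomial k hzt).mul_left (t ^ (b - 1) * (1 - t) ^ k)
    refine Eq.trans (tsum_congr fun n => ?_) h.tsum_eq
    rw [show b + n - 1 = b - 1 + n by ring, Real.rpow_add ht.1, Real.rpow_natCast,
      add_sub_cancel_left, mul_pow]
    ring
  rw [hL] at hsum
  refine hsum.unique (((hasSum_hypergeometric (-k) b hc hz').mul_left _).congr_fun fun n => ?_)
  have q1 : (ascPochhammer ℝ n).eval (b + (1 + k)) ≠ 0 := (ascPochhammer_pos n _ hc).ne'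
  have q2 : Real.Gamma (b + (1 + k)) ≠ 0 := (Real.Gamma_pos_of_pos hc).ne'
  rw [integral_const_mul, hval, ← ascPochhammer_eval_mul_Gamma hb,
    show b + n + (1 + k) = b + (1 + k) + n by ring, ← ascPochhammer_eval_mul_Gamma hc]
  simp only [ordinaryHypergeometricCoefficient, hw]
  field_simp

/-- Gauss's value at `1`, by dominated convergence in Euler's integral. The limiting integrand is
`t^(b-1) (1 - t)^(2k)`, integrable because `2k > -1`. -/
theorem tendsto_hypergeometric_one {k b : ℝ} (hk : -(1 / 2) < k) (hb : 0 < b) :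
    Tendsto (fun z : ℝ => ordinaryHypergeometric (-k) b (b + (1 + k)) z) (𝓝[<] 1)
      (𝓝 (Real.Gamma (b + (1 + k)) * Real.Gamma (1 + 2 * k) /
        (Real.Gamma (1 + k) * Real.Gamma (b + (1 + 2 * k))))) := by
  have g1 : Real.Gamma (b + (1 + k)) ≠ 0 := (Real.Gamma_pos_of_pos (by linarith)).ne'
  have g2 : Real.Gamma b ≠ 0 := (Real.Gamma_pos_of_pos hb).ne'
  have g3 : Real.Gamma (1 + k) ≠ 0 := (Real.Gamma_pos_of_pos (by linarith)).ne'
  have g4 : Real.Gamma (b + (1 + 2 * k)) ≠ 0 := (Real.Gamma_pos_of_pos (by linarith)).ne'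
  have i1 := integrableOn_beta hb (show 0 < 1 + k by linarith)
  have i2 := integrableOn_beta hb (show 0 < 1 + 2 * k by linarith)
  have key : Tendsto
      (fun z : ℝ => ∫ t in Ioo (0 : ℝ) 1, t ^ (b - 1) * (1 - t) ^ k * (1 - z * t) ^ k) (𝓝[<] 1)
      (𝓝 (∫ t in Ioo (0 : ℝ) 1, t ^ (b - 1) * (1 - t) ^ (1 + 2 * k - 1))) := by
    refine tendsto_integral_filter_of_dominated_convergence
      (fun t => t ^ (b - 1) * (1 - t) ^ (1 + k - 1) + t ^ (b - 1) * (1 - t) ^ (1 + 2 * k - 1))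
      (Eventually.of_forall fun z => ?_) ?_ (i1.add i2) ?_
    · exact Measurable.aestronglyMeasurable (by fun_prop)
    · filter_upwards [Ioo_mem_nhdsLT (show (0 : ℝ) < 1 by norm_num)] with z hz
      refine (ae_restrict_iff' measurableSet_Ioo).2 (Eventually.of_forall fun t ht => ?_)
      have h1 : 0 < 1 - t := by linarith [ht.2]
      have h2 : 1 - t ≤ 1 - z * t := by nlinarith [ht.1, hz.2]
      have h3 : 1 - z * t ≤ 1 := by nlinarith [ht.1, hz.1]
      have h4 : 0 ≤ t ^ (b - 1) := Real.rpow_nonneg ht.1.le _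
      have h5 : 0 ≤ (1 - t) ^ k := Real.rpow_nonneg h1.le _
      -- One majorant for both signs of `k`: the power is at most `1` when `k ≥ 0` and at most `(1 -
      -- t)^k` when `k ≤ 0`.
      have h6 : (1 - z * t) ^ k ≤ 1 + (1 - t) ^ k := by
        rcases le_total 0 k with hk0 | hk0
        · have := Real.rpow_le_one (h1.le.trans h2) h3 hk0
          linarith
        · have := Real.rpow_le_rpow_of_nonpos h1 h2 hk0
          linarith
      have h7 : (1 - t) ^ (1 + 2 * k - 1) = (1 - t) ^ k * (1 - t) ^ k := by
        rw [← Real.rpow_add h1]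
        congr 1
        ring
      rw [Real.norm_of_nonneg (mul_nonneg (mul_nonneg h4 h5)
        (Real.rpow_nonneg (h1.le.trans h2) _)), h7, add_sub_cancel_left]
      calc t ^ (b - 1) * (1 - t) ^ k * (1 - z * t) ^ k
          ≤ t ^ (b - 1) * (1 - t) ^ k * (1 + (1 - t) ^ k) :=
            mul_le_mul_of_nonneg_left h6 (mul_nonneg h4 h5)
        _ = _ := by ring
    · refine (ae_restrict_iff' measurableSet_Ioo).2 (Eventually.of_forall fun t ht => ?_)
      have h1 : 0 < 1 - t := by linarith [ht.2]
      have h7 : (1 - t) ^ (1 + 2 * k - 1) = (1 - t) ^ k * (1 - 1 * t) ^ k := by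
        rw [one_mul, ← Real.rpow_add h1]
        congr 1
        ring
      rw [h7, ← mul_assoc]
      have hc : ContinuousAt (fun z : ℝ => (1 - z * t) ^ k) 1 :=
        ContinuousAt.rpow_const (by fun_prop) (Or.inl (by rw [one_mul]; exact h1.ne'))
      exact (hc.tendsto.mono_left nhdsWithin_le_nhds).const_mul _
  rw [integral_beta hb (by linarith)] at key
  have key2 := key.const_mul (Real.Gamma (b + (1 + k)) / (Real.Gamma b * Real.Gamma (1 + k)))
  have e : Real.Gamma (b + (1 + k)) / (Real.Gamma b * Real.Gamma (1 + k)) *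
      (Real.Gamma b * Real.Gamma (1 + 2 * k) / Real.Gamma (b + (1 + 2 * k))) =
      Real.Gamma (b + (1 + k)) * Real.Gamma (1 + 2 * k) /
        (Real.Gamma (1 + k) * Real.Gamma (b + (1 + 2 * k))) := by
    field_simp
  rw [e] at key2
  refine key2.congr' ?_
  filter_upwards [Ioo_mem_nhdsLT (show (0 : ℝ) < 1 by norm_num)] with z hz
  rw [hypergeometric_euler_integral (by linarith) hb ⟨hz.1.le, hz.2⟩]
  field_simp

/-! ### The rows of the matrix `L` -/

/-- The first entry of the first row of `L`. -/
def rowFst (k₀ k₁ u : ℝ) : ℝ :=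
  u ^ k₁ * ((1 - u ^ 2) ^ (-k₀) *
    ordinaryHypergeometric (-k₀) (k₁ + 1 / 2 - k₀) (k₁ + 1 / 2) (u ^ 2))

/-- The second entry of the first row of `L`. -/
def rowSnd (k₀ k₁ u : ℝ) : ℝ :=
  u ^ k₁ * (u * (-(k₀ / (k₁ + 1 / 2)) * ((1 - u ^ 2) ^ (-k₀) *
    ordinaryHypergeometric (1 - k₀) (k₁ + 1 / 2 - k₀) (k₁ + 1 / 2 + 1) (u ^ 2))))

/-- The second row is the first row with `k₁` replaced by `-k₁` and the entries exchanged, so a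
single pair of functions has to be studied. -/
theorem matL_eq (k₀ k₁ : ℝ) {u : ℝ} (hu : 0 < u) :
    matL k₀ k₁ u = !![rowFst k₀ k₁ u, rowSnd k₀ k₁ u; rowSnd k₀ (-k₁) u, rowFst k₀ (-k₁) u] := by
  have e1 : 1 / 2 - k₀ + k₁ = k₁ + 1 / 2 - k₀ := by ring
  have e2 : 1 / 2 - k₀ - k₁ = -k₁ + 1 / 2 - k₀ := by ring
  have e3 : k₁ + 3 / 2 = k₁ + 1 / 2 + 1 := by ring
  have e4 : 3 / 2 - k₁ = -k₁ + 1 / 2 + 1 := by ring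
  have e5 : 1 / 2 - k₁ = -k₁ + 1 / 2 := by ring
  ext i j
  fin_cases i <;> fin_cases j <;>
    simp only [matL, rowFst, rowSnd, abs_of_pos hu, e1, e2, e3, e4, e5] <;> simp <;> ring

/-- The linear system satisfied by the rows of `L`. -/
def IsRowSolution (k₀ k₁ : ℝ) (a b : ℝ → ℝ) : Prop :=
  ∀ u ∈ Ioo (0 : ℝ) 1, HasDerivAt a (k₁ / u * a u - 2 * k₀ / (1 - u ^ 2) * b u) u ∧
    HasDerivAt b (-(2 * k₀ / (1 - u ^ 2)) * a u - k₁ / u * b u) u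

/-- This is the pair of hypergeometric derivative formulas with `c = k₁ + 1/2` and `z = u²`, after
the power prefactors are differentiated. -/
theorem isRowSolution_row (k₀ : ℝ) {k₁ : ℝ} (hc : 0 < k₁ + 1 / 2) :
    IsRowSolution k₀ k₁ (rowFst k₀ k₁) (rowSnd k₀ k₁) := by
  intro u hu
  have h0 : u ≠ 0 := hu.1.ne'
  have h1 : 0 < 1 - u ^ 2 := by nlinarith [hu.1, hu.2]
  have hz : |u ^ 2| < 1 := by rw [abs_of_nonneg (sq_nonneg u)]; linarith
  have hsq : HasDerivAt (fun u : ℝ => u ^ 2) (2 * u) u := by simpa using hasDerivAt_pow 2 u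
  have hp : HasDerivAt (fun u : ℝ => u ^ k₁) (k₁ * u ^ (k₁ - 1)) u :=
    Real.hasDerivAt_rpow_const (Or.inl h0)
  have hq : HasDerivAt (fun u : ℝ => (1 - u ^ 2) ^ (-k₀))
      (-(2 * u) * (-k₀) * (1 - u ^ 2) ^ (-k₀ - 1)) u :=
    (hsq.const_sub 1).rpow_const (Or.inl h1.ne')
  have hf := HasDerivAt.comp (h := fun u : ℝ => u ^ 2) u (hasDerivAt_hypergeometric_fst k₀ hc hz) hsq
  have hg := HasDerivAt.comp (h := fun u : ℝ => u ^ 2) u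
    (hasDerivAt_hypergeometric_snd k₀ hc (pow_ne_zero 2 h0) hz) hsq
  have ep : u ^ k₁ = u ^ (k₁ - 1) * u := by
    rw [← Real.rpow_add_one h0]; congr 1; ring
  have eq : (1 - u ^ 2) ^ (-k₀) = (1 - u ^ 2) ^ (-k₀ - 1) * (1 - u ^ 2) := by
    rw [← Real.rpow_add_one h1.ne']; congr 1; ring
  refine ⟨(hp.mul (hq.mul hf)).congr_deriv ?_,
    (hp.mul ((hasDerivAt_id u).mul ((hq.mul hg).const_mul _))).congr_deriv ?_⟩
  · simp only [rowFst, rowSnd, Function.comp_apply, Pi.mul_apply]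
    generalize ordinaryHypergeometric (-k₀) (k₁ + 1 / 2 - k₀) (k₁ + 1 / 2) (u ^ 2) = F at *
    generalize ordinaryHypergeometric (1 - k₀) (k₁ + 1 / 2 - k₀) (k₁ + 1 / 2 + 1) (u ^ 2) = G at *
    generalize k₁ + 1 / 2 = c at *
    rw [ep, eq]
    have := h1.ne'
    field_simp
    ring
  · simp only [rowFst, rowSnd, Function.comp_apply, Pi.mul_apply, id]
    generalize ordinaryHypergeometric (-k₀) (k₁ + 1 / 2 - k₀) (k₁ + 1 / 2) (u ^ 2) = F at *
    generalize ordinaryHypergeometric (1 - k₀) (k₁ + 1 / 2 - k₀) (k₁ + 1 / 2 + 1) (u ^ 2) = G at *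
    obtain ⟨c, hck⟩ : ∃ c, c = k₁ + 1 / 2 := ⟨_, rfl⟩
    have hk : k₁ = c - 1 / 2 := by linarith
    rw [ep, eq, ← hck]
    rw [← hck] at hc
    have := h1.ne'
    generalize u ^ (k₁ - 1) = p at *
    generalize (1 - u ^ 2) ^ (-k₀ - 1) = q at *
    subst hk
    field_simp
    ring

/-- Exchanging the components compensates `k₁ → -k₁`, so both rows of `L` solve the same system. -/
theorem IsRowSolution.swap {k₀ k₁ : ℝ} {a b : ℝ → ℝ} (h : IsRowSolution k₀ (-k₁) a b) :
    IsRowSolution k₀ k₁ b a := fun u hu =>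
  ⟨(h u hu).2.congr_deriv (by ring), (h u hu).1.congr_deriv (by ring)⟩

theorem IsRowSolution.neg_snd {k₀ k₁ : ℝ} {a b : ℝ → ℝ} (h : IsRowSolution (-k₀) k₁ a b) :
    IsRowSolution k₀ k₁ a (fun u => -b u) := fun u hu =>
  ⟨(h u hu).1.congr_deriv (by ring), (h u hu).2.fun_neg.congr_deriv (by ring)⟩

theorem eq_of_hasDerivAt_zero_of_tendsto {W : ℝ → ℝ} {w : ℝ}
    (hW : ∀ u ∈ Ioo (0 : ℝ) 1, HasDerivAt W 0 u) (hw : Tendsto W (𝓝[>] 0) (𝓝 w)) {u : ℝ}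
    (hu : u ∈ Ioo (0 : ℝ) 1) : W u = w := by
  refine tendsto_nhds_unique (tendsto_const_nhds.congr' ?_) hw
  filter_upwards [Ioo_mem_nhdsGT (show (0 : ℝ) < 1 by norm_num)] with v hv
  exact isOpen_Ioo.is_const_of_deriv_eq_zero isPreconnected_Ioo
      (fun t ht => (hW t ht).differentiableAt.differentiableWithinAt)
      (fun t ht => (hW t ht).deriv) hu hv

/-- The coefficient matrix has trace `k₁/u - k₁/u = 0`, so the Wronskian is constant and can be read
off at `u = 0`. -/
theorem IsRowSolution.wronskian {k₀ k₁ : ℝ} {a b a' b' : ℝ → ℝ} (h : IsRowSolution k₀ k₁ a b)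
    (h' : IsRowSolution k₀ k₁ a' b') {w : ℝ}
    (hw : Tendsto (fun u => a u * b' u - b u * a' u) (𝓝[>] 0) (𝓝 w)) {u : ℝ}
    (hu : u ∈ Ioo (0 : ℝ) 1) : a u * b' u - b u * a' u = w := by
  refine eq_of_hasDerivAt_zero_of_tendsto (W := fun u => a u * b' u - b u * a' u)
    (fun v hv => ?_) hw hu
  refine (((h v hv).1.mul (h' v hv).2).sub ((h v hv).2.mul (h' v hv).1)).congr_deriv ?_
  ring

theorem tendsto_hypergeometric_sq_zero (a b : ℝ) {c : ℝ} (hc : 0 < c) :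
    Tendsto (fun u : ℝ => ordinaryHypergeometric a b c (u ^ 2)) (𝓝[>] 0) (𝓝 1) := by
  obtain ⟨f', hf', -⟩ := exists_hasDerivAt_hypergeometric a b hc (z := 0) (by simp)
  have h := hf'.continuousAt.tendsto
  simp only [ordinaryHypergeometric_zero] at h
  refine h.comp ?_
  have : Tendsto (fun u : ℝ => u ^ 2) (𝓝 0) (𝓝 (0 ^ 2)) := (continuous_pow 2).tendsto 0
  rw [zero_pow two_ne_zero] at this
  exact this.mono_left nhdsWithin_le_nhds

theorem tendsto_one_sub_sq_rpow (k : ℝ) :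
    Tendsto (fun u : ℝ => (1 - u ^ 2) ^ k) (𝓝[>] 0) (𝓝 1) := by
  have h : ContinuousAt (fun u : ℝ => (1 - u ^ 2) ^ k) 0 :=
    ContinuousAt.rpow_const (by fun_prop) (Or.inl (by norm_num))
  have := h.tendsto.mono_left (nhdsWithin_le_nhds (s := Ioi 0))
  simpa using this

theorem exists_rowFst_eq (k₀ : ℝ) {k₁ : ℝ} (hc : 0 < k₁ + 1 / 2) :
    ∃ A : ℝ → ℝ, (∀ u, rowFst k₀ k₁ u = u ^ k₁ * A u) ∧ Tendsto A (𝓝[>] 0) (𝓝 1) := by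
  refine ⟨_, fun u => rfl, ?_⟩
  simpa using (tendsto_one_sub_sq_rpow (-k₀)).mul
    (tendsto_hypergeometric_sq_zero (-k₀) (k₁ + 1 / 2 - k₀) hc)

theorem exists_rowSnd_eq (k₀ : ℝ) {k₁ : ℝ} (hc : 0 < k₁ + 1 / 2) :
    ∃ (B : ℝ → ℝ) (x : ℝ), (∀ u, rowSnd k₀ k₁ u = u ^ k₁ * (u * B u)) ∧
      Tendsto B (𝓝[>] 0) (𝓝 x) :=
  ⟨_, _, fun u => rfl, ((tendsto_one_sub_sq_rpow (-k₀)).mul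
    (tendsto_hypergeometric_sq_zero (1 - k₀) (k₁ + 1 / 2 - k₀) (by linarith))).const_mul _⟩

theorem tendsto_rpow_zero {p : ℝ} (hp : 0 < p) :
    Tendsto (fun u : ℝ => u ^ p) (𝓝[>] 0) (𝓝 0) := by
  have h := (Real.continuousAt_rpow_const 0 p (Or.inr hp.le)).tendsto
  rw [Real.zero_rpow hp.ne'] at h
  exact h.mono_left nhdsWithin_le_nhds

theorem tendsto_id_zero : Tendsto (fun u : ℝ => u) (𝓝[>] 0) (𝓝 0) :=
  tendsto_id.mono_left nhdsWithin_le_nhds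

/-- `det L = 1`. -/
theorem row_det (k₀ : ℝ) {k₁ : ℝ} (hc : 0 < k₁ + 1 / 2) (hc' : 0 < -k₁ + 1 / 2) {u : ℝ}
    (hu : u ∈ Ioo (0 : ℝ) 1) :
    rowFst k₀ k₁ u * rowFst k₀ (-k₁) u - rowSnd k₀ k₁ u * rowSnd k₀ (-k₁) u = 1 := by
  refine (isRowSolution_row k₀ hc).wronskian (isRowSolution_row k₀ hc').swap ?_ hu
  obtain ⟨A, hA, tA⟩ := exists_rowFst_eq k₀ hc
  obtain ⟨A', hA', tA'⟩ := exists_rowFst_eq k₀ hc'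
  obtain ⟨B, x, hB, tB⟩ := exists_rowSnd_eq k₀ hc
  obtain ⟨B', x', hB', tB'⟩ := exists_rowSnd_eq k₀ hc'
  have h := (tA.mul tA').sub ((tendsto_id_zero.mul tB).mul (tendsto_id_zero.mul tB'))
  simp only [one_mul, zero_mul, sub_zero] at h
  refine h.congr' ?_
  filter_upwards [self_mem_nhdsWithin] with u hu
  have e : u ^ k₁ * u ^ (-k₁) = 1 := by rw [← Real.rpow_add hu]; simp
  rw [hA, hA', hB, hB']
  linear_combination (-(A u * A' u) + u * B u * (u * B' u)) * e

/-- The rows depend on `k₀` through its sign only up to reflection. -/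
theorem row_neg (k₀ : ℝ) {k₁ : ℝ} (hc : 0 < k₁ + 1 / 2) (hc' : 0 < -k₁ + 1 / 2) {u : ℝ}
    (hu : u ∈ Ioo (0 : ℝ) 1) :
    rowFst (-k₀) k₁ u = rowFst k₀ k₁ u ∧ rowSnd (-k₀) k₁ u = -rowSnd k₀ k₁ u := by
  have hs : IsRowSolution k₀ k₁ (rowFst (-k₀) k₁) (fun u => -rowSnd (-k₀) k₁ u) :=
    (isRowSolution_row (-k₀) hc).neg_snd
  obtain ⟨A, hA, tA⟩ := exists_rowFst_eq k₀ hc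
  obtain ⟨A', hA', tA'⟩ := exists_rowFst_eq k₀ hc'
  obtain ⟨B, x, hB, tB⟩ := exists_rowSnd_eq k₀ hc
  obtain ⟨B', x', hB', tB'⟩ := exists_rowSnd_eq k₀ hc'
  obtain ⟨A'', hA'', tA''⟩ := exists_rowFst_eq (-k₀) hc
  obtain ⟨B'', x'', hB'', tB''⟩ := exists_rowSnd_eq (-k₀) hc
  -- The candidate solution is identified by its Wronskians with the two rows of `L`: `0` with the
  -- first, since it is of order `u^(2k₁+1)`, and `1` with the second. As `det L = 1`, Cramer's rule
  -- then gives equality with the first row.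
  have w1 := hs.wronskian (isRowSolution_row k₀ hc) (w := 0) ?_ hu
  · have w2 := hs.wronskian (isRowSolution_row k₀ hc').swap (w := 1) ?_ hu
    · have hd := row_det k₀ hc hc' hu
      constructor
      · linear_combination (-rowFst (-k₀) k₁ u) * hd + rowFst k₀ k₁ u * w2 -
          rowSnd k₀ (-k₁) u * w1
      · linear_combination (-rowSnd (-k₀) k₁ u) * hd - rowSnd k₀ k₁ u * w2 +
          rowFst k₀ (-k₁) u * w1
    · have h := (tA''.mul tA').add ((tendsto_id_zero.mul tB'').mul (tendsto_id_zero.mul tB'))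
      simp only [one_mul, zero_mul, add_zero] at h
      refine h.congr' ?_
      filter_upwards [self_mem_nhdsWithin] with u hu
      have e : u ^ k₁ * u ^ (-k₁) = 1 := by rw [← Real.rpow_add hu]; simp
      rw [hA'', hA', hB'', hB']
      linear_combination (-(A'' u * A' u) - u * B'' u * (u * B' u)) * e
  · have h := (tendsto_rpow_zero (show 0 < k₁ + 1 / 2 + (k₁ + 1 / 2) by linarith)).mul
      ((tA''.mul tB).add (tB''.mul tA))
    rw [zero_mul] at h
    refine h.congr' ?_
    filter_upwards [self_mem_nhdsWithin] with u hu
    have e : u ^ (k₁ + 1 / 2 + (k₁ + 1 / 2)) = u ^ k₁ * u ^ k₁ * u := by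
      rw [← Real.rpow_add hu, ← Real.rpow_add_one (ne_of_gt hu)]
      congr 1
      ring
    rw [hA'', hB'', hA, hB, e]
    ring

/-- A priori bound for the solutions of the system. -/
theorem IsRowSolution.exists_bound {k₀ k₁ : ℝ} {a b : ℝ → ℝ} (h : IsRowSolution k₀ k₁ a b) :
    ∃ M, 0 ≤ M ∧ ∀ u ∈ Ioo (0 : ℝ) 1,
      a u ^ 2 + b u ^ 2 ≤ M * (u ^ (-(2 * |k₁|)) * (1 - u) ^ (-(2 * |k₀|))) := by
  set N : ℝ → ℝ := fun u => a u ^ 2 + b u ^ 2 with hN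
  -- A Gronwall argument for `N = a² + b²`. The system gives `|N'| ≤ R N`, and `P` is the
  -- exponential of an antiderivative of `R`, with `Q` its inverse.
  set P : ℝ → ℝ := fun u => u ^ (2 * |k₁|) * ((1 - u) ^ (-(2 * |k₀|)) * (1 + u) ^ (2 * |k₀|))
    with hP
  set Q : ℝ → ℝ := fun u => u ^ (-(2 * |k₁|)) * ((1 - u) ^ (2 * |k₀|) * (1 + u) ^ (-(2 * |k₀|)))
    with hQ
  set R : ℝ → ℝ := fun u => 2 * |k₁| / u + 4 * |k₀| / (1 - u ^ 2) with hR
  have hN0 : ∀ u, 0 ≤ N u := fun u => by positivity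
  have dN : ∀ u ∈ Ioo (0 : ℝ) 1, ∃ N', HasDerivAt N N' u ∧ |N'| ≤ R u * N u := by
    intro u hu
    have h1 : 0 < 1 - u ^ 2 := by nlinarith [hu.1, hu.2]
    refine ⟨_, ((h u hu).1.pow 2).add ((h u hu).2.pow 2), ?_⟩
    have e : ((2 : ℕ) : ℝ) * a u ^ (2 - 1) * (k₁ / u * a u - 2 * k₀ / (1 - u ^ 2) * b u) +
        ((2 : ℕ) : ℝ) * b u ^ (2 - 1) * (-(2 * k₀ / (1 - u ^ 2)) * a u - k₁ / u * b u) =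
        2 / u * (k₁ * (a u ^ 2 - b u ^ 2)) - 4 / (1 - u ^ 2) * (k₀ * (2 * a u * b u)) := by
      push_cast
      ring
    rw [e]
    have i1 : |k₁ * (a u ^ 2 - b u ^ 2)| ≤ |k₁| * N u := by
      rw [abs_mul]
      refine mul_le_mul_of_nonneg_left ?_ (abs_nonneg _)
      exact abs_le.2 ⟨by simp only [hN]; nlinarith [sq_nonneg (a u)],
        by simp only [hN]; nlinarith [sq_nonneg (b u)]⟩
    have i2 : |k₀ * (2 * a u * b u)| ≤ |k₀| * N u := by
      rw [abs_mul]
      refine mul_le_mul_of_nonneg_left ?_ (abs_nonneg _)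
      exact abs_le.2 ⟨by simp only [hN]; nlinarith [sq_nonneg (a u + b u)],
        by simp only [hN]; nlinarith [sq_nonneg (a u - b u)]⟩
    have p1 : 0 < 2 / u := div_pos two_pos hu.1
    have p2 : 0 < 4 / (1 - u ^ 2) := div_pos four_pos h1
    refine (abs_sub _ _).trans ?_
    rw [abs_mul (2 / u), abs_mul (4 / (1 - u ^ 2)), abs_of_pos p1, abs_of_pos p2]
    calc _ ≤ 2 / u * (|k₁| * N u) + 4 / (1 - u ^ 2) * (|k₀| * N u) := by gcongr
      _ = R u * N u := by simp only [hR]; ring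
  have pos : ∀ u ∈ Ioo (0 : ℝ) 1, 0 < u ∧ 0 < 1 - u ∧ 0 < 1 + u := fun u hu =>
    ⟨hu.1, by linarith [hu.2], by linarith [hu.1]⟩
  have dgen : ∀ s t : ℝ, ∀ u ∈ Ioo (0 : ℝ) 1,
      HasDerivAt (fun u : ℝ => u ^ s * ((1 - u) ^ (-t) * (1 + u) ^ t))
        ((s / u + 2 * t / (1 - u ^ 2)) * (u ^ s * ((1 - u) ^ (-t) * (1 + u) ^ t))) u := by
    intro s t u hu
    obtain ⟨p0, p1, p2⟩ := pos u hu
    have d1 : HasDerivAt (fun u : ℝ => u ^ s) (s * u ^ (s - 1)) u :=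
      Real.hasDerivAt_rpow_const (Or.inl p0.ne')
    have d2 : HasDerivAt (fun u : ℝ => (1 - u) ^ (-t)) (-1 * (-t) * (1 - u) ^ (-t - 1)) u :=
      ((hasDerivAt_id u).const_sub 1).rpow_const (Or.inl p1.ne')
    have d3 : HasDerivAt (fun u : ℝ => (1 + u) ^ t) (1 * t * (1 + u) ^ (t - 1)) u :=
      ((hasDerivAt_id u).const_add 1).rpow_const (Or.inl p2.ne')
    refine (d1.mul (d2.mul d3)).congr_deriv ?_
    have e1 : u ^ s = u ^ (s - 1) * u := by rw [← Real.rpow_add_one p0.ne']; congr 1; ring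
    have e2 : (1 - u) ^ (-t) = (1 - u) ^ (-t - 1) * (1 - u) := by
      rw [← Real.rpow_add_one p1.ne']; congr 1; ring
    have e3 : (1 + u) ^ t = (1 + u) ^ (t - 1) * (1 + u) := by
      rw [← Real.rpow_add_one p2.ne']; congr 1; ring
    have e4 : 1 - u ^ 2 = (1 - u) * (1 + u) := by ring
    simp only [Pi.mul_apply]
    rw [e1, e2, e3, e4]
    have := p0.ne'
    have := p1.ne'
    have := p2.ne'
    field_simp
    ring
  have dP : ∀ u ∈ Ioo (0 : ℝ) 1, HasDerivAt P (R u * P u) u := fun u hu =>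
    (dgen (2 * |k₁|) (2 * |k₀|) u hu).congr_deriv (by simp only [hR, hP]; ring)
  have dQ : ∀ u ∈ Ioo (0 : ℝ) 1, HasDerivAt Q (-R u * Q u) u := fun u hu => by
    have := dgen (-(2 * |k₁|)) (-(2 * |k₀|)) u hu
    rw [neg_neg] at this
    exact this.congr_deriv (by simp only [hR, hQ]; ring)
  have P0 : ∀ u ∈ Ioo (0 : ℝ) 1, 0 < P u := fun u hu => by
    obtain ⟨p0, p1, p2⟩ := pos u hu
    positivity
  have Q0 : ∀ u ∈ Ioo (0 : ℝ) 1, 0 < Q u := fun u hu => by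
    obtain ⟨p0, p1, p2⟩ := pos u hu
    positivity
  have PQ : ∀ u ∈ Ioo (0 : ℝ) 1, P u * Q u = 1 := fun u hu => by
    obtain ⟨p0, p1, p2⟩ := pos u hu
    simp only [hP, hQ]
    rw [Real.rpow_neg p0.le, Real.rpow_neg p1.le, Real.rpow_neg p2.le]
    have := (Real.rpow_pos_of_pos p0 (2 * |k₁|)).ne'
    have := (Real.rpow_pos_of_pos p1 (2 * |k₀|)).ne'
    have := (Real.rpow_pos_of_pos p2 (2 * |k₀|)).ne'
    field_simp
  -- The bound `N' ≥ -R N` makes `N P` increase and `N' ≤ R N` makes `N Q` decrease. Comparison with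
  -- `u = 1/2` then controls `N` by `Q` to its left and by `P` to its right.
  have mono : MonotoneOn (fun u => N u * P u) (Ioo 0 1) := by
    refine monotoneOn_of_deriv_nonneg (convex_Ioo 0 1) (fun u hu => ?_) (fun u hu => ?_)
      fun u hu => ?_
    · obtain ⟨N', hN', -⟩ := dN u hu
      exact (hN'.mul (dP u hu)).continuousAt.continuousWithinAt
    · rw [interior_Ioo] at hu
      obtain ⟨N', hN', -⟩ := dN u hu
      exact (hN'.mul (dP u hu)).differentiableAt.differentiableWithinAt
    · rw [interior_Ioo] at hu
      obtain ⟨N', hN', hb⟩ := dN u hu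
      have := (hN'.mul (dP u hu)).deriv
      change 0 ≤ deriv (N * P) u
      rw [this]
      nlinarith [(abs_le.1 hb).1, P0 u hu]
  have anti : AntitoneOn (fun u => N u * Q u) (Ioo 0 1) := by
    refine antitoneOn_of_deriv_nonpos (convex_Ioo 0 1) (fun u hu => ?_) (fun u hu => ?_)
      fun u hu => ?_
    · obtain ⟨N', hN', -⟩ := dN u hu
      exact (hN'.mul (dQ u hu)).continuousAt.continuousWithinAt
    · rw [interior_Ioo] at hu
      obtain ⟨N', hN', -⟩ := dN u hu
      exact (hN'.mul (dQ u hu)).differentiableAt.differentiableWithinAt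
    · rw [interior_Ioo] at hu
      obtain ⟨N', hN', hb⟩ := dN u hu
      have := (hN'.mul (dQ u hu)).deriv
      change deriv (N * Q) u ≤ 0
      rw [this]
      nlinarith [(abs_le.1 hb).2, Q0 u hu]
  have hhalf : (1 / 2 : ℝ) ∈ Ioo (0 : ℝ) 1 := by norm_num
  set M₁ := N (1 / 2) * P (1 / 2)
  set M₂ := N (1 / 2) * Q (1 / 2)
  have hM₁ : 0 ≤ M₁ := mul_nonneg (hN0 _) (P0 _ hhalf).le
  have hM₂ : 0 ≤ M₂ := mul_nonneg (hN0 _) (Q0 _ hhalf).le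
  refine ⟨M₁ + M₂ * 2 ^ (2 * |k₀|), by positivity, fun u hu => ?_⟩
  obtain ⟨p0, p1, p2⟩ := pos u hu
  have k1 : 0 ≤ 2 * |k₁| := by positivity
  have k0 : 0 ≤ 2 * |k₀| := by positivity
  have a1 : 1 ≤ u ^ (-(2 * |k₁|)) :=
    Real.one_le_rpow_of_pos_of_le_one_of_nonpos p0 hu.2.le (by linarith)
  have a2 : 1 ≤ (1 - u) ^ (-(2 * |k₀|)) :=
    Real.one_le_rpow_of_pos_of_le_one_of_nonpos p1 (by linarith) (by linarith)
  have a3 : u ^ (2 * |k₁|) ≤ 1 := Real.rpow_le_one p0.le hu.2.le k1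
  have a4 : (1 - u) ^ (2 * |k₀|) ≤ 1 := Real.rpow_le_one p1.le (by linarith) k0
  have a5 : (1 + u) ^ (-(2 * |k₀|)) ≤ 1 :=
    Real.rpow_le_one_of_one_le_of_nonpos (by linarith) (by linarith)
  have a6 : (1 + u) ^ (2 * |k₀|) ≤ 2 ^ (2 * |k₀|) :=
    Real.rpow_le_rpow p2.le (by linarith [hu.2]) k0
  have b1 : 0 < u ^ (2 * |k₁|) := Real.rpow_pos_of_pos p0 _
  have b4 : 0 < (1 - u) ^ (2 * |k₀|) := Real.rpow_pos_of_pos p1 _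
  have b5 : 0 < (1 + u) ^ (-(2 * |k₀|)) := Real.rpow_pos_of_pos p2 _
  have b6 : 0 < (1 + u) ^ (2 * |k₀|) := Real.rpow_pos_of_pos p2 _
  have b7 : (0 : ℝ) < 2 ^ (2 * |k₀|) := Real.rpow_pos_of_pos two_pos _
  have hQle : Q u ≤ u ^ (-(2 * |k₁|)) * (1 - u) ^ (-(2 * |k₀|)) := by
    refine mul_le_mul_of_nonneg_left ?_ (by linarith)
    calc _ ≤ 1 * 1 := mul_le_mul a4 a5 b5.le zero_le_one
      _ ≤ _ := by rw [one_mul]; exact a2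
  have hPle : P u ≤ 2 ^ (2 * |k₀|) * (u ^ (-(2 * |k₁|)) * (1 - u) ^ (-(2 * |k₀|))) := by
    calc P u ≤ u ^ (-(2 * |k₁|)) * ((1 - u) ^ (-(2 * |k₀|)) * 2 ^ (2 * |k₀|)) :=
          mul_le_mul (a3.trans a1) (mul_le_mul_of_nonneg_left a6 (by linarith))
            (mul_nonneg (by linarith) b6.le) (by linarith)
      _ = _ := by ring
  have hX : 0 ≤ u ^ (-(2 * |k₁|)) * (1 - u) ^ (-(2 * |k₀|)) :=
    mul_nonneg (by linarith) (by linarith)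
  rcases le_total u (1 / 2) with hle | hle
  · have hm : N u * P u ≤ M₁ := mono hu hhalf hle
    have : N u ≤ M₁ * Q u := by
      calc N u = N u * P u * Q u := by rw [mul_assoc, PQ u hu, mul_one]
        _ ≤ _ := mul_le_mul_of_nonneg_right hm (Q0 u hu).le
    have h3 := mul_le_mul_of_nonneg_left hQle hM₁
    have h4 : 0 ≤ M₂ * 2 ^ (2 * |k₀|) * (u ^ (-(2 * |k₁|)) * (1 - u) ^ (-(2 * |k₀|))) := by
      positivity
    change N u ≤ _
    linarith
  · have hm : N u * Q u ≤ M₂ := anti hhalf hu hle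
    have : N u ≤ M₂ * P u := by
      calc N u = N u * Q u * P u := by rw [mul_assoc, mul_comm (Q u), PQ u hu, mul_one]
        _ ≤ _ := mul_le_mul_of_nonneg_right hm (P0 u hu).le
    have h3 := mul_le_mul_of_nonneg_left hPle hM₂
    have h4 : 0 ≤ M₁ * (u ^ (-(2 * |k₁|)) * (1 - u) ^ (-(2 * |k₀|))) := by positivity
    change N u ≤ _
    linarith

/-! ### Behaviour of the rows at the wall `u = 1` -/

/-- The limit of `(1 - u²)^{k₀} (L₁₁ - L₁₂)` at `u = 1`, where `c = k₁ + 1/2`. -/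
def edgeConst (k₀ c : ℝ) : ℝ :=
  Real.Gamma c * Real.Gamma (1 + 2 * k₀) / (Real.Gamma (1 + k₀) * Real.Gamma (c + k₀))

theorem tendsto_one_sub_rpow {p : ℝ} (hp : 0 < p) :
    Tendsto (fun u : ℝ => (1 - u) ^ p) (𝓝[<] 1) (𝓝 0) := by
  have h : ContinuousAt (fun u : ℝ => (1 - u) ^ p) 1 :=
    ContinuousAt.rpow_const (by fun_prop) (Or.inr hp.le)
  have := h.tendsto.mono_left (nhdsWithin_le_nhds (s := Iio 1))
  simpa [Real.zero_rpow hp.ne'] using this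

theorem tendsto_rpow_one (p : ℝ) : Tendsto (fun u : ℝ => u ^ p) (𝓝[<] 1) (𝓝 1) := by
  have h := (Real.continuousAt_rpow_const 1 p (Or.inl one_ne_zero)).tendsto
  rw [Real.one_rpow] at h
  exact h.mono_left nhdsWithin_le_nhds

/-- By the a priori bound the square is `O((1 - u)^(2 + 2k₀ - 2|k₀|))`. The exponent is positive: it
is `2` for `k₀ ≥ 0` and `2 + 4k₀` for `k₀ < 0`. -/
theorem tendsto_edge_error {k₀ k₁ : ℝ} (hc : 0 < k₁ + 1 / 2) (hk : -(1 / 2) < k₀) :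
    Tendsto (fun u => (1 - u) * ((1 - u ^ 2) ^ k₀ * rowSnd k₀ k₁ u)) (𝓝[<] 1) (𝓝 0) := by
  obtain ⟨M, hM0, hM⟩ := (isRowSolution_row k₀ hc).exists_bound
  have hsq : Tendsto (fun u => ((1 - u) * ((1 - u ^ 2) ^ k₀ * rowSnd k₀ k₁ u)) ^ 2) (𝓝[<] 1)
      (𝓝 0) := by
    have hp : 0 < 2 + 2 * k₀ - 2 * |k₀| := by
      rcases abs_cases k₀ with ⟨h, _⟩ | ⟨h, _⟩ <;> linarith
    have hcont : Tendsto (fun u : ℝ => (1 + u) ^ (2 * k₀)) (𝓝[<] 1) (𝓝 ((1 + 1) ^ (2 * k₀))) := by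
      have h : ContinuousAt (fun u : ℝ => (1 + u) ^ (2 * k₀)) 1 :=
        ContinuousAt.rpow_const (by fun_prop) (Or.inl (by norm_num))
      exact h.tendsto.mono_left nhdsWithin_le_nhds
    have hup := ((tendsto_one_sub_rpow hp).mul
      (hcont.mul (tendsto_rpow_one (-(2 * |k₁|))))).const_mul M
    rw [zero_mul, mul_zero] at hup
    refine squeeze_zero' (Eventually.of_forall fun u => sq_nonneg _) ?_ hup
    filter_upwards [Ioo_mem_nhdsLT (show (0 : ℝ) < 1 by norm_num)] with u hu
    have h1 : 0 < 1 - u := by linarith [hu.2]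
    have h2 : 0 < 1 + u := by linarith [hu.1]
    have h := hM u hu
    have e1 : (1 - u ^ 2) ^ k₀ = (1 - u) ^ k₀ * (1 + u) ^ k₀ := by
      rw [← Real.mul_rpow h1.le h2.le]
      congr 1
      ring
    have e2 : (1 - u) ^ (2 + 2 * k₀ - 2 * |k₀|) =
        ((1 - u) * (1 - u) ^ k₀) ^ 2 * (1 - u) ^ (-(2 * |k₀|)) := by
      rw [show 2 + 2 * k₀ - 2 * |k₀| = (1 + k₀) + (1 + k₀) + (-(2 * |k₀|)) by ring,
        Real.rpow_add h1, Real.rpow_add h1, Real.rpow_add h1, Real.rpow_one]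
      ring
    have e3 : (1 + u) ^ (2 * k₀) = ((1 + u) ^ k₀) ^ 2 := by
      rw [two_mul, Real.rpow_add h2, sq]
    rw [e1, e2, e3]
    have hX : 0 ≤ ((1 - u) * (1 - u) ^ k₀ * (1 + u) ^ k₀) ^ 2 := sq_nonneg _
    have h3 : rowSnd k₀ k₁ u ^ 2 ≤ M * (u ^ (-(2 * |k₁|)) * (1 - u) ^ (-(2 * |k₀|))) := by
      nlinarith [sq_nonneg (rowFst k₀ k₁ u)]
    calc _ = ((1 - u) * (1 - u) ^ k₀ * (1 + u) ^ k₀) ^ 2 * rowSnd k₀ k₁ u ^ 2 := by ring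
      _ ≤ _ := mul_le_mul_of_nonneg_left h3 hX
      _ = _ := by ring
  have h := hsq.sqrt
  simp only [Real.sqrt_sq_eq_abs, Real.sqrt_zero] at h
  exact (tendsto_zero_iff_abs_tendsto_zero _).2 h

/-- With `c = k₁ + 1/2`, the expression is `u^k₁ (F + u (k₀/c) G)`, `F` and `G` being the two
hypergeometric factors. With `1` in place of the inner `u`, the contiguous relation yields one
function that has a limit by Gauss; the difference carries a factor `1 - u` and is the error of
`tendsto_edge_error`. -/
theorem tendsto_edge {k₀ k₁ : ℝ} (hc : 0 < k₁ + 1 / 2) (hb : 0 < k₁ + 1 / 2 - k₀)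
    (hb' : 0 < k₁ + 1 / 2 + k₀) (hk : -(1 / 2) < k₀) :
    Tendsto (fun u => (1 - u ^ 2) ^ k₀ * (rowFst k₀ k₁ u - rowSnd k₀ k₁ u)) (𝓝[<] 1)
      (𝓝 (edgeConst k₀ (k₁ + 1 / 2))) := by
  have hsq : Tendsto (fun u : ℝ => u ^ 2) (𝓝[<] 1) (𝓝[<] 1) := by
    refine tendsto_nhdsWithin_iff.2 ⟨?_, ?_⟩
    · have : Tendsto (fun u : ℝ => u ^ 2) (𝓝 1) (𝓝 (1 ^ 2)) := (continuous_pow 2).tendsto 1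
      rw [one_pow] at this
      exact this.mono_left nhdsWithin_le_nhds
    · filter_upwards [Ioo_mem_nhdsLT (show (0 : ℝ) < 1 by norm_num)] with u hu
      have := hu.1
      have := hu.2
      exact mem_Iio.2 (by nlinarith)
  have h1 := (tendsto_hypergeometric_one hk hb).comp hsq
  have h2 := (tendsto_rpow_one k₁).mul (h1.const_mul ((k₁ + 1 / 2 + k₀) / (k₁ + 1 / 2)))
  have h3 := h2.add ((tendsto_edge_error hc hk).mul (tendsto_rpow_one (-1)))
  have g1 : Real.Gamma (k₁ + 1 / 2 + 1) = (k₁ + 1 / 2) * Real.Gamma (k₁ + 1 / 2) :=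
    Real.Gamma_add_one hc.ne'
  have g2 : Real.Gamma (k₁ + 1 / 2 + k₀ + 1) =
      (k₁ + 1 / 2 + k₀) * Real.Gamma (k₁ + 1 / 2 + k₀) :=
    Real.Gamma_add_one hb'.ne'
  have hlim : 1 * ((k₁ + 1 / 2 + k₀) / (k₁ + 1 / 2) *
      (Real.Gamma (k₁ + 1 / 2 - k₀ + (1 + k₀)) * Real.Gamma (1 + 2 * k₀) /
        (Real.Gamma (1 + k₀) * Real.Gamma (k₁ + 1 / 2 - k₀ + (1 + 2 * k₀))))) + 0 * 1 =
      edgeConst k₀ (k₁ + 1 / 2) := by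
    have n1 : Real.Gamma (1 + k₀) ≠ 0 := (Real.Gamma_pos_of_pos (by linarith)).ne'
    have n2 : Real.Gamma (k₁ + 1 / 2 + k₀) ≠ 0 := (Real.Gamma_pos_of_pos hb').ne'
    rw [show k₁ + 1 / 2 - k₀ + (1 + k₀) = k₁ + 1 / 2 + 1 by ring,
      show k₁ + 1 / 2 - k₀ + (1 + 2 * k₀) = k₁ + 1 / 2 + k₀ + 1 by ring, g1, g2, edgeConst]
    generalize Real.Gamma (k₁ + 1 / 2) = g
    generalize Real.Gamma (k₁ + 1 / 2 + k₀) = g' at *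
    generalize k₁ + 1 / 2 = c at *
    have := hc.ne'
    have := hb'.ne'
    field_simp
    ring
  rw [hlim] at h3
  refine h3.congr' ?_
  filter_upwards [Ioo_mem_nhdsLT (show (0 : ℝ) < 1 by norm_num)] with u hu
  have p1 : 0 < 1 - u ^ 2 := by nlinarith [hu.1, hu.2]
  have hz : |u ^ 2| < 1 := by rw [abs_of_nonneg (sq_nonneg u)]; linarith
  have hcg := hypergeometric_contiguous k₀ hc hz
  have ep : (1 - u ^ 2) ^ k₀ * (1 - u ^ 2) ^ (-k₀) = 1 := by
    rw [← Real.rpow_add p1]; simp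
  -- The factor `u⁻¹` on the error removes the extra `u` contained in `rowSnd`.
  simp only [Function.comp_apply]
  rw [show k₁ + 1 / 2 - k₀ + (1 + k₀) = k₁ + 1 / 2 + 1 by ring, ← hcg, Real.rpow_neg_one]
  simp only [rowFst, rowSnd]
  have := hu.1.ne'
  generalize ordinaryHypergeometric (-k₀) (k₁ + 1 / 2 - k₀) (k₁ + 1 / 2) (u ^ 2) = F
  generalize ordinaryHypergeometric (1 - k₀) (k₁ + 1 / 2 - k₀) (k₁ + 1 / 2 + 1) (u ^ 2) = G
  generalize (1 - u ^ 2) ^ k₀ = p at *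
  generalize (1 - u ^ 2) ^ (-k₀) = q at *
  generalize u ^ k₁ = w
  generalize k₀ / (k₁ + 1 / 2) = r
  have e : (1 - u) * (p * (w * (u * (-r * (q * G))))) * u⁻¹ =
      -((1 - u) * r * w * G) * (p * q) := by
    field_simp
  rw [e]
  linear_combination (-(w * (F + u * r * G)) - (1 - u) * r * w * G) * ep

/-- Factor `a² - b² = (a - b)(a + b)`. By `row_neg` the factor `a + b` is `a - b` for `-k₀`, so
`tendsto_edge` applies to both and the powers `(1 - u²)^(±k₀)` cancel. -/
theorem tendsto_row_sq_sub_sq {k₀ k₁ : ℝ} (hc : 0 < k₁ + 1 / 2) (hc' : 0 < -k₁ + 1 / 2)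
    (hb : 0 < k₁ + 1 / 2 - k₀) (hb' : 0 < k₁ + 1 / 2 + k₀) (hk : -(1 / 2) < k₀)
    (hk' : k₀ < 1 / 2) :
    Tendsto (fun u => rowFst k₀ k₁ u ^ 2 - rowSnd k₀ k₁ u ^ 2) (𝓝[<] 1)
      (𝓝 (edgeConst k₀ (k₁ + 1 / 2) * edgeConst (-k₀) (k₁ + 1 / 2))) := by
  have h := (tendsto_edge hc hb hb' hk).mul
    (tendsto_edge (k₀ := -k₀) hc (by linarith) (by linarith) (by linarith))
  refine h.congr' ?_
  filter_upwards [Ioo_mem_nhdsLT (show (0 : ℝ) < 1 by norm_num)] with u hu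
  have p1 : 0 < 1 - u ^ 2 := by nlinarith [hu.1, hu.2]
  have ep : (1 - u ^ 2) ^ k₀ * (1 - u ^ 2) ^ (-k₀) = 1 := by
    rw [← Real.rpow_add p1]; simp
  obtain ⟨r1, r2⟩ := row_neg k₀ hc hc' hu
  rw [r1, r2]
  linear_combination (rowFst k₀ k₁ u ^ 2 - rowSnd k₀ k₁ u ^ 2) * ep

/-! ### The entries of the weight on the chamber -/

/-- The trace of `Lᵀ diag(D₁, D₂) L`. -/
def wtTrace (k₀ k₁ D₁ D₂ u : ℝ) : ℝ :=
  D₁ * (rowFst k₀ k₁ u ^ 2 + rowSnd k₀ k₁ u ^ 2) +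
    D₂ * (rowFst k₀ (-k₁) u ^ 2 + rowSnd k₀ (-k₁) u ^ 2)

/-- The difference of the diagonal entries of `Lᵀ diag(D₁, D₂) L`. -/
def wtDiff (k₀ k₁ D₁ D₂ u : ℝ) : ℝ :=
  D₁ * (rowFst k₀ k₁ u ^ 2 - rowSnd k₀ k₁ u ^ 2) -
    D₂ * (rowFst k₀ (-k₁) u ^ 2 - rowSnd k₀ (-k₁) u ^ 2)

/-- Twice the off-diagonal entry of `Lᵀ diag(D₁, D₂) L`. -/
def wtOff (k₀ k₁ D₁ D₂ u : ℝ) : ℝ :=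
  D₁ * (2 * rowFst k₀ k₁ u * rowSnd k₀ k₁ u) +
    D₂ * (2 * rowFst k₀ (-k₁) u * rowSnd k₀ (-k₁) u)

section Weight

variable {k₀ k₁ D₁ D₂ : ℝ}

theorem hasDerivAt_wt (hc : 0 < k₁ + 1 / 2) (hc' : 0 < -k₁ + 1 / 2) {u : ℝ}
    (hu : u ∈ Ioo (0 : ℝ) 1) :
    HasDerivAt (wtTrace k₀ k₁ D₁ D₂) (2 * k₁ / u * wtDiff k₀ k₁ D₁ D₂ u -
        4 * k₀ / (1 - u ^ 2) * wtOff k₀ k₁ D₁ D₂ u) u ∧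
      HasDerivAt (wtDiff k₀ k₁ D₁ D₂) (2 * k₁ / u * wtTrace k₀ k₁ D₁ D₂ u) u ∧
      HasDerivAt (wtOff k₀ k₁ D₁ D₂) (-(4 * k₀ / (1 - u ^ 2)) * wtTrace k₀ k₁ D₁ D₂ u) u := by
  obtain ⟨a1, b1⟩ := isRowSolution_row k₀ hc u hu
  obtain ⟨a2, b2⟩ := isRowSolution_row k₀ hc' u hu
  refine ⟨((((a1.pow 2).add (b1.pow 2)).const_mul D₁).add
      (((a2.pow 2).add (b2.pow 2)).const_mul D₂)).congr_deriv ?_,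
    ((((a1.pow 2).sub (b1.pow 2)).const_mul D₁).sub
      (((a2.pow 2).sub (b2.pow 2)).const_mul D₂)).congr_deriv ?_,
    ((((a1.const_mul 2).mul b1).const_mul D₁).add
      (((a2.const_mul 2).mul b2).const_mul D₂)).congr_deriv ?_⟩ <;>
  · simp only [wtTrace, wtDiff, wtOff]
    push_cast
    ring

theorem abs_wtDiff_le (h1 : 0 ≤ D₁) (h2 : 0 ≤ D₂) (u : ℝ) :
    |wtDiff k₀ k₁ D₁ D₂ u| ≤ wtTrace k₀ k₁ D₁ D₂ u := by
  simp only [wtDiff, wtTrace]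
  have := mul_nonneg h1 (sq_nonneg (rowFst k₀ k₁ u))
  have := mul_nonneg h1 (sq_nonneg (rowSnd k₀ k₁ u))
  have := mul_nonneg h2 (sq_nonneg (rowFst k₀ (-k₁) u))
  have := mul_nonneg h2 (sq_nonneg (rowSnd k₀ (-k₁) u))
  exact abs_le.2 ⟨by linarith, by linarith⟩

theorem abs_wtOff_le (h1 : 0 ≤ D₁) (h2 : 0 ≤ D₂) (u : ℝ) :
    |wtOff k₀ k₁ D₁ D₂ u| ≤ wtTrace k₀ k₁ D₁ D₂ u := by
  simp only [wtOff, wtTrace]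
  have := mul_nonneg h1 (sq_nonneg (rowFst k₀ k₁ u + rowSnd k₀ k₁ u))
  have := mul_nonneg h1 (sq_nonneg (rowFst k₀ k₁ u - rowSnd k₀ k₁ u))
  have := mul_nonneg h2 (sq_nonneg (rowFst k₀ (-k₁) u + rowSnd k₀ (-k₁) u))
  have := mul_nonneg h2 (sq_nonneg (rowFst k₀ (-k₁) u - rowSnd k₀ (-k₁) u))
  exact abs_le.2 ⟨by linarith, by linarith⟩

theorem wtTrace_pos (hc : 0 < k₁ + 1 / 2) (hc' : 0 < -k₁ + 1 / 2) (h1 : 0 < D₁) (h2 : 0 < D₂)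
    {u : ℝ} (hu : u ∈ Ioo (0 : ℝ) 1) : 0 < wtTrace k₀ k₁ D₁ D₂ u := by
  have hd := row_det k₀ hc hc' hu
  have a1 : 0 ≤ rowFst k₀ k₁ u ^ 2 + rowSnd k₀ k₁ u ^ 2 := by positivity
  have a2 : 0 ≤ D₂ * (rowFst k₀ (-k₁) u ^ 2 + rowSnd k₀ (-k₁) u ^ 2) := by positivity
  have a3 : rowFst k₀ k₁ u ^ 2 + rowSnd k₀ k₁ u ^ 2 ≠ 0 := by
    intro h
    obtain ⟨e1, e2⟩ := (add_eq_zero_iff_of_nonneg (sq_nonneg _) (sq_nonneg _)).1 h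
    rw [pow_eq_zero_iff two_ne_zero] at e1 e2
    rw [e1, e2] at hd
    norm_num at hd
  have a4 : 0 < rowFst k₀ k₁ u ^ 2 + rowSnd k₀ k₁ u ^ 2 := lt_of_le_of_ne a1 (Ne.symm a3)
  have := mul_pos h1 a4
  rw [wtTrace]
  linarith

theorem exists_wtTrace_bound (hc : 0 < k₁ + 1 / 2) (hc' : 0 < -k₁ + 1 / 2) (h1 : 0 ≤ D₁)
    (h2 : 0 ≤ D₂) : ∃ M, 0 ≤ M ∧ ∀ u ∈ Ioo (0 : ℝ) 1,
      wtTrace k₀ k₁ D₁ D₂ u ≤ M * (u ^ (-(2 * |k₁|)) * (1 - u) ^ (-(2 * |k₀|))) := by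
  obtain ⟨M, hM0, hM⟩ := (isRowSolution_row k₀ hc).exists_bound
  obtain ⟨M', hM0', hM'⟩ := (isRowSolution_row k₀ hc').exists_bound
  refine ⟨D₁ * M + D₂ * M', by positivity, fun u hu => ?_⟩
  have a := mul_le_mul_of_nonneg_left (hM u hu) h1
  have b := mul_le_mul_of_nonneg_left (hM' u hu) h2
  rw [abs_neg] at b
  rw [wtTrace]
  linarith

theorem tendsto_wtOff (hc : 0 < k₁ + 1 / 2) (hc' : 0 < -k₁ + 1 / 2) :
    Tendsto (wtOff k₀ k₁ D₁ D₂) (𝓝[>] 0) (𝓝 0) := by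
  have key : ∀ k : ℝ, 0 < k + 1 / 2 →
      Tendsto (fun u => 2 * rowFst k₀ k u * rowSnd k₀ k u) (𝓝[>] 0) (𝓝 0) := by
    intro k hk
    obtain ⟨A, hA, tA⟩ := exists_rowFst_eq k₀ hk
    obtain ⟨B, x, hB, tB⟩ := exists_rowSnd_eq k₀ hk
    have h := (tendsto_rpow_zero (show 0 < k + 1 / 2 + (k + 1 / 2) by linarith)).mul
      ((tA.mul tB).const_mul 2)
    rw [zero_mul] at h
    refine h.congr' ?_
    filter_upwards [self_mem_nhdsWithin] with u hu
    have e : u ^ (k + 1 / 2 + (k + 1 / 2)) = u ^ k * u ^ k * u := by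
      rw [← Real.rpow_add hu, ← Real.rpow_add_one (ne_of_gt hu)]
      congr 1
      ring
    rw [hA, hB, e]
    ring
  have h := ((key k₁ hc).const_mul D₁).add ((key (-k₁) hc').const_mul D₂)
  rw [mul_zero, mul_zero, add_zero] at h
  exact h

/-- Each row contributes a finite limit at the wall, and `hD` says that the two contributions
cancel. This is where the ratio of the diagonal constants is forced. -/
theorem tendsto_wtDiff (hp : |k₀ + k₁| < 1 / 2) (hm : |k₀ - k₁| < 1 / 2)
    (hD : D₁ * (edgeConst k₀ (k₁ + 1 / 2) * edgeConst (-k₀) (k₁ + 1 / 2)) =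
      D₂ * (edgeConst k₀ (-k₁ + 1 / 2) * edgeConst (-k₀) (-k₁ + 1 / 2))) :
    Tendsto (wtDiff k₀ k₁ D₁ D₂) (𝓝[<] 1) (𝓝 0) := by
  obtain ⟨p1, p2⟩ := abs_lt.1 hp
  obtain ⟨m1, m2⟩ := abs_lt.1 hm
  have h1 := tendsto_row_sq_sub_sq (k₀ := k₀) (k₁ := k₁) (by linarith) (by linarith)
    (by linarith) (by linarith) (by linarith) (by linarith)
  have h2 := tendsto_row_sq_sub_sq (k₀ := k₀) (k₁ := -k₁) (by linarith) (by linarith)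
    (by linarith) (by linarith) (by linarith) (by linarith)
  have h := (h1.const_mul D₁).sub (h2.const_mul D₂)
  rwa [hD, sub_self] at h

end Weight

/-! ### Moments of the weight along the arc `0 < θ < π/4` -/

/-- The system satisfied by the trace `T`, the difference `G` of the diagonal entries and twice the
off-diagonal entry `B` of the weight along the arc, with the boundary behaviour at the walls. -/
structure IsArcWeight (k₀ k₁ : ℝ) (T G B : ℝ → ℝ) : Prop where
  deriv_T : ∀ θ ∈ Ioo (0 : ℝ) (Real.pi / 4), HasDerivAt T
    (4 * k₁ / Real.sin (2 * θ) * G θ - 4 * k₀ / Real.cos (2 * θ) * B θ) θ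
  deriv_G : ∀ θ ∈ Ioo (0 : ℝ) (Real.pi / 4), HasDerivAt G (4 * k₁ / Real.sin (2 * θ) * T θ) θ
  deriv_B : ∀ θ ∈ Ioo (0 : ℝ) (Real.pi / 4), HasDerivAt B (-(4 * k₀ / Real.cos (2 * θ)) * T θ) θ
  abs_G_le : ∀ θ, |G θ| ≤ T θ
  abs_B_le : ∀ θ, |B θ| ≤ T θ
  integrable : IntegrableOn T (Ioo 0 (Real.pi / 4))
  sin_mul_T : Tendsto (fun θ => Real.sin (2 * θ) * T θ) (𝓝[>] 0) (𝓝 0)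
  lim_B : Tendsto B (𝓝[>] 0) (𝓝 0)
  cos_mul_T : Tendsto (fun θ => Real.cos (2 * θ) * T θ) (𝓝[<] (Real.pi / 4)) (𝓝 0)
  lim_G : Tendsto G (𝓝[<] (Real.pi / 4)) (𝓝 0)

theorem sin_two_mul_pos {θ : ℝ} (hθ : θ ∈ Ioo (0 : ℝ) (Real.pi / 4)) : 0 < Real.sin (2 * θ) :=
  Real.sin_pos_of_pos_of_lt_pi (by linarith [hθ.1]) (by linarith [hθ.2, Real.pi_pos])

theorem cos_two_mul_pos {θ : ℝ} (hθ : θ ∈ Ioo (0 : ℝ) (Real.pi / 4)) : 0 < Real.cos (2 * θ) :=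
  Real.cos_pos_of_mem_Ioo ⟨by linarith [hθ.1, Real.pi_pos], by linarith [hθ.2]⟩

theorem hasDerivAt_sin_two_mul (θ : ℝ) :
    HasDerivAt (fun θ => Real.sin (2 * θ)) (2 * Real.cos (2 * θ)) θ := by
  simpa [mul_comm] using ((hasDerivAt_id θ).const_mul 2).sin

theorem hasDerivAt_cos_two_mul (θ : ℝ) :
    HasDerivAt (fun θ => Real.cos (2 * θ)) (-(2 * Real.sin (2 * θ))) θ := by
  simpa [mul_comm] using ((hasDerivAt_id θ).const_mul 2).cos

theorem quarter_pi_pos : (0 : ℝ) < Real.pi / 4 := by linarith [Real.pi_pos]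

namespace IsArcWeight

variable {k₀ k₁ : ℝ} {T G B : ℝ → ℝ}

theorem intervalIntegrable_mul (h : IsArcWeight k₀ k₁ T G B) {w f : ℝ → ℝ}
    (hw : Continuous w) (hw1 : ∀ θ, |w θ| ≤ 1) (hf : ∀ θ, |f θ| ≤ T θ)
    (hfc : ContinuousOn f (Ioo 0 (Real.pi / 4))) :
    IntervalIntegrable (fun θ => w θ * f θ) volume 0 (Real.pi / 4) := by
  rw [intervalIntegrable_iff_integrableOn_Ioo_of_le quarter_pi_pos.le]
  refine h.integrable.mono' ((hw.continuousOn.mul hfc).aestronglyMeasurable measurableSet_Ioo)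
    (Eventually.of_forall fun θ => ?_)
  rw [Real.norm_eq_abs, abs_mul]
  calc |w θ| * |f θ| ≤ 1 * |f θ| := mul_le_mul_of_nonneg_right (hw1 θ) (abs_nonneg _)
    _ ≤ T θ := by rw [one_mul]; exact hf θ

theorem abs_T_le (h : IsArcWeight k₀ k₁ T G B) (θ : ℝ) : |T θ| ≤ T θ :=
  (abs_of_nonneg ((abs_nonneg _).trans (h.abs_G_le θ))).le

theorem abs_cos_pow_le (n : ℕ) (θ : ℝ) : |Real.cos (2 * θ) ^ n| ≤ 1 := by
  rw [abs_pow]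
  exact pow_le_one₀ (abs_nonneg _) (Real.abs_cos_le_one _)

theorem intervalIntegrable_T (h : IsArcWeight k₀ k₁ T G B) (n : ℕ) :
    IntervalIntegrable (fun θ => Real.cos (2 * θ) ^ n * T θ) volume 0 (Real.pi / 4) :=
  h.intervalIntegrable_mul (by fun_prop) (abs_cos_pow_le n) h.abs_T_le
    fun θ hθ => (h.deriv_T θ hθ).continuousAt.continuousWithinAt

theorem intervalIntegrable_G (h : IsArcWeight k₀ k₁ T G B) (n : ℕ) :
    IntervalIntegrable (fun θ => Real.cos (2 * θ) ^ n * G θ) volume 0 (Real.pi / 4) :=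
  h.intervalIntegrable_mul (by fun_prop) (abs_cos_pow_le n) h.abs_G_le
    fun θ hθ => (h.deriv_G θ hθ).continuousAt.continuousWithinAt

theorem intervalIntegrable_B (h : IsArcWeight k₀ k₁ T G B) (n : ℕ) :
    IntervalIntegrable (fun θ => Real.cos (2 * θ) ^ n * Real.sin (2 * θ) * B θ) volume 0
      (Real.pi / 4) := by
  refine h.intervalIntegrable_mul (by fun_prop) (fun θ => ?_) h.abs_B_le
    fun θ hθ => (h.deriv_B θ hθ).continuousAt.continuousWithinAt
  rw [abs_mul]
  exact mul_le_one₀ (abs_cos_pow_le n θ) (abs_nonneg _) (Real.abs_sin_le_one _)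

theorem tendsto_of_abs_le {f g w : ℝ → ℝ} {l : Filter ℝ} (hg : Tendsto g l (𝓝 0))
    (h : ∀ᶠ θ in l, |f θ| ≤ g θ) (hw : ∀ θ, |w θ| ≤ 1) :
    Tendsto (fun θ => w θ * f θ) l (𝓝 0) := by
  refine squeeze_zero_norm' (h.mono fun θ hθ => ?_) hg
  rw [Real.norm_eq_abs, abs_mul]
  calc |w θ| * |f θ| ≤ 1 * |f θ| := mul_le_mul_of_nonneg_right (hw θ) (abs_nonneg _)
    _ ≤ g θ := by rwa [one_mul]

theorem eventually_zero : ∀ᶠ θ in 𝓝[>] (0 : ℝ), θ ∈ Ioo (0 : ℝ) (Real.pi / 4) :=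
  Ioo_mem_nhdsGT quarter_pi_pos

theorem eventually_quarter_pi :
    ∀ᶠ θ in 𝓝[<] (Real.pi / 4), θ ∈ Ioo (0 : ℝ) (Real.pi / 4) :=
  Ioo_mem_nhdsLT quarter_pi_pos

/-- Integrate the derivative of `cos^n(2θ) sin(2θ) G`. The boundary value vanishes at `0` because
`|G| ≤ T` and `sin(2θ) T → 0`, and at `π/4` because `G → 0`. For `n = 0` the truncated exponent `n -
1` is multiplied by zero. -/
theorem moment_G (h : IsArcWeight k₀ k₁ T G B) (n : ℕ) :
    (n + 1) * (∫ θ in (0 : ℝ)..Real.pi / 4, Real.cos (2 * θ) ^ (n + 1) * G θ) -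
      n * (∫ θ in (0 : ℝ)..Real.pi / 4, Real.cos (2 * θ) ^ (n - 1) * G θ) +
      2 * k₁ * (∫ θ in (0 : ℝ)..Real.pi / 4, Real.cos (2 * θ) ^ n * T θ) = 0 := by
  have i1 := (h.intervalIntegrable_G (n + 1)).const_mul (2 * (n + 1))
  have i2 := (h.intervalIntegrable_G (n - 1)).const_mul (2 * n)
  have i3 := (h.intervalIntegrable_T n).const_mul (4 * k₁)
  have key := intervalIntegral.integral_eq_sub_of_hasDerivAt_of_tendsto
    (f := fun θ => Real.cos (2 * θ) ^ n * (Real.sin (2 * θ) * G θ)) quarter_pi_pos (fa := 0)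
    (fb := 0) (fun θ hθ => ?_) ((i1.sub i2).add i3) ?_ ?_
  · rw [intervalIntegral.integral_add (i1.sub i2) i3, intervalIntegral.integral_sub i1 i2] at key
    simp only [intervalIntegral.integral_const_mul] at key
    linarith
  · refine (((hasDerivAt_cos_two_mul θ).pow n).mul
      ((hasDerivAt_sin_two_mul θ).mul (h.deriv_G θ hθ))).congr_deriv ?_
    have hs := (sin_two_mul_pos hθ).ne'
    have e : Real.sin (2 * θ) * (4 * k₁ / Real.sin (2 * θ) * T θ) = 4 * k₁ * T θ := by
      field_simp
    rw [e]
    simp only [Pi.pow_apply, Pi.mul_apply]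
    rcases n with _ | n
    · simp
      ring
    · have e2 := Real.sin_sq_add_cos_sq (2 * θ)
      simp only [Nat.add_sub_cancel]
      push_cast
      linear_combination (-2 * (n + 1) * Real.cos (2 * θ) ^ n * G θ) * e2
  · refine tendsto_of_abs_le h.sin_mul_T (eventually_zero.mono fun θ hθ => ?_) (abs_cos_pow_le n)
    rw [abs_mul, abs_of_pos (sin_two_mul_pos hθ)]
    exact mul_le_mul_of_nonneg_left (h.abs_G_le θ) (sin_two_mul_pos hθ).le
  · have hG := h.lim_G.abs
    rw [abs_zero] at hG
    refine tendsto_of_abs_le hG (Eventually.of_forall fun θ => ?_) (abs_cos_pow_le n)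
    rw [abs_mul]
    exact mul_le_of_le_one_left (abs_nonneg _) (Real.abs_sin_le_one _)

/-- Integrate the derivative of `-cos^(n+1)(2θ) B`. Here `B → 0` serves at `0`, and `cos(2θ) T → 0`
with `|B| ≤ T` at `π/4`. -/
theorem moment_B (h : IsArcWeight k₀ k₁ T G B) (n : ℕ) :
    (n + 1) * (∫ θ in (0 : ℝ)..Real.pi / 4, Real.cos (2 * θ) ^ n * Real.sin (2 * θ) * B θ) +
      2 * k₀ * (∫ θ in (0 : ℝ)..Real.pi / 4, Real.cos (2 * θ) ^ n * T θ) = 0 := by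
  have i1 := (h.intervalIntegrable_B n).const_mul (2 * (n + 1))
  have i2 := (h.intervalIntegrable_T n).const_mul (4 * k₀)
  have key := intervalIntegral.integral_eq_sub_of_hasDerivAt_of_tendsto
    (f := fun θ => -(Real.cos (2 * θ) ^ n * (Real.cos (2 * θ) * B θ))) quarter_pi_pos (fa := -0)
    (fb := -0) (fun θ hθ => ?_) (i1.add i2) (Tendsto.neg ?_) (Tendsto.neg ?_)
  · rw [intervalIntegral.integral_add i1 i2] at key
    simp only [intervalIntegral.integral_const_mul] at key
    linarith
  · refine (((hasDerivAt_cos_two_mul θ).pow n).mul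
      ((hasDerivAt_cos_two_mul θ).mul (h.deriv_B θ hθ))).neg.congr_deriv ?_
    have hs := (cos_two_mul_pos hθ).ne'
    have e : Real.cos (2 * θ) * (-(4 * k₀ / Real.cos (2 * θ)) * T θ) = -(4 * k₀ * T θ) := by
      field_simp
    rw [e]
    simp only [Pi.pow_apply, Pi.mul_apply]
    rcases n with _ | n
    · simp
      ring
    · simp only [Nat.add_sub_cancel]
      push_cast
      ring
  · have hB := h.lim_B.abs
    rw [abs_zero] at hB
    refine tendsto_of_abs_le hB (Eventually.of_forall fun θ => ?_) (abs_cos_pow_le n)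
    rw [abs_mul]
    exact mul_le_of_le_one_left (abs_nonneg _) (Real.abs_cos_le_one _)
  · refine tendsto_of_abs_le h.cos_mul_T (eventually_quarter_pi.mono fun θ hθ => ?_)
      (abs_cos_pow_le n)
    rw [abs_mul, abs_of_pos (cos_two_mul_pos hθ)]
    exact mul_le_mul_of_nonneg_left (h.abs_B_le θ) (cos_two_mul_pos hθ).le

/-- Integrate the derivative of `cos^(n+1)(2θ) sin(2θ) T`. The two trigonometric factors cancel the
poles of the coefficients of `G` and `B`. -/
theorem moment_T (h : IsArcWeight k₀ k₁ T G B) (n : ℕ) :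
    (n + 2) * (∫ θ in (0 : ℝ)..Real.pi / 4, Real.cos (2 * θ) ^ (n + 2) * T θ) -
      (n + 1) * (∫ θ in (0 : ℝ)..Real.pi / 4, Real.cos (2 * θ) ^ n * T θ) +
      2 * k₁ * (∫ θ in (0 : ℝ)..Real.pi / 4, Real.cos (2 * θ) ^ (n + 1) * G θ) -
      2 * k₀ * (∫ θ in (0 : ℝ)..Real.pi / 4, Real.cos (2 * θ) ^ n * Real.sin (2 * θ) * B θ) =
        0 := by
  have i1 := (h.intervalIntegrable_T (n + 2)).const_mul (2 * (n + 2))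
  have i2 := (h.intervalIntegrable_T n).const_mul (2 * (n + 1))
  have i3 := (h.intervalIntegrable_G (n + 1)).const_mul (4 * k₁)
  have i4 := (h.intervalIntegrable_B n).const_mul (4 * k₀)
  have key := intervalIntegral.integral_eq_sub_of_hasDerivAt_of_tendsto
    (f := fun θ => Real.cos (2 * θ) ^ n * (Real.cos (2 * θ) * (Real.sin (2 * θ) * T θ)))
    quarter_pi_pos (fa := 0)
    (fb := 0) (fun θ hθ => ?_) (((i1.sub i2).add i3).sub i4) ?_ ?_
  · rw [intervalIntegral.integral_sub ((i1.sub i2).add i3) i4,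
      intervalIntegral.integral_add (i1.sub i2) i3, intervalIntegral.integral_sub i1 i2] at key
    simp only [intervalIntegral.integral_const_mul] at key
    linarith
  · refine (((hasDerivAt_cos_two_mul θ).pow n).mul ((hasDerivAt_cos_two_mul θ).mul
      ((hasDerivAt_sin_two_mul θ).mul (h.deriv_T θ hθ)))).congr_deriv ?_
    have hs := (sin_two_mul_pos hθ).ne'
    have hc := (cos_two_mul_pos hθ).ne'
    have e : Real.cos (2 * θ) * (2 * Real.cos (2 * θ) * T θ + Real.sin (2 * θ) *
        (4 * k₁ / Real.sin (2 * θ) * G θ - 4 * k₀ / Real.cos (2 * θ) * B θ)) =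
        2 * Real.cos (2 * θ) ^ 2 * T θ + 4 * k₁ * (Real.cos (2 * θ) * G θ) -
          4 * k₀ * (Real.sin (2 * θ) * B θ) := by
      field_simp
      ring
    simp only [Pi.pow_apply, Pi.mul_apply]
    rw [e]
    have e2 := Real.sin_sq_add_cos_sq (2 * θ)
    rcases n with _ | n
    · simp
      linear_combination (-2 * T θ) * e2
    · simp only [Nat.add_sub_cancel]
      push_cast
      linear_combination (-2 * (n + 2) * Real.cos (2 * θ) ^ (n + 1) * T θ) * e2
  · refine tendsto_of_abs_le h.sin_mul_T (eventually_zero.mono fun θ hθ => ?_) (abs_cos_pow_le n)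
    rw [abs_mul, abs_mul, abs_of_pos (sin_two_mul_pos hθ),
      abs_of_nonneg ((abs_nonneg _).trans (h.abs_T_le θ))]
    exact mul_le_of_le_one_left (mul_nonneg (sin_two_mul_pos hθ).le
      ((abs_nonneg _).trans (h.abs_T_le θ))) (Real.abs_cos_le_one _)
  · refine tendsto_of_abs_le h.cos_mul_T (eventually_quarter_pi.mono fun θ hθ => ?_)
      (abs_cos_pow_le n)
    rw [mul_left_comm, abs_mul, abs_mul, abs_of_pos (cos_two_mul_pos hθ),
      abs_of_nonneg ((abs_nonneg _).trans (h.abs_T_le θ))]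
    exact mul_le_of_le_one_left (mul_nonneg (cos_two_mul_pos hθ).le
      ((abs_nonneg _).trans (h.abs_T_le θ))) (Real.abs_sin_le_one _)

/-- The form on `φ^{2n+1} p₁₄` and `p₁₂` as a moment of the normalized weight. -/
theorem formS_eq (h : IsArcWeight k₀ k₁ T G B)
    (hT : 4 * (∫ θ in (0 : ℝ)..Real.pi / 4, T θ) = 1) (n : ℕ) :
    formS k₀ k₁ (phi ^ (2 * n + 1) • p14) p12 =
      4 * ((∫ θ in (0 : ℝ)..Real.pi / 4, Real.cos (2 * θ) ^ (2 * n + 1) * G θ) -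
        (∫ θ in (0 : ℝ)..Real.pi / 4, Real.cos (2 * θ) ^ (2 * n + 2) * T θ)) := by
  have gG := h.moment_G
  have gB := h.moment_B
  have gT := h.moment_T
  have hx0 : 4 * (∫ θ in (0 : ℝ)..Real.pi / 4, Real.cos (2 * θ) ^ 0 * T θ) = 1 := by simpa using hT
  generalize hx : (fun m : ℕ => ∫ θ in (0 : ℝ)..Real.pi / 4, Real.cos (2 * θ) ^ m * T θ) = x
  generalize hy : (fun m : ℕ => ∫ θ in (0 : ℝ)..Real.pi / 4, Real.cos (2 * θ) ^ m * G θ) = y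
  generalize hz : (fun m : ℕ => ∫ θ in (0 : ℝ)..Real.pi / 4,
    Real.cos (2 * θ) ^ m * Real.sin (2 * θ) * B θ) = z
  simp only [fun m => congrFun hx m, fun m => congrFun hy m, fun m => congrFun hz m] at *
  -- With diagonal entries `(T ± G)/2` and off-diagonal entry `B/2`, these are eight times the
  -- integrals of `φ^(2b) p₁₂ K p₁₂ᵀ` and `φ^(2b+1) p₁₄ K p₁₂ᵀ`; in the second the off-diagonal
  -- terms cancel.
  refine formS_eq_of_recurrence (E := fun b => 4 * (x (2 * b) - y (2 * b + 1) - z (2 * b)))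
    (O := fun b => 4 * (y (2 * b + 1) - x (2 * b + 2))) ?_ ?_ (fun b => ?_) (fun b => ?_) n
  · have a := gG 0
    have b := gB 0
    simp at a b ⊢
    linear_combination (1 + 2 * k₀ + 2 * k₁) * hx0 - 4 * a - 4 * b
  · have a := gG 0
    have b := gB 0
    have c := gT 0
    simp at a b c ⊢
    linear_combination (4 + 8 * k₀) * a - (4 + 8 * k₁) * b - 4 * c
  · have a := gG (2 * b + 2)
    have a' := gB (2 * b)
    have b' := gB (2 * b + 2)
    have c := gT (2 * b)
    rw [show 2 * b + 2 - 1 = 2 * b + 1 by omega] at a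
    simp only [show 2 * (b + 1) = 2 * b + 2 by ring]
    push_cast at *
    linear_combination 4 * (a' + c - a - b')
  · have a := gG (2 * b + 2)
    have b' := gB (2 * b + 2)
    have c := gT (2 * b + 2)
    rw [show 2 * b + 2 - 1 = 2 * b + 1 by omega] at a
    simp only [show 2 * (b + 1) = 2 * b + 2 by ring]
    push_cast at *
    linear_combination 4 * ((2 * b + 3 + 2 * k₀) * a - (1 + 2 * k₁) * b' - (2 * b + 3) * c)

end IsArcWeight

/-! ### The weight along the arc -/

theorem tan_mem_Ioo {θ : ℝ} (hθ : θ ∈ Ioo (0 : ℝ) (Real.pi / 4)) : Real.tan θ ∈ Ioo (0 : ℝ) 1 := by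
  refine ⟨Real.tan_pos_of_pos_of_lt_pi_div_two hθ.1 (by linarith [hθ.2, Real.pi_pos]), ?_⟩
  rw [← Real.tan_pi_div_four]
  exact Real.tan_lt_tan_of_nonneg_of_lt_pi_div_two hθ.1.le (by linarith [Real.pi_pos]) hθ.2

theorem cos_pos_of_mem {θ : ℝ} (hθ : θ ∈ Ioo (0 : ℝ) (Real.pi / 4)) : 0 < Real.cos θ :=
  Real.cos_pos_of_mem_Ioo ⟨by linarith [hθ.1, Real.pi_pos], by linarith [hθ.2, Real.pi_pos]⟩

theorem sin_pos_of_mem {θ : ℝ} (hθ : θ ∈ Ioo (0 : ℝ) (Real.pi / 4)) : 0 < Real.sin θ :=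
  Real.sin_pos_of_pos_of_lt_pi hθ.1 (by linarith [hθ.2, Real.pi_pos])

theorem tendsto_tan_zero : Tendsto Real.tan (𝓝[>] 0) (𝓝[>] 0) := by
  refine tendsto_nhdsWithin_iff.2 ⟨?_, ?_⟩
  · have h := (Real.hasDerivAt_tan (x := 0) (by simp)).continuousAt.tendsto
    rw [Real.tan_zero] at h
    exact h.mono_left nhdsWithin_le_nhds
  · filter_upwards [IsArcWeight.eventually_zero] with θ hθ using (tan_mem_Ioo hθ).1

theorem tendsto_tan_quarter_pi : Tendsto Real.tan (𝓝[<] (Real.pi / 4)) (𝓝[<] 1) := by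
  refine tendsto_nhdsWithin_iff.2 ⟨?_, ?_⟩
  · have hc : Real.cos (Real.pi / 4) ≠ 0 := by
      rw [Real.cos_pi_div_four]
      positivity
    have h := (Real.hasDerivAt_tan hc).continuousAt.tendsto
    rw [Real.tan_pi_div_four] at h
    exact h.mono_left nhdsWithin_le_nhds
  · filter_upwards [IsArcWeight.eventually_quarter_pi] with θ hθ using (tan_mem_Ioo hθ).2

/-- From `x ≤ tan x` at `x = π/4 - θ`, where the tangent equals `(1 - tan θ)/(1 + tan θ)`. It turns
the bound in `1 - u` into an integrable one in `θ`. -/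
theorem quarter_pi_sub_le_one_sub_tan {θ : ℝ} (hθ : θ ∈ Ioo (0 : ℝ) (Real.pi / 4)) :
    Real.pi / 4 - θ ≤ 1 - Real.tan θ := by
  have h := (Real.lt_tan (x := Real.pi / 4 - θ) (by linarith [hθ.2])
    (by linarith [hθ.1, Real.pi_pos])).le
  have hc := cos_pos_of_mem hθ
  have hs := sin_pos_of_mem hθ
  have hu := tan_mem_Ioo hθ
  have e : Real.tan (Real.pi / 4 - θ) = (1 - Real.tan θ) / (1 + Real.tan θ) := by
    rw [Real.tan_eq_sin_div_cos, Real.tan_eq_sin_div_cos, Real.sin_sub, Real.cos_sub,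
      Real.sin_pi_div_four, Real.cos_pi_div_four]
    have : Real.cos θ + Real.sin θ ≠ 0 := by positivity
    field_simp
  rw [e] at h
  exact h.trans (div_le_self (by linarith [hu.2]) (by linarith [hu.1]))

theorem sin_two_mul_eq_tan {θ : ℝ} (hc : Real.cos θ ≠ 0) :
    Real.sin (2 * θ) = 2 * Real.tan θ * Real.cos θ ^ 2 := by
  rw [Real.sin_two_mul, Real.tan_eq_sin_div_cos]
  field_simp

theorem cos_two_mul_eq_tan {θ : ℝ} (hc : Real.cos θ ≠ 0) :
    Real.cos (2 * θ) = (1 - Real.tan θ ^ 2) * Real.cos θ ^ 2 := by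
  rw [Real.cos_two_mul', Real.tan_eq_sin_div_cos]
  field_simp

theorem integrableOn_arc {p q : ℝ} (hp : p < 1) (hq : q < 1) :
    IntegrableOn (fun θ : ℝ => θ ^ (-p) * (Real.pi / 4 - θ) ^ (-q)) (Ioo 0 (Real.pi / 4)) := by
  have h := integrableOn_beta (u := 1 - p) (v := 1 - q) (by linarith) (by linarith)
  have h1 : IntervalIntegrable (fun t : ℝ => t ^ (1 - p - 1) * (1 - t) ^ (1 - q - 1)) volume 0 1 :=
    (intervalIntegrable_iff_integrableOn_Ioo_of_le zero_le_one).2 h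
  have h2 := (h1.comp_mul_left (c := 4 / Real.pi)).const_mul
    ((Real.pi / 4) ^ (-p) * (Real.pi / 4) ^ (-q))
  rw [zero_div, one_div_div, intervalIntegrable_iff_integrableOn_Ioo_of_le quarter_pi_pos.le] at h2
  refine h2.congr_fun (fun θ hθ => ?_) measurableSet_Ioo
  have e1 : θ = Real.pi / 4 * (4 / Real.pi * θ) := by
    field_simp
  have e2 : Real.pi / 4 - θ = Real.pi / 4 * (1 - 4 / Real.pi * θ) := by
    field_simp
  have h0 : 0 ≤ 4 / Real.pi * θ := mul_nonneg (by positivity) hθ.1.le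
  have h3 : 0 ≤ 1 - 4 / Real.pi * θ := by
    have : 0 < Real.pi / 4 * (1 - 4 / Real.pi * θ) := by
      rw [← e2]
      linarith [hθ.2]
    exact (pos_of_mul_pos_right this quarter_pi_pos.le).le
  simp only [show 1 - p - 1 = -p by ring, show 1 - q - 1 = -q by ring]
  rw [e2]
  nth_rw 3 [e1]
  rw [Real.mul_rpow quarter_pi_pos.le h0, Real.mul_rpow quarter_pi_pos.le h3]
  ring

theorem wtTrace_nonneg {k₀ k₁ D₁ D₂ : ℝ} (h1 : 0 ≤ D₁) (h2 : 0 ≤ D₂) (u : ℝ) :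
    0 ≤ wtTrace k₀ k₁ D₁ D₂ u :=
  (abs_nonneg _).trans (abs_wtDiff_le h1 h2 u)

/-- The substitution `u = tan θ` turns `2k₁/u` into `4k₁/sin 2θ` and `4k₀/(1 - u²)` into `4k₀/cos
2θ`. The hypotheses give `2|k₀| < 1` and `2|k₁| < 1`, so the a priori bound on the trace is
integrable and loses to one factor `sin 2θ` or `cos 2θ` at the respective wall. -/
theorem isArcWeight {k₀ k₁ D₁ D₂ : ℝ} (hp : |k₀ + k₁| < 1 / 2) (hm : |k₀ - k₁| < 1 / 2)
    (h1 : 0 ≤ D₁) (h2 : 0 ≤ D₂)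
    (hD : D₁ * (edgeConst k₀ (k₁ + 1 / 2) * edgeConst (-k₀) (k₁ + 1 / 2)) =
      D₂ * (edgeConst k₀ (-k₁ + 1 / 2) * edgeConst (-k₀) (-k₁ + 1 / 2))) :
    IsArcWeight k₀ k₁ (fun θ => wtTrace k₀ k₁ D₁ D₂ (Real.tan θ))
      (fun θ => wtDiff k₀ k₁ D₁ D₂ (Real.tan θ)) (fun θ => wtOff k₀ k₁ D₁ D₂ (Real.tan θ)) := by
  obtain ⟨p1, p2⟩ := abs_lt.1 hp
  obtain ⟨m1, m2⟩ := abs_lt.1 hm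
  have hc : 0 < k₁ + 1 / 2 := by linarith
  have hc' : 0 < -k₁ + 1 / 2 := by linarith
  have hk0 : 2 * |k₀| < 1 := by
    rcases abs_cases k₀ with ⟨h, _⟩ | ⟨h, _⟩ <;> linarith
  have hk1 : 2 * |k₁| < 1 := by
    rcases abs_cases k₁ with ⟨h, _⟩ | ⟨h, _⟩ <;> linarith
  have hnn := wtTrace_nonneg (k₀ := k₀) (k₁ := k₁) h1 h2
  obtain ⟨M, hM0, hM⟩ := exists_wtTrace_bound (k₀ := k₀) hc hc' h1 h2
  have hder : ∀ θ ∈ Ioo (0 : ℝ) (Real.pi / 4), HasDerivAt Real.tan (1 / Real.cos θ ^ 2) θ :=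
    fun θ hθ => Real.hasDerivAt_tan (cos_pos_of_mem hθ).ne'
  have c1 : ∀ θ ∈ Ioo (0 : ℝ) (Real.pi / 4), ∀ x : ℝ,
      2 * k₁ / Real.tan θ * x * (1 / Real.cos θ ^ 2) = 4 * k₁ / Real.sin (2 * θ) * x := by
    intro θ hθ x
    have hcos := (cos_pos_of_mem hθ).ne'
    have ht := (tan_mem_Ioo hθ).1.ne'
    rw [sin_two_mul_eq_tan hcos]
    field_simp
    ring
  have c0 : ∀ θ ∈ Ioo (0 : ℝ) (Real.pi / 4), ∀ x : ℝ,
      4 * k₀ / (1 - Real.tan θ ^ 2) * x * (1 / Real.cos θ ^ 2) =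
        4 * k₀ / Real.cos (2 * θ) * x := by
    intro θ hθ x
    have hcos := (cos_pos_of_mem hθ).ne'
    have ht := tan_mem_Ioo hθ
    have : 1 - Real.tan θ ^ 2 ≠ 0 := by nlinarith [ht.1, ht.2]
    rw [cos_two_mul_eq_tan hcos]
    field_simp
  refine ⟨fun θ hθ => ?_, fun θ hθ => ?_, fun θ hθ => ?_, fun θ => abs_wtDiff_le h1 h2 _,
    fun θ => abs_wtOff_le h1 h2 _, ?_, ?_, (tendsto_wtOff hc hc').comp tendsto_tan_zero, ?_,
    (tendsto_wtDiff hp hm hD).comp tendsto_tan_quarter_pi⟩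
  · refine ((hasDerivAt_wt hc hc' (tan_mem_Ioo hθ)).1.comp θ (hder θ hθ)).congr_deriv ?_
    rw [sub_mul, c1 θ hθ, c0 θ hθ]
  · refine ((hasDerivAt_wt hc hc' (tan_mem_Ioo hθ)).2.1.comp θ (hder θ hθ)).congr_deriv ?_
    rw [c1 θ hθ]
  · refine ((hasDerivAt_wt hc hc' (tan_mem_Ioo hθ)).2.2.comp θ (hder θ hθ)).congr_deriv ?_
    rw [neg_mul, neg_mul, c0 θ hθ, neg_mul]
  · refine ((integrableOn_arc hk1 hk0).const_mul M).mono' ?_ ?_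
    · refine ContinuousOn.aestronglyMeasurable (fun θ hθ => ?_) measurableSet_Ioo
      exact ((hasDerivAt_wt hc hc' (tan_mem_Ioo hθ)).1.comp θ
        (hder θ hθ)).continuousAt.continuousWithinAt
    · refine (ae_restrict_mem measurableSet_Ioo).mono fun θ hθ => ?_
      rw [Real.norm_eq_abs, abs_of_nonneg (hnn _)]
      refine (hM _ (tan_mem_Ioo hθ)).trans (mul_le_mul_of_nonneg_left ?_ hM0)
      have hlt := (Real.lt_tan hθ.1 (by linarith [hθ.2, Real.pi_pos])).le
      have hsub : 0 < Real.pi / 4 - θ := by linarith [hθ.2]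
      exact mul_le_mul (Real.rpow_le_rpow_of_nonpos hθ.1 hlt (by linarith [abs_nonneg k₁]))
        (Real.rpow_le_rpow_of_nonpos hsub (quarter_pi_sub_le_one_sub_tan hθ)
          (by linarith [abs_nonneg k₀]))
        (Real.rpow_nonneg (by linarith [(tan_mem_Ioo hθ).2]) _) (Real.rpow_nonneg hθ.1.le _)
  · have hlim : Tendsto (fun u : ℝ => M * (2 * (u ^ (1 - 2 * |k₁|) * (1 - u) ^ (-(2 * |k₀|)))))
        (𝓝[>] 0) (𝓝 0) := by
      have h : ContinuousAt (fun u : ℝ => (1 - u) ^ (-(2 * |k₀|))) 0 :=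
        ContinuousAt.rpow_const (by fun_prop) (Or.inl (by norm_num))
      have h' := (((tendsto_rpow_zero (show 0 < 1 - 2 * |k₁| by linarith)).mul
        (h.tendsto.mono_left nhdsWithin_le_nhds)).const_mul 2).const_mul M
      rwa [zero_mul, mul_zero, mul_zero] at h'
    refine squeeze_zero' ?_ ?_ (hlim.comp tendsto_tan_zero)
    · filter_upwards [IsArcWeight.eventually_zero] with θ hθ
      exact mul_nonneg (sin_two_mul_pos hθ).le (hnn _)
    · filter_upwards [IsArcWeight.eventually_zero] with θ hθ
      have ht := tan_mem_Ioo hθ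
      have hcos := cos_pos_of_mem hθ
      have hb := hM _ ht
      have h3 : Real.sin (2 * θ) ≤ 2 * Real.tan θ := by
        rw [sin_two_mul_eq_tan hcos.ne']
        exact mul_le_of_le_one_right (by linarith [ht.1]) (Real.cos_sq_le_one θ)
      rw [Function.comp_apply, sub_eq_add_neg, Real.rpow_add ht.1, Real.rpow_one]
      calc _ ≤ 2 * Real.tan θ * wtTrace k₀ k₁ D₁ D₂ (Real.tan θ) :=
            mul_le_mul_of_nonneg_right h3 (hnn _)
        _ ≤ _ := mul_le_mul_of_nonneg_left hb (by linarith [ht.1])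
        _ = _ := by ring
  · have hlim : Tendsto (fun u : ℝ => M * (2 * ((1 - u) ^ (1 - 2 * |k₀|) * u ^ (-(2 * |k₁|)))))
        (𝓝[<] 1) (𝓝 0) := by
      have h' := (((tendsto_one_sub_rpow (show 0 < 1 - 2 * |k₀| by linarith)).mul
        (tendsto_rpow_one (-(2 * |k₁|)))).const_mul 2).const_mul M
      rwa [zero_mul, mul_zero, mul_zero] at h'
    refine squeeze_zero' ?_ ?_ (hlim.comp tendsto_tan_quarter_pi)
    · filter_upwards [IsArcWeight.eventually_quarter_pi] with θ hθ
      exact mul_nonneg (cos_two_mul_pos hθ).le (hnn _)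
    · filter_upwards [IsArcWeight.eventually_quarter_pi] with θ hθ
      have ht := tan_mem_Ioo hθ
      have hcos := cos_pos_of_mem hθ
      have hb := hM _ ht
      have hpos : 0 < 1 - Real.tan θ := by linarith [ht.2]
      have h3 : Real.cos (2 * θ) ≤ 2 * (1 - Real.tan θ) := by
        rw [cos_two_mul_eq_tan hcos.ne']
        exact (mul_le_of_le_one_right (by nlinarith [ht.1, ht.2]) (Real.cos_sq_le_one θ)).trans
          (by nlinarith [ht.1, ht.2])
      rw [Function.comp_apply, sub_eq_add_neg 1 (2 * |k₀|), Real.rpow_add hpos, Real.rpow_one]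
      calc _ ≤ 2 * (1 - Real.tan θ) * wtTrace k₀ k₁ D₁ D₂ (Real.tan θ) :=
            mul_le_mul_of_nonneg_right h3 (hnn _)
        _ ≤ _ := mul_le_mul_of_nonneg_left hb (by linarith)
        _ = _ := by ring

/-! ### The weight matrix on the chamber and on the circle -/

theorem chamberWeight_entries (k₀ k₁ c : ℝ) {x : Fin 2 → ℝ} (hx : 0 < x 1 / x 0) :
    chamberWeight k₀ k₁ c x 0 0 =
        (wtTrace k₀ k₁ (d1 k₀ k₁ c) (d2 k₀ k₁ c) (x 1 / x 0) +
          wtDiff k₀ k₁ (d1 k₀ k₁ c) (d2 k₀ k₁ c) (x 1 / x 0)) / 2 ∧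
      chamberWeight k₀ k₁ c x 1 1 =
        (wtTrace k₀ k₁ (d1 k₀ k₁ c) (d2 k₀ k₁ c) (x 1 / x 0) -
          wtDiff k₀ k₁ (d1 k₀ k₁ c) (d2 k₀ k₁ c) (x 1 / x 0)) / 2 ∧
      chamberWeight k₀ k₁ c x 0 1 = chamberWeight k₀ k₁ c x 1 0 := by
  simp only [chamberWeight, matL_eq k₀ k₁ hx, wtTrace, wtDiff]
  refine ⟨?_, ?_, ?_⟩ <;>
  · simp [Matrix.mul_apply, Fin.sum_univ_two, Matrix.diagonal]
    ring

/-- The weight depends only on the ratio of the coordinates, and signed permutations at most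
exchange the diagonal entries. The squared sign is `1` except on the line `x₁ = 0`. -/
theorem weight_zero_zero (k₀ k₁ c : ℝ) (x : Fin 2 → ℝ) :
    weight k₀ k₁ c x 0 0 = Real.sign (x 0) ^ 2 *
      if |x 1| < |x 0| then chamberWeight k₀ k₁ c ![1, |x 1| / |x 0|] 0 0
      else chamberWeight k₀ k₁ c ![1, |x 0| / |x 1|] 1 1 := by
  have hs : ∀ y : ℝ, y * y.sign = |y| := by
    intro y
    rcases lt_trichotomy y 0 with h | rfl | h
    · rw [Real.sign_of_neg h, abs_of_neg h, mul_neg_one]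
    · simp
    · rw [Real.sign_of_pos h, abs_of_pos h, mul_one]
  have hsame : ∀ y : Fin 2 → ℝ, chamberWeight k₀ k₁ c y =
      chamberWeight k₀ k₁ c ![1, y 1 / y 0] := by
    intro y
    simp [chamberWeight]
  simp only [weight, chamberElt]
  split_ifs with h
  · rw [hsame (x ᵥ* _)]
    simp [Matrix.mul_apply, Fin.sum_univ_two, Matrix.vecMul, dotProduct, hs]
    ring
  · rw [hsame (x ᵥ* _)]
    simp [Matrix.mul_apply, Fin.sum_univ_two, Matrix.vecMul, dotProduct, hs]
    ring

theorem abs_sin_lt_abs_cos {θ : ℝ} (hθ : θ ∈ Ioo (0 : ℝ) (Real.pi / 4)) :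
    |Real.sin θ| < |Real.cos θ| := by
  have h := (tan_mem_Ioo hθ).2
  rw [Real.tan_eq_sin_div_cos, div_lt_one (cos_pos_of_mem hθ)] at h
  rwa [abs_of_pos (sin_pos_of_mem hθ), abs_of_pos (cos_pos_of_mem hθ)]

theorem weight_circlePt (k₀ k₁ c : ℝ) {θ : ℝ} (hθ : θ ∈ Ioo (0 : ℝ) (Real.pi / 4)) :
    weight k₀ k₁ c (circlePt θ) = chamberWeight k₀ k₁ c (circlePt θ) := by
  have h : chamberElt (circlePt θ) = 1 := by
    have h' := abs_sin_lt_abs_cos hθ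
    simp [chamberElt, circlePt, h', Real.sign_of_pos (sin_pos_of_mem hθ),
      Real.sign_of_pos (cos_pos_of_mem hθ), Matrix.one_fin_two]
  simp [weight, h]

theorem integrand_eq (k₀ k₁ : ℝ) (n : ℕ) {θ : ℝ} (hθ : θ ∈ Ioo (0 : ℝ) (Real.pi / 4)) :
    MvPolynomial.eval (circlePt θ) phi ^ (2 * n + 1) *
        (vEval (circlePt θ) p14 ⬝ᵥ (matK k₀ k₁ (circlePt θ) *ᵥ vEval (circlePt θ) p12)) =
      1 / 2 * (Real.cos (2 * θ) ^ (2 * n + 1) *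
          wtDiff k₀ k₁ (d1 k₀ k₁ (normConst k₀ k₁)) (d2 k₀ k₁ (normConst k₀ k₁)) (Real.tan θ) -
        Real.cos (2 * θ) ^ (2 * n + 2) *
          wtTrace k₀ k₁ (d1 k₀ k₁ (normConst k₀ k₁)) (d2 k₀ k₁ (normConst k₀ k₁))
            (Real.tan θ)) := by
  have hu : circlePt θ 1 / circlePt θ 0 = Real.tan θ := by
    simp [circlePt, Real.tan_eq_sin_div_cos]
  obtain ⟨e0, e1, e2⟩ := chamberWeight_entries k₀ k₁ (normConst k₀ k₁) (x := circlePt θ)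
    (by rw [hu]; exact (tan_mem_Ioo hθ).1)
  rw [hu] at e0 e1
  have hphi : MvPolynomial.eval (circlePt θ) phi = Real.cos (2 * θ) := by
    simp [phi, circlePt, Real.cos_two_mul']
  rw [hphi, matK, weight_circlePt k₀ k₁ _ hθ]
  simp only [dotProduct, Matrix.mulVec, Fin.sum_univ_two, e0, e1, e2]
  simp [vEval, p14, p12, circlePt]
  have h1 := Real.cos_two_mul' θ
  have h2 := Real.sin_sq_add_cos_sq θ
  generalize chamberWeight k₀ k₁ (normConst k₀ k₁) ![Real.cos θ, Real.sin θ] 1 0 = b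
  rw [pow_succ _ (2 * n + 1)]
  generalize Real.cos (2 * θ) ^ (2 * n + 1) = P
  generalize wtDiff k₀ k₁ (d1 k₀ k₁ (normConst k₀ k₁)) (d2 k₀ k₁ (normConst k₀ k₁))
    (Real.tan θ) = G
  generalize wtTrace k₀ k₁ (d1 k₀ k₁ (normConst k₀ k₁)) (d2 k₀ k₁ (normConst k₀ k₁))
    (Real.tan θ) = T
  linear_combination (P * T / 2) * h1 + (P * G / 2) * h2

/-! ### The constants `d₁`, `d₂` -/

theorem d1_eq (k₀ k₁ c : ℝ) : d1 k₀ k₁ c = d2 k₀ (-k₁) c := by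
  simp only [d1, d2]
  ring_nf

theorem d2_pos {k₀ k₁ c : ℝ} (hp : |k₀ + k₁| < 1 / 2) (hm : |k₀ - k₁| < 1 / 2) (hc : 0 < c) :
    0 < d2 k₀ k₁ c := by
  obtain ⟨p1, p2⟩ := abs_lt.1 hp
  obtain ⟨m1, m2⟩ := abs_lt.1 hm
  have h1 : 0 < Real.Gamma (1 / 2 + k₁) := Real.Gamma_pos_of_pos (by linarith)
  have h2 : 0 < Real.Gamma (1 / 2 + k₀ + k₁) := Real.Gamma_pos_of_pos (by linarith)
  have h3 : 0 < Real.Gamma (1 / 2 - k₀ + k₁) := Real.Gamma_pos_of_pos (by linarith)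
  have h4 : 0 < Real.cos (Real.pi * k₀) := by
    have := Real.pi_pos
    exact Real.cos_pos_of_mem_Ioo ⟨by nlinarith, by nlinarith⟩
  unfold d2
  positivity

theorem d1_pos {k₀ k₁ c : ℝ} (hp : |k₀ + k₁| < 1 / 2) (hm : |k₀ - k₁| < 1 / 2) (hc : 0 < c) :
    0 < d1 k₀ k₁ c := by
  rw [d1_eq]
  exact d2_pos (by rwa [← sub_eq_add_neg]) (by rwa [sub_neg_eq_add]) hc

/-- For `c' = 1/2 + k₁` the product of edge constants is `Γ(c')² / (Γ(c' + k₀) Γ(c' - k₀))` times a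
factor in `k₀` alone, which is the shape of `d₂`. Both sides are therefore the same expression,
symmetric under `k₁ → -k₁`. -/
theorem d_balance (k₀ k₁ c : ℝ) :
    d1 k₀ k₁ c * (edgeConst k₀ (k₁ + 1 / 2) * edgeConst (-k₀) (k₁ + 1 / 2)) =
      d2 k₀ k₁ c * (edgeConst k₀ (-k₁ + 1 / 2) * edgeConst (-k₀) (-k₁ + 1 / 2)) := by
  simp only [d1, d2, edgeConst]
  rw [show 1 / 2 - k₁ = -k₁ + 1 / 2 by ring, show 1 / 2 + k₁ = k₁ + 1 / 2 by ring,
    show 1 / 2 + k₀ - k₁ = -k₁ + 1 / 2 + k₀ by ring,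
    show 1 / 2 - k₀ - k₁ = -k₁ + 1 / 2 + -k₀ by ring,
    show 1 / 2 + k₀ + k₁ = k₁ + 1 / 2 + k₀ by ring,
    show 1 / 2 - k₀ + k₁ = k₁ + 1 / 2 + -k₀ by ring]
  simp only [div_eq_mul_inv, mul_inv]
  ring

theorem wtTrace_d_mul (k₀ k₁ c u : ℝ) : wtTrace k₀ k₁ (d1 k₀ k₁ c) (d2 k₀ k₁ c) u =
    c * wtTrace k₀ k₁ (d1 k₀ k₁ 1) (d2 k₀ k₁ 1) u := by
  simp only [wtTrace, d1, d2]
  ring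

/-! ### The normalizing constant -/

theorem integral_mul_exp_neg_sq_div_two :
    ∫ r in Ioi (0 : ℝ), r * Real.exp (-r ^ 2 / 2) = 1 := by
  have hd : ∀ r ∈ Ici (0 : ℝ),
      HasDerivAt (fun r : ℝ => -Real.exp (-r ^ 2 / 2)) (r * Real.exp (-r ^ 2 / 2)) r := by
    intro r _
    refine ((((hasDerivAt_id r).pow 2).neg.div_const 2).exp.neg).congr_deriv ?_
    simp
    ring
  have hl : Tendsto (fun r : ℝ => -Real.exp (-r ^ 2 / 2)) atTop (𝓝 (-0)) := by
    refine (Real.tendsto_exp_atBot.comp ?_).neg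
    have h : Tendsto (fun r : ℝ => r ^ 2 / 2) atTop atTop :=
      (tendsto_pow_atTop two_ne_zero).atTop_div_const two_pos
    simpa only [Function.comp_def, neg_div] using tendsto_neg_atTop_atBot.comp h
  rw [integral_Ioi_of_hasDerivAt_of_nonneg' hd
    (fun r hr => mul_nonneg (le_of_lt hr) (Real.exp_pos _).le) hl]
  simp

/-- For a function constant along rays, polar coordinates split off the radial integral of `r
e^(-r²/2)`, which is `1`. -/
theorem integral_polar_gaussian (f : (Fin 2 → ℝ) → ℝ)
    (hf : ∀ r : ℝ, 0 < r → ∀ θ, f (r • circlePt θ) = f (circlePt θ)) :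
    ∫ x : Fin 2 → ℝ, f x * Real.exp (-(x 0 ^ 2 + x 1 ^ 2) / 2) =
      ∫ θ in (-Real.pi)..Real.pi, f (circlePt θ) := by
  have h1 := ((volume_preserving_finTwoArrow ℝ).symm _).integral_comp
    (MeasurableEquiv.measurableEmbedding _)
    (fun x : Fin 2 → ℝ => f x * Real.exp (-(x 0 ^ 2 + x 1 ^ 2) / 2))
  rw [← h1, ← integral_comp_polarCoord_symm]
  have h2 : EqOn (fun p : ℝ × ℝ => p.1 • (f (MeasurableEquiv.finTwoArrow.symm (polarCoord.symm p)) *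
      Real.exp (-((MeasurableEquiv.finTwoArrow.symm (polarCoord.symm p) : Fin 2 → ℝ) 0 ^ 2 +
        (MeasurableEquiv.finTwoArrow.symm (polarCoord.symm p) : Fin 2 → ℝ) 1 ^ 2) / 2)))
      (fun p => p.1 * Real.exp (-p.1 ^ 2 / 2) * f (circlePt p.2)) polarCoord.target := by
    rintro ⟨r, θ⟩ hp
    have hr : 0 < r := hp.1
    have e : (MeasurableEquiv.finTwoArrow.symm (polarCoord.symm (r, θ)) : Fin 2 → ℝ) =
        r • circlePt θ := by
      ext i
      fin_cases i <;> simp [circlePt, polarCoord, MeasurableEquiv.finTwoArrow]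
    simp only [e, hf r hr]
    have e2 : (r • circlePt θ) 0 ^ 2 + (r • circlePt θ) 1 ^ 2 = r ^ 2 := by
      simp [circlePt, mul_pow, ← mul_add]
    rw [e2, smul_eq_mul]
    ring
  rw [setIntegral_congr_fun polarCoord.open_target.measurableSet h2, polarCoord_target,
    Measure.volume_eq_prod, setIntegral_prod_mul (fun r : ℝ => r * Real.exp (-r ^ 2 / 2))
      (fun θ => f (circlePt θ)),
    integral_mul_exp_neg_sq_div_two, one_mul,
    intervalIntegral.integral_of_le (by linarith [Real.pi_pos]), integral_Ioc_eq_integral_Ioo]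

theorem integral_eq_four_mul {h : ℝ → ℝ} (h1 : ∀ θ, h (-θ) = h θ)
    (h2 : ∀ θ, h (Real.pi - θ) = h θ) (hi : IntervalIntegrable h volume 0 (Real.pi / 2)) :
    ∫ θ in (-Real.pi)..Real.pi, h θ = 4 * ∫ θ in (0 : ℝ)..Real.pi / 2, h θ := by
  have i2 : IntervalIntegrable h volume (Real.pi / 2) Real.pi := by
    have := hi.comp_sub_left Real.pi
    simp only [h2, sub_zero, sub_half] at this
    exact this.symm
  have e2 : ∫ θ in (Real.pi / 2)..Real.pi, h θ = ∫ θ in (0 : ℝ)..Real.pi / 2, h θ := by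
    have := intervalIntegral.integral_comp_sub_left (a := 0) (b := Real.pi / 2) h Real.pi
    simp only [h2, sub_zero, sub_half] at this
    exact this.symm
  have i3 : IntervalIntegrable h volume 0 Real.pi := hi.trans i2
  have i4 : IntervalIntegrable h volume (-Real.pi) 0 := by
    have := i3.comp_sub_left 0
    simp only [zero_sub, neg_zero, h1] at this
    exact this.symm
  have e4 : ∫ θ in (-Real.pi)..0, h θ = ∫ θ in (0 : ℝ)..Real.pi, h θ := by
    have := intervalIntegral.integral_comp_neg (a := 0) (b := Real.pi) h
    simp only [neg_zero, h1] at this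
    exact this.symm
  rw [← intervalIntegral.integral_add_adjacent_intervals i4 i3, e4,
    ← intervalIntegral.integral_add_adjacent_intervals hi i2, e2]
  ring

theorem integral_half_pi {h f g : ℝ → ℝ}
    (hf : ∀ θ ∈ Ioo (0 : ℝ) (Real.pi / 4), h θ = f θ)
    (hg : ∀ θ ∈ Ioo (0 : ℝ) (Real.pi / 4), h (Real.pi / 2 - θ) = g θ)
    (fi : IntervalIntegrable f volume 0 (Real.pi / 4))
    (gi : IntervalIntegrable g volume 0 (Real.pi / 4)) :
    IntervalIntegrable h volume 0 (Real.pi / 2) ∧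
      ∫ θ in (0 : ℝ)..Real.pi / 2, h θ = ∫ θ in (0 : ℝ)..Real.pi / 4, (f θ + g θ) := by
  have hq : Real.pi / 2 - Real.pi / 4 = Real.pi / 4 := by ring
  have cf : ∀ {a b : ℝ → ℝ}, (∀ θ ∈ Ioo (0 : ℝ) (Real.pi / 4), a θ = b θ) →
      IntervalIntegrable b volume 0 (Real.pi / 4) →
      IntervalIntegrable a volume 0 (Real.pi / 4) ∧
        ∫ θ in (0 : ℝ)..Real.pi / 4, a θ = ∫ θ in (0 : ℝ)..Real.pi / 4, b θ := by
    intro a b hab hb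
    rw [intervalIntegrable_iff_integrableOn_Ioo_of_le quarter_pi_pos.le] at hb ⊢
    rw [intervalIntegral.integral_of_le quarter_pi_pos.le,
      intervalIntegral.integral_of_le quarter_pi_pos.le, integral_Ioc_eq_integral_Ioo,
      integral_Ioc_eq_integral_Ioo]
    exact ⟨hb.congr_fun (fun θ hθ => (hab θ hθ).symm) measurableSet_Ioo,
      setIntegral_congr_fun measurableSet_Ioo hab⟩
  obtain ⟨i1, e1⟩ := cf hf fi
  obtain ⟨i2, e2⟩ := cf hg gi
  have i3 : IntervalIntegrable h volume (Real.pi / 4) (Real.pi / 2) := by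
    have := i2.comp_sub_left (Real.pi / 2)
    simp only [sub_sub_cancel, sub_zero, hq] at this
    exact this.symm
  have e3 : ∫ θ in (Real.pi / 4)..Real.pi / 2, h θ = ∫ θ in (0 : ℝ)..Real.pi / 4, g θ := by
    rw [← e2, intervalIntegral.integral_comp_sub_left, hq, sub_zero]
  refine ⟨i1.trans i3, ?_⟩
  rw [← intervalIntegral.integral_add_adjacent_intervals i1 i3, e1, e3,
    intervalIntegral.integral_add fi gi]

theorem isArcWeight_d {k₀ k₁ : ℝ} (hp : |k₀ + k₁| < 1 / 2) (hm : |k₀ - k₁| < 1 / 2) {c : ℝ}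
    (hc : 0 < c) : IsArcWeight k₀ k₁
      (fun θ => wtTrace k₀ k₁ (d1 k₀ k₁ c) (d2 k₀ k₁ c) (Real.tan θ))
      (fun θ => wtDiff k₀ k₁ (d1 k₀ k₁ c) (d2 k₀ k₁ c) (Real.tan θ))
      (fun θ => wtOff k₀ k₁ (d1 k₀ k₁ c) (d2 k₀ k₁ c) (Real.tan θ)) :=
  isArcWeight hp hm (d1_pos hp hm hc).le (d2_pos hp hm hc).le (d_balance k₀ k₁ c)

/-- Reflection symmetry reduces the circle to four copies of a quadrant. Folding the quadrant at
`π/4` exchanges the diagonal entries, so `K₁₁` there adds up to the trace on the chamber. -/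
theorem normConst_eq {k₀ k₁ : ℝ} (hp : |k₀ + k₁| < 1 / 2) (hm : |k₀ - k₁| < 1 / 2) :
    normConst k₀ k₁ = (4 * ∫ θ in (0 : ℝ)..Real.pi / 4,
      wtTrace k₀ k₁ (d1 k₀ k₁ 1) (d2 k₀ k₁ 1) (Real.tan θ))⁻¹ := by
  have hw := isArcWeight_d hp hm one_pos
  have iT := hw.intervalIntegrable_T 0
  have iG := hw.intervalIntegrable_G 0
  simp only [pow_zero, one_mul] at iT iG
  rw [normConst, integral_polar_gaussian (fun x => weight k₀ k₁ 1 x 0 0)]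
  · have hf : ∀ θ ∈ Ioo (0 : ℝ) (Real.pi / 4), weight k₀ k₁ 1 (circlePt θ) 0 0 =
        (wtTrace k₀ k₁ (d1 k₀ k₁ 1) (d2 k₀ k₁ 1) (Real.tan θ) +
          wtDiff k₀ k₁ (d1 k₀ k₁ 1) (d2 k₀ k₁ 1) (Real.tan θ)) / 2 := by
      intro θ hθ
      have hu : circlePt θ 1 / circlePt θ 0 = Real.tan θ := by
        simp [circlePt, Real.tan_eq_sin_div_cos]
      have h := (chamberWeight_entries k₀ k₁ 1 (x := circlePt θ)
        (by rw [hu]; exact (tan_mem_Ioo hθ).1)).1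
      rwa [hu, ← weight_circlePt k₀ k₁ 1 hθ] at h
    have hg : ∀ θ ∈ Ioo (0 : ℝ) (Real.pi / 4),
        weight k₀ k₁ 1 (circlePt (Real.pi / 2 - θ)) 0 0 =
          (wtTrace k₀ k₁ (d1 k₀ k₁ 1) (d2 k₀ k₁ 1) (Real.tan θ) -
            wtDiff k₀ k₁ (d1 k₀ k₁ 1) (d2 k₀ k₁ 1) (Real.tan θ)) / 2 := by
      intro θ hθ
      have h := (chamberWeight_entries k₀ k₁ 1 (x := ![1, Real.tan θ])
        (by simpa using (tan_mem_Ioo hθ).1)).2.1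
      have hs := sin_pos_of_mem hθ
      have hcos := cos_pos_of_mem hθ
      rw [weight_zero_zero]
      simp only [circlePt, Real.cos_pi_div_two_sub, Real.sin_pi_div_two_sub, Matrix.cons_val_zero,
        Matrix.cons_val_one]
      rw [if_neg (abs_sin_lt_abs_cos hθ).le.not_gt, Real.sign_of_pos hs, abs_of_pos hs,
        abs_of_pos hcos, ← Real.tan_eq_sin_div_cos, h]
      simp
    obtain ⟨hi, he⟩ := integral_half_pi (h := fun θ => weight k₀ k₁ 1 (circlePt θ) 0 0) hf hg
      ((iT.add iG).div_const 2) ((iT.sub iG).div_const 2)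
    rw [integral_eq_four_mul _ _ hi, he]
    · congr 3
      ext θ
      ring
    · intro θ
      simp [weight_zero_zero, circlePt]
    · intro θ
      simp [weight_zero_zero, circlePt, Real.sign_neg]
  · intro r hr θ
    have hsg : Real.sign (r * Real.cos θ) = Real.sign (Real.cos θ) := by
      rcases lt_trichotomy (Real.cos θ) 0 with h | h | h
      · rw [Real.sign_of_neg h, Real.sign_of_neg (mul_neg_of_pos_of_neg hr h)]
      · rw [h, mul_zero]
      · rw [Real.sign_of_pos h, Real.sign_of_pos (mul_pos hr h)]
    simp [weight_zero_zero, circlePt, hsg, abs_mul, abs_of_pos hr, hr,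
      mul_div_mul_left _ _ hr.ne']

theorem normConst_pos {k₀ k₁ : ℝ} (hp : |k₀ + k₁| < 1 / 2) (hm : |k₀ - k₁| < 1 / 2) :
    0 < normConst k₀ k₁ := by
  have iT := (isArcWeight_d hp hm one_pos).intervalIntegrable_T 0
  simp only [pow_zero, one_mul] at iT
  obtain ⟨p1, p2⟩ := abs_lt.1 hp
  obtain ⟨m1, m2⟩ := abs_lt.1 hm
  rw [normConst_eq hp hm]
  have := intervalIntegral.intervalIntegral_pos_of_pos_on iT (fun θ hθ =>
    wtTrace_pos (k₀ := k₀) (by linarith) (by linarith) (d1_pos hp hm one_pos)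
      (d2_pos hp hm one_pos) (tan_mem_Ioo hθ)) quarter_pi_pos
  positivity

theorem four_mul_integral_wtTrace {k₀ k₁ : ℝ} (hp : |k₀ + k₁| < 1 / 2)
    (hm : |k₀ - k₁| < 1 / 2) :
    4 * (∫ θ in (0 : ℝ)..Real.pi / 4, wtTrace k₀ k₁ (d1 k₀ k₁ (normConst k₀ k₁))
      (d2 k₀ k₁ (normConst k₀ k₁)) (Real.tan θ)) = 1 := by
  have h := normConst_pos hp hm
  simp only [wtTrace_d_mul k₀ k₁ (normConst k₀ k₁), intervalIntegral.integral_const_mul]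
  rw [normConst_eq hp hm] at h ⊢
  rw [← mul_left_comm]
  exact inv_mul_cancel₀ (inv_pos.1 h).ne'

theorem formS_eq_integral {k₀ k₁ : ℝ} (hp : |k₀ + k₁| < 1 / 2) (hm : |k₀ - k₁| < 1 / 2) (n : ℕ) :
    IntervalIntegrable (fun θ : ℝ => MvPolynomial.eval (circlePt θ) phi ^ (2 * n + 1) *
        (vEval (circlePt θ) p14 ⬝ᵥ (matK k₀ k₁ (circlePt θ) *ᵥ vEval (circlePt θ) p12)))
      volume 0 (Real.pi / 4) ∧
    formS k₀ k₁ (phi ^ (2 * n + 1) • p14) p12 = 8 * ∫ θ in (0 : ℝ)..(Real.pi / 4),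
      MvPolynomial.eval (circlePt θ) phi ^ (2 * n + 1) *
        (vEval (circlePt θ) p14 ⬝ᵥ (matK k₀ k₁ (circlePt θ) *ᵥ vEval (circlePt θ) p12)) := by
  have hw := isArcWeight_d hp hm (normConst_pos hp hm)
  have iG := hw.intervalIntegrable_G (2 * n + 1)
  have iT := hw.intervalIntegrable_T (2 * n + 2)
  have hi := (iG.sub iT).const_mul (1 / 2)
  constructor
  · rw [intervalIntegrable_iff_integrableOn_Ioo_of_le quarter_pi_pos.le] at hi ⊢
    exact hi.congr_fun (fun θ hθ => (integrand_eq k₀ k₁ n hθ).symm) measurableSet_Ioo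
  · rw [hw.formS_eq (four_mul_integral_wtTrace hp hm) n, ← intervalIntegral.integral_sub iG iT,
      intervalIntegral.integral_of_le quarter_pi_pos.le,
      intervalIntegral.integral_of_le quarter_pi_pos.le, integral_Ioc_eq_integral_Ioo,
      integral_Ioc_eq_integral_Ioo,
      setIntegral_congr_fun measurableSet_Ioo fun θ hθ => integrand_eq k₀ k₁ n hθ,
      integral_const_mul]
    ring

/-! ### Asymptotics of the moments -/

/-- Laplace's method in comparative form. Because `C` decreases, the mass of `C^n w` moves to `0`,
where `f` is close to `L w`. What remains is at most a constant times `C(δ)^n`, negligible by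
`hsmall`. -/
theorem tendsto_integral_div_of_peak {C w f : ℝ → ℝ} {a L : ℝ} (ha : 0 < a) (hC : Continuous C)
    (anti : AntitoneOn C (Icc 0 a)) (C0 : ∀ θ ∈ Icc 0 a, 0 ≤ C θ)
    (wi : IntervalIntegrable w volume 0 a) (fi : IntervalIntegrable f volume 0 a)
    (w0 : ∀ θ ∈ Ioo 0 a, 0 < w θ) (hpos : ∀ n : ℕ, 0 < ∫ θ in (0 : ℝ)..a, C θ ^ n * w θ)
    (hsmall : ∀ δ ∈ Ioo 0 a,
      Tendsto (fun n : ℕ => C δ ^ n / ∫ θ in (0 : ℝ)..a, C θ ^ n * w θ) atTop (𝓝 0))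
    (hlim : Tendsto (fun θ => f θ / w θ) (𝓝[>] 0) (𝓝 L)) :
    Tendsto (fun n : ℕ => (∫ θ in (0 : ℝ)..a, C θ ^ n * f θ) /
      ∫ θ in (0 : ℝ)..a, C θ ^ n * w θ) atTop (𝓝 L) := by
  have ri : IntervalIntegrable (fun θ => f θ - L * w θ) volume 0 a := fi.sub (wi.const_mul L)
  have iw : ∀ n : ℕ, IntervalIntegrable (fun θ => C θ ^ n * w θ) volume 0 a := fun n =>
    wi.continuousOn_mul (hC.pow n).continuousOn
  have if' : ∀ n : ℕ, IntervalIntegrable (fun θ => C θ ^ n * f θ) volume 0 a := fun n =>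
    fi.continuousOn_mul (hC.pow n).continuousOn
  rw [Metric.tendsto_atTop]
  intro ε hε
  have hev := Metric.tendsto_nhds.1 hlim (ε / 2) (half_pos hε)
  obtain ⟨b, hb, hbs⟩ := (mem_nhdsGT_iff_exists_Ioo_subset).1 hev
  have hb0 : 0 < b := hb
  set δ := min b a / 2 with hδ
  have hm : 0 < min b a := lt_min hb0 ha
  have hδ0 : 0 < δ := half_pos hm
  have hδb : δ < b := (half_lt_self hm).trans_le (min_le_left _ _)
  have hδa : δ < a := (half_lt_self hm).trans_le (min_le_right _ _)
  set A := ∫ θ in (0 : ℝ)..a, |f θ - L * w θ| with hA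
  have hs := (hsmall δ ⟨hδ0, hδa⟩).mul_const A
  rw [zero_mul] at hs
  obtain ⟨N, hN⟩ := Metric.tendsto_atTop.1 hs (ε / 2) (half_pos hε)
  refine ⟨N, fun n hn => ?_⟩
  have hI := hpos n
  have h1 := (abs_lt.1 (by simpa only [Real.dist_eq, sub_zero] using hN n hn)).2
  have e1 : (∫ θ in (0 : ℝ)..a, C θ ^ n * (f θ - L * w θ)) =
      (∫ θ in (0 : ℝ)..a, C θ ^ n * f θ) - L * ∫ θ in (0 : ℝ)..a, C θ ^ n * w θ := by
    rw [← intervalIntegral.integral_const_mul,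
      ← intervalIntegral.integral_sub (if' n) ((iw n).const_mul L)]
    congr 1
    ext θ
    ring
  -- One majorant for both regimes: the first summand handles `θ < b`, where `|f - L w| < (ε/2) w`,
  -- and the second handles `θ ≥ b > δ`, where `C θ ≤ C δ`.
  have h2 : ‖∫ θ in (0 : ℝ)..a, C θ ^ n * (f θ - L * w θ)‖ ≤
      ∫ θ in (0 : ℝ)..a, (ε / 2 * (C θ ^ n * w θ) + C δ ^ n * |f θ - L * w θ|) := by
    refine intervalIntegral.norm_integral_le_of_norm_le ha.le ?_
      (((iw n).const_mul _).add (ri.abs.const_mul _))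
    have hne : ∀ᵐ θ : ℝ, θ ≠ a := by simp [ae_iff]
    refine hne.mono fun θ hθa hθ => ?_
    have hθ' : θ ∈ Ioo 0 a := ⟨hθ.1, lt_of_le_of_ne hθ.2 hθa⟩
    have hCθ := C0 θ ⟨hθ.1.le, hθ.2⟩
    have hw := w0 θ hθ'
    rw [Real.norm_eq_abs, abs_mul, abs_of_nonneg (pow_nonneg hCθ n)]
    rcases lt_or_ge θ b with h | h
    · have hd : dist (f θ / w θ) L < ε / 2 := hbs ⟨hθ.1, h⟩
      rw [Real.dist_eq, div_sub' hw.ne', abs_div, abs_of_pos hw,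
        div_lt_iff₀ hw] at hd
      rw [mul_comm L]
      have h3 := mul_le_mul_of_nonneg_left hd.le (pow_nonneg hCθ n)
      have h4 : 0 ≤ C δ ^ n * |f θ - w θ * L| :=
        mul_nonneg (pow_nonneg (C0 δ ⟨hδ0.le, hδa.le⟩) n) (abs_nonneg _)
      linarith
    · have h3 := mul_le_mul_of_nonneg_right (pow_le_pow_left₀ hCθ
        (anti ⟨hδ0.le, hδa.le⟩ ⟨hθ.1.le, hθ.2⟩ (hδb.le.trans h)) n) (abs_nonneg (f θ - L * w θ))
      have h4 : 0 ≤ ε / 2 * (C θ ^ n * w θ) := by positivity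
      linarith
  rw [intervalIntegral.integral_add ((iw n).const_mul _) (ri.abs.const_mul _),
    intervalIntegral.integral_const_mul, intervalIntegral.integral_const_mul, ← hA, e1,
    Real.norm_eq_abs] at h2
  rw [Real.dist_eq, div_sub' hI.ne', abs_div, abs_of_pos hI, div_lt_iff₀ hI, mul_comm _ L]
  refine h2.trans_lt ?_
  rw [div_mul_eq_mul_div, div_lt_iff₀ hI] at h1
  linarith

/-- The weight `cos 2θ (sin 2θ)^{2s-1}`. -/
def arcPower (s θ : ℝ) : ℝ := Real.cos (2 * θ) * Real.sin (2 * θ) ^ (2 * s - 1)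

theorem arcPower_pos (s : ℝ) {θ : ℝ} (hθ : θ ∈ Ioo (0 : ℝ) (Real.pi / 4)) : 0 < arcPower s θ :=
  mul_pos (cos_two_mul_pos hθ) (Real.rpow_pos_of_pos (sin_two_mul_pos hθ) _)

theorem hasDerivAt_sin_rpow (s : ℝ) {θ : ℝ} (hθ : θ ∈ Ioo (0 : ℝ) (Real.pi / 4)) :
    HasDerivAt (fun θ => Real.sin (2 * θ) ^ (2 * s)) (4 * s * arcPower s θ) θ := by
  refine ((hasDerivAt_sin_two_mul θ).rpow_const (Or.inl (sin_two_mul_pos hθ).ne')).congr_deriv ?_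
  rw [arcPower]
  ring

theorem continuous_sin_rpow {s : ℝ} (hs : 0 < s) :
    Continuous (fun θ : ℝ => Real.sin (2 * θ) ^ (2 * s)) :=
  (by fun_prop : Continuous fun θ : ℝ => Real.sin (2 * θ)).rpow_const
    fun _ => Or.inr (by positivity)

/-- The exponent `2s - 1` may be negative. Up to the factor `4s` the function is the nonnegative
derivative of the continuous `(sin 2θ)^(2s)`, hence integrable. -/
theorem intervalIntegrable_arcPower {s : ℝ} (hs : 0 < s) :
    IntervalIntegrable (arcPower s) volume 0 (Real.pi / 4) := by
  have h := intervalIntegral.intervalIntegrable_deriv_of_nonneg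
    (g' := fun θ => 4 * s * arcPower s θ) (a := 0) (b := Real.pi / 4)
    (continuous_sin_rpow hs).continuousOn
    (fun θ hθ => hasDerivAt_sin_rpow s (by
      rwa [min_eq_left quarter_pi_pos.le, max_eq_right quarter_pi_pos.le] at hθ))
    (fun θ hθ => by
      rw [min_eq_left quarter_pi_pos.le, max_eq_right quarter_pi_pos.le] at hθ
      have := arcPower_pos s hθ
      positivity)
  have h2 := h.const_mul (4 * s)⁻¹
  refine h2.congr fun θ _ => ?_
  field_simp

/-- The moments of `arcPower`. -/
def arcMoment (s : ℝ) (n : ℕ) : ℝ :=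
  ∫ θ in (0 : ℝ)..Real.pi / 4, (Real.cos (2 * θ) ^ 2) ^ n * arcPower s θ

theorem intervalIntegrable_arcMoment {s : ℝ} (hs : 0 < s) (n : ℕ) :
    IntervalIntegrable (fun θ => (Real.cos (2 * θ) ^ 2) ^ n * arcPower s θ) volume 0
      (Real.pi / 4) :=
  (intervalIntegrable_arcPower hs).continuousOn_mul (by fun_prop)

theorem arcMoment_zero {s : ℝ} (hs : 0 < s) : 4 * s * arcMoment s 0 = 1 := by
  have key := intervalIntegral.integral_eq_sub_of_hasDerivAt_of_tendsto quarter_pi_pos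
    (fun θ hθ => hasDerivAt_sin_rpow s hθ) ((intervalIntegrable_arcPower hs).const_mul _)
    ((continuous_sin_rpow hs).tendsto 0 |>.mono_left nhdsWithin_le_nhds)
    ((continuous_sin_rpow hs).tendsto (Real.pi / 4) |>.mono_left nhdsWithin_le_nhds)
  rw [intervalIntegral.integral_const_mul] at key
  rw [arcMoment]
  simp only [pow_zero, one_mul]
  rw [key, show 2 * (Real.pi / 4) = Real.pi / 2 by ring, mul_zero, Real.sin_zero,
    Real.sin_pi_div_two, Real.one_rpow, Real.zero_rpow (by positivity), sub_zero]

/-- Integrate the derivative of `cos^(2n+2)(2θ) (sin 2θ)^(2s)`, which vanishes at both ends. -/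
theorem arcMoment_succ {s : ℝ} (hs : 0 < s) (n : ℕ) :
    (s + (n + 1)) * arcMoment s (n + 1) = (n + 1) * arcMoment s n := by
  have i1 := (intervalIntegrable_arcMoment hs (n + 1)).const_mul (4 * (s + (n + 1)))
  have i2 := (intervalIntegrable_arcMoment hs n).const_mul (4 * (n + 1))
  have hcont : Continuous fun θ : ℝ =>
      Real.cos (2 * θ) ^ (2 * (n + 1)) * Real.sin (2 * θ) ^ (2 * s) :=
    (by fun_prop : Continuous fun θ : ℝ => Real.cos (2 * θ) ^ (2 * (n + 1))).mul
      (continuous_sin_rpow hs)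
  have key := intervalIntegral.integral_eq_sub_of_hasDerivAt_of_tendsto quarter_pi_pos
    (f := fun θ => Real.cos (2 * θ) ^ (2 * (n + 1)) * Real.sin (2 * θ) ^ (2 * s))
    (fun θ hθ => ?_) (i1.sub i2)
    (hcont.tendsto 0 |>.mono_left nhdsWithin_le_nhds)
    (hcont.tendsto (Real.pi / 4) |>.mono_left nhdsWithin_le_nhds)
  · rw [intervalIntegral.integral_sub i1 i2, intervalIntegral.integral_const_mul,
      intervalIntegral.integral_const_mul] at key
    rw [show 2 * (Real.pi / 4) = Real.pi / 2 by ring, mul_zero, Real.sin_zero,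
      Real.cos_pi_div_two, Real.zero_rpow (by positivity), zero_pow (by positivity), mul_zero,
      zero_mul, sub_zero] at key
    simp only [arcMoment]
    linarith
  · have hsin := sin_two_mul_pos hθ
    refine (((hasDerivAt_cos_two_mul θ).pow (2 * (n + 1))).mul
      (hasDerivAt_sin_rpow s hθ)).congr_deriv ?_
    have e : Real.sin (2 * θ) ^ (2 * s) = Real.sin (2 * θ) ^ (2 * s - 1) * Real.sin (2 * θ) := by
      rw [← Real.rpow_add_one hsin.ne']
      congr 1
      ring
    have e2 := Real.sin_sq_add_cos_sq (2 * θ)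
    simp only [Pi.pow_apply, arcPower]
    rw [e, show 2 * (n + 1) - 1 = 2 * n + 1 by omega, ← pow_mul, ← pow_mul]
    push_cast
    linear_combination (-4 * (n + 1) * Real.cos (2 * θ) ^ (2 * n + 1) *
      Real.sin (2 * θ) ^ (2 * s - 1)) * e2

/-- The recurrence gives `arcMoment s n = n! / (4 s (s+1) ⋯ (s+n))`, which is a quarter of Euler's
sequence for `Γ(s)` without its factor `n^s`. -/
theorem rpow_mul_arcMoment {s : ℝ} (hs : 0 < s) (n : ℕ) :
    (n : ℝ) ^ s * arcMoment s n = 1 / 4 * Real.GammaSeq s n := by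
  have h : arcMoment s n * ∏ j ∈ Finset.range (n + 1), (s + j) = 1 / 4 * (n.factorial : ℝ) := by
    induction n with
    | zero =>
      have := arcMoment_zero hs
      simp
      linarith
    | succ n ih =>
      have := arcMoment_succ hs n
      rw [Finset.prod_range_succ, Nat.factorial_succ]
      push_cast
      linear_combination (∏ j ∈ Finset.range (n + 1), (s + j)) * this + (n + 1) * ih
  have hp : ∏ j ∈ Finset.range (n + 1), (s + (j : ℝ)) ≠ 0 :=
    Finset.prod_ne_zero_iff.2 fun j _ => by positivity
  rw [Real.GammaSeq]
  field_simp
  linear_combination 4 * (n : ℝ) ^ s * h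

theorem tendsto_rpow_mul_arcMoment {s : ℝ} (hs : 0 < s) :
    Tendsto (fun n : ℕ => (n : ℝ) ^ s * arcMoment s n) atTop (𝓝 (1 / 4 * Real.Gamma s)) := by
  simp only [rpow_mul_arcMoment hs]
  exact (Real.GammaSeq_tendsto_Gamma s).const_mul _

theorem arcMoment_pos {s : ℝ} (hs : 0 < s) (n : ℕ) : 0 < arcMoment s n := by
  induction n with
  | zero => exact pos_of_mul_pos_right (by rw [arcMoment_zero hs]; exact one_pos) (by positivity)
  | succ n ih =>
    exact pos_of_mul_pos_right (by rw [arcMoment_succ hs]; positivity)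
      (show 0 ≤ s + ((n : ℝ) + 1) by positivity)

theorem tendsto_pow_div_arcMoment {s : ℝ} (hs : 0 < s) (hs1 : s ≤ 1) {q : ℝ} (hq : 0 ≤ q)
    (hq1 : q < 1) : Tendsto (fun n : ℕ => q ^ n / arcMoment s n) atTop (𝓝 0) := by
  have h1 : Tendsto (fun n : ℕ => (n : ℝ) ^ s * q ^ n) atTop (𝓝 0) := by
    refine squeeze_zero' (Eventually.of_forall fun n => by positivity) ?_
      (tendsto_self_mul_const_pow_of_lt_one hq hq1)
    filter_upwards [eventually_ge_atTop 1] with n hn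
    have hn' : (1 : ℝ) ≤ n := by exact_mod_cast hn
    refine mul_le_mul_of_nonneg_right ?_ (pow_nonneg hq n)
    calc (n : ℝ) ^ s ≤ (n : ℝ) ^ (1 : ℝ) := Real.rpow_le_rpow_of_exponent_le hn' hs1
      _ = n := Real.rpow_one _
  have hg : 1 / 4 * Real.Gamma s ≠ 0 := by
    have := Real.Gamma_pos_of_pos hs
    positivity
  have h := h1.div (tendsto_rpow_mul_arcMoment hs) hg
  rw [zero_div] at h
  refine h.congr' ?_
  filter_upwards [eventually_ge_atTop 1] with n hn
  have hn' : (0 : ℝ) < (n : ℝ) ^ s := Real.rpow_pos_of_pos (by exact_mod_cast hn) _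
  simp only [Pi.div_apply]
  rw [mul_div_mul_left _ _ hn'.ne']

/-- The behaviour at the wall `θ = 0` of the density of the moments. -/
theorem tendsto_density {k₀ k₁ D₁ D₂ : ℝ} (hc : 0 < k₁ + 1 / 2) (hc' : 0 < -k₁ + 1 / 2) :
    Tendsto (fun θ => Real.sin (2 * θ) ^ (2 * k₁) *
      (wtDiff k₀ k₁ D₁ D₂ (Real.tan θ) - Real.cos (2 * θ) * wtTrace k₀ k₁ D₁ D₂ (Real.tan θ)))
      (𝓝[>] 0) (𝓝 (-(2 * (2 ^ (2 * k₁) * D₂)))) := by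
  obtain ⟨A, hA, tA⟩ := exists_rowFst_eq k₀ hc
  obtain ⟨B, x, hB, tB⟩ := exists_rowSnd_eq k₀ hc
  obtain ⟨A', hA', tA'⟩ := exists_rowFst_eq k₀ hc'
  obtain ⟨B', x', hB', tB'⟩ := exists_rowSnd_eq k₀ hc'
  have tc : Tendsto (fun θ => Real.cos θ ^ 2) (𝓝[>] 0) (𝓝 1) := by
    have h : Continuous fun θ => Real.cos θ ^ 2 := by fun_prop
    have := (h.tendsto 0).mono_left (nhdsWithin_le_nhds (s := Ioi 0))
    simpa using this
  have tcp : Tendsto (fun θ => (Real.cos θ ^ 2) ^ (2 * k₁)) (𝓝[>] 0) (𝓝 1) := by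
    have h := tc.rpow_const (p := 2 * k₁) (Or.inl one_ne_zero)
    rwa [Real.one_rpow] at h
  -- With `u = tan θ` and `cos² θ = 1/(1 + u²)`, the bracket equals `2 cos² θ (D₁ (u² a² - b²) - D₂
  -- (a'² - u² b'²))`, where `(a, b)` and `(a', b')` are the values at `k₁` and `-k₁`. After
  -- multiplication by `u^(2k₁)` the `D₁` part is of order `u^(4k₁+2)` and vanishes in the limit;
  -- the `D₂` part tends to `-D₂`.
  have tu : Tendsto (fun u => D₁ * (u ^ (4 * k₁ + 2) * (A u ^ 2 - B u ^ 2)) -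
      D₂ * (A' u ^ 2 - u ^ 4 * B' u ^ 2)) (𝓝[>] 0) (𝓝 (-D₂)) := by
    have h := (((tendsto_rpow_zero (show 0 < 4 * k₁ + 2 by linarith)).mul
      ((tA.pow 2).sub (tB.pow 2))).const_mul D₁).sub
      (((tA'.pow 2).sub ((tendsto_id_zero.pow 4).mul (tB'.pow 2))).const_mul D₂)
    simpa using h
  have h := (((tcp.mul tc).mul (tu.comp tendsto_tan_zero)).const_mul (2 * 2 ^ (2 * k₁)))
  rw [show 2 * 2 ^ (2 * k₁) * (1 * 1 * -D₂) = -(2 * (2 ^ (2 * k₁) * D₂)) by ring] at h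
  refine h.congr' ?_
  filter_upwards [IsArcWeight.eventually_zero] with θ hθ
  have hcos := cos_pos_of_mem hθ
  have ht := (tan_mem_Ioo hθ).1
  have e2 := Real.inv_one_add_tan_sq hcos.ne'
  rw [sin_two_mul_eq_tan hcos.ne', cos_two_mul_eq_tan hcos.ne', Function.comp_apply]
  generalize Real.tan θ = u at *
  generalize Real.cos θ ^ 2 = c at *
  have hc2 : c * (1 + u ^ 2) = 1 := by
    rw [← e2]
    exact inv_mul_cancel₀ (by positivity)
  have hc0 : 0 ≤ c := by
    rw [← e2]
    positivity
  have q1 : u ^ (4 * k₁ + 2) = u ^ (2 * k₁) * (u ^ k₁ * u ^ k₁) * u ^ 2 := by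
    rw [← Real.rpow_add ht, ← Real.rpow_add ht, ← Real.rpow_two, ← Real.rpow_add ht]
    congr 1
    ring
  have q2 : u ^ (2 * k₁) * (u ^ (-k₁) * u ^ (-k₁)) = 1 := by
    rw [← Real.rpow_add ht, ← Real.rpow_add ht, ← Real.rpow_zero u]
    congr 1
    ring
  rw [Real.mul_rpow (by positivity) hc0, Real.mul_rpow two_pos.le ht.le, q1]
  simp only [wtDiff, wtTrace, hA, hB, hA', hB']
  generalize u ^ k₁ = y
  generalize u ^ (-k₁) = z at *
  generalize u ^ (2 * k₁) = t at *
  generalize c ^ (2 * k₁) = v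
  generalize (2 : ℝ) ^ (2 * k₁) = w
  linear_combination (2 * w * v * c * D₂ * (A' u ^ 2 - u ^ 4 * B' u ^ 2)) * q2 +
    w * t * v * (D₁ * ((y * A u) ^ 2 - (y * (u * B u)) ^ 2) -
      D₂ * ((z * A' u) ^ 2 - (z * (u * B' u)) ^ 2)) * hc2

/-- The peak is `C = cos²(2θ)`, with one `cos 2θ` of the odd power kept in both densities. The
choice `s = 1/2 - k₁` makes the comparison density `cos(2θ) (sin 2θ)^(-2k₁)`, matching
`tendsto_density`. -/
theorem tendsto_formS_div {k₀ k₁ : ℝ} (hp : |k₀ + k₁| < 1 / 2) (hm : |k₀ - k₁| < 1 / 2) :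
    Tendsto (fun n : ℕ => formS k₀ k₁ (phi ^ (2 * n + 1) • p14) p12 / arcMoment (1 / 2 - k₁) n)
      atTop (𝓝 (4 * -(2 * (2 ^ (2 * k₁) * d2 k₀ k₁ (normConst k₀ k₁))))) := by
  have hw := isArcWeight_d hp hm (normConst_pos hp hm)
  have hT := four_mul_integral_wtTrace hp hm
  obtain ⟨p1, p2⟩ := abs_lt.1 hp
  obtain ⟨m1, m2⟩ := abs_lt.1 hm
  have hs : 0 < 1 / 2 - k₁ := by linarith
  have hdens := tendsto_density (k₀ := k₀) (k₁ := k₁) (D₁ := d1 k₀ k₁ (normConst k₀ k₁))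
    (D₂ := d2 k₀ k₁ (normConst k₀ k₁)) (by linarith) (by linarith)
  have h := (tendsto_integral_div_of_peak (C := fun θ => Real.cos (2 * θ) ^ 2)
    (w := arcPower (1 / 2 - k₁)) (f := fun θ => Real.cos (2 * θ) *
      (wtDiff k₀ k₁ (d1 k₀ k₁ (normConst k₀ k₁)) (d2 k₀ k₁ (normConst k₀ k₁)) (Real.tan θ) -
        Real.cos (2 * θ) *
          wtTrace k₀ k₁ (d1 k₀ k₁ (normConst k₀ k₁)) (d2 k₀ k₁ (normConst k₀ k₁)) (Real.tan θ)))
    quarter_pi_pos (by fun_prop) ?_ (fun θ _ => sq_nonneg _) (intervalIntegrable_arcPower hs) ?_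
    (fun θ hθ => arcPower_pos _ hθ) (arcMoment_pos hs) (fun δ hδ => ?_)
    (hdens.congr' ?_)).const_mul 4
  · refine h.congr fun n => ?_
    rw [hw.formS_eq hT n, ← intervalIntegral.integral_sub (hw.intervalIntegrable_G _)
      (hw.intervalIntegrable_T _), ← arcMoment, ← mul_div_assoc]
    congr 3
    ext θ
    ring
  · intro x hx y hy hxy
    have h1 : 0 ≤ Real.cos (2 * y) :=
      Real.cos_nonneg_of_mem_Icc ⟨by linarith [hy.1, Real.pi_pos], by linarith [hy.2]⟩
    exact pow_le_pow_left₀ h1 (Real.cos_le_cos_of_nonneg_of_le_pi (by linarith [hx.1])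
      (by linarith [hy.2, Real.pi_pos]) (by linarith)) 2
  · have i1 := hw.intervalIntegrable_G 0
    have i2 := hw.intervalIntegrable_T 1
    simp only [pow_zero, pow_one, one_mul] at i1 i2
    exact (i1.sub i2).continuousOn_mul (by fun_prop)
  · refine tendsto_pow_div_arcMoment hs (by linarith) (sq_nonneg _) ?_
    have := Real.sin_sq_add_cos_sq (2 * δ)
    have := pow_pos (sin_two_mul_pos hδ) 2
    linarith
  · filter_upwards [IsArcWeight.eventually_zero] with θ hθ
    have hsin := Real.rpow_pos_of_pos (sin_two_mul_pos hθ) (2 * k₁)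
    have hcos := cos_two_mul_pos hθ
    rw [arcPower, show 2 * (1 / 2 - k₁) - 1 = -(2 * k₁) by ring,
      Real.rpow_neg (sin_two_mul_pos hθ).le]
    field_simp

theorem tendsto_formS {k₀ k₁ : ℝ} (hp : |k₀ + k₁| < 1 / 2) (hm : |k₀ - k₁| < 1 / 2) :
    Tendsto (fun n : ℕ => formS k₀ k₁ (phi ^ (2 * n + 1) • p14) p12 /
      (-(2 * Real.pi * normConst k₀ k₁) / (Real.cos (Real.pi * k₀) * Real.cos (Real.pi * k₁)) *
        ((2 : ℝ) ^ (2 * k₁) * (n : ℝ) ^ (k₁ - 1 / 2) * Real.Gamma (1 / 2 + k₁) /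
          (Real.Gamma (1 / 2 + k₀ + k₁) * Real.Gamma (1 / 2 - k₀ + k₁))))) atTop (𝓝 1) := by
  obtain ⟨p1, p2⟩ := abs_lt.1 hp
  obtain ⟨m1, m2⟩ := abs_lt.1 hm
  have hs : 0 < 1 / 2 - k₁ := by linarith
  have hd := d2_pos hp hm (normConst_pos hp hm)
  have hg := Real.Gamma_pos_of_pos hs
  have h2 : (0 : ℝ) < 2 ^ (2 * k₁) := Real.rpow_pos_of_pos two_pos _
  set K := -(2 * 2 ^ (2 * k₁) * d2 k₀ k₁ (normConst k₀ k₁) * Real.Gamma (1 / 2 - k₁)) with hK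
  have hK0 : K ≠ 0 := neg_ne_zero.2 (by positivity)
  have h := ((tendsto_formS_div hp hm).mul (tendsto_rpow_mul_arcMoment hs)).div_const K
  have e : 4 * -(2 * (2 ^ (2 * k₁) * d2 k₀ k₁ (normConst k₀ k₁))) *
      (1 / 4 * Real.Gamma (1 / 2 - k₁)) / K = 1 := by
    rw [div_eq_one_iff_eq hK0, hK]
    ring
  rw [e] at h
  refine h.congr' ?_
  filter_upwards [eventually_ge_atTop 1] with n hn
  have hn' : (0 : ℝ) < n := by exact_mod_cast hn
  have hm := arcMoment_pos hs n
  -- The reflection formula `Γ(1/2 + k₁) Γ(1/2 - k₁) = π / cos(π k₁)` absorbs the factor `Γ(1/2 -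
  -- k₁)` coming from the moments and one of the two factors `Γ(1/2 + k₁)` in `d₂`.
  have hrefl := Real.Gamma_mul_Gamma_one_sub (1 / 2 + k₁)
  rw [show 1 - (1 / 2 + k₁) = 1 / 2 - k₁ by ring,
    show Real.pi * (1 / 2 + k₁) = Real.pi * k₁ + Real.pi / 2 by ring, Real.sin_add_pi_div_two]
    at hrefl
  have hcos : Real.cos (Real.pi * k₁) ≠ 0 := by
    have := Real.pi_pos
    exact (Real.cos_pos_of_mem_Ioo ⟨by nlinarith, by nlinarith⟩).ne'
  have hden : -(2 * Real.pi * normConst k₀ k₁) /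
      (Real.cos (Real.pi * k₀) * Real.cos (Real.pi * k₁)) *
        ((2 : ℝ) ^ (2 * k₁) * (n : ℝ) ^ (k₁ - 1 / 2) * Real.Gamma (1 / 2 + k₁) /
          (Real.Gamma (1 / 2 + k₀ + k₁) * Real.Gamma (1 / 2 - k₀ + k₁))) =
      K * (n : ℝ) ^ (k₁ - 1 / 2) := by
    rw [eq_div_iff hcos] at hrefl
    rw [hK, d2]
    generalize Real.cos (Real.pi * k₀) = c₀
    generalize Real.cos (Real.pi * k₁) = c₁ at hcos hrefl ⊢
    generalize Real.Gamma (1 / 2 - k₁) = g at hrefl ⊢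
    generalize Real.Gamma (1 / 2 + k₀ + k₁) = g₁
    generalize Real.Gamma (1 / 2 - k₀ + k₁) = g₂
    rw [← hrefl]
    field_simp
  rw [hden, show k₁ - 1 / 2 = -(1 / 2 - k₁) by ring, Real.rpow_neg hn'.le]
  have hpn := Real.rpow_pos_of_pos hn' (1 / 2 - k₁)
  generalize arcMoment (1 / 2 - k₁) n = μ at hm ⊢
  generalize (n : ℝ) ^ (1 / 2 - k₁) = ν at hpn ⊢
  field_simp

end DunklB2

end

/-! ### The main theorem. -/

theorem mainTheorem7 (k₀ k₁ : ℝ)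
    (hp : -(1 / 2) < k₀ + k₁ ∧ k₀ + k₁ < 1 / 2)
    (hm : -(1 / 2) < k₀ - k₁ ∧ k₀ - k₁ < 1 / 2) :
    (∀ n : ℕ,
      IntervalIntegrable
        (fun θ : ℝ => MvPolynomial.eval (DunklB2.circlePt θ) DunklB2.phi ^ (2 * n + 1) *
          (DunklB2.vEval (DunklB2.circlePt θ) DunklB2.p14 ⬝ᵥ
            (DunklB2.matK k₀ k₁ (DunklB2.circlePt θ) *ᵥ
              DunklB2.vEval (DunklB2.circlePt θ) DunklB2.p12)))
        MeasureTheory.volume 0 (Real.pi / 4) ∧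
      DunklB2.formS k₀ k₁ (DunklB2.phi ^ (2 * n + 1) • DunklB2.p14) DunklB2.p12 =
        8 * ∫ θ in (0 : ℝ)..(Real.pi / 4),
          MvPolynomial.eval (DunklB2.circlePt θ) DunklB2.phi ^ (2 * n + 1) *
            (DunklB2.vEval (DunklB2.circlePt θ) DunklB2.p14 ⬝ᵥ
              (DunklB2.matK k₀ k₁ (DunklB2.circlePt θ) *ᵥ
                DunklB2.vEval (DunklB2.circlePt θ) DunklB2.p12))) ∧
    Filter.Tendsto
      (fun n : ℕ =>
        DunklB2.formS k₀ k₁ (DunklB2.phi ^ (2 * n + 1) • DunklB2.p14) DunklB2.p12 /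
          (-(2 * Real.pi * DunklB2.normConst k₀ k₁) /
              (Real.cos (Real.pi * k₀) * Real.cos (Real.pi * k₁)) *
            ((2 : ℝ) ^ (2 * k₁) * (n : ℝ) ^ (k₁ - 1 / 2) * Real.Gamma (1 / 2 + k₁) /
              (Real.Gamma (1 / 2 + k₀ + k₁) * Real.Gamma (1 / 2 - k₀ + k₁)))))
      Filter.atTop (nhds 1) := by
  have hp' : |k₀ + k₁| < 1 / 2 := abs_lt.2 hp
  have hm' : |k₀ - k₁| < 1 / 2 := abs_lt.2 hm
  exact ⟨fun n => DunklB2.formS_eq_integral hp' hm' n, DunklB2.tendsto_formS hp' hm'⟩
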